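/- Let $\Gamma_1(x,t)=(4\pi t)^{-1/2}e^{-x^2/(4t)}$ for $t>0$ and $\Gamma_1(x,t)=0$ for $t\le 0$ be the one-dimensional heat kernel. Fix a real-valued $\varphi\in C^\infty(\mathbb R)$ supported in an annulus $\{a\le|\xi|\le b\}$, $0<a<b<\infty$, with $\sum_{j\in\mathbb Z}\varphi(2^{-j}\xi)=1$ for every $\xi\ne0$. Put $h(t)=\frac1{2\pi}\int_{\mathbb R}e^{i\xi t}\varphi(\xi)\,d\xi$, and let $\Delta_jg(t)=2^j\int_{\mathbb R}h(2^j(t-s))g(s)\,ds$ be the Littlewood–Paley operators. For $\sigma\in\mathbb R$ and $1\le q<\infty$ let $$\|g\|_{\dot B^{\sigma}_{q,q}(\mathbb R)}=\Big(\sum_{j\in\mathbb Z}2^{qj\sigma}\|\Delta_jg\|_{L^q(\mathbb R)}^q\Big)^{1/q}\in[0,\infty].$$ Let $1\le q<\infty$. There is a finite constant $C$, depending only on $q$ and $\varphi$, such that the following holds. Let $g:\mathbb R\to\mathbb C$ be a measurable function such that $(1+|s|)^{-N}g(s)$ is integrable on $\mathbb R$ for some $N\in\mathbb N$, and such that the integral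 $$f(x,t)=\int_{\mathbb R}\Gamma_1(x,t-s)\,g(s)\,ds$$ converges absolutely for all $x>0$ and $t\in\mathbb R$. Then $f(\cdot,t)\in C^2((0,\infty))$ for every $t\in\mathbb R$, the function $\partial_x^2f$ is measurable on $\mathbb R_+\times\mathbb R$, and $$\|g\|_{\dot B^{\frac12-\frac1{2q}}_{q,q}(\mathbb R)}\le C\,\|\partial_x^2f\|_{L^q(\mathbb R_+\times\mathbb R)}\quad\text{and}\quad\|\partial_x^2f\|_{L^q(\mathbb R_+\times\mathbb R)}\le C\,\|g\|_{\dot B^{\frac12-\frac1{2q}}_{q,q}(\mathbb R)},$$ where both norms take values in $[0,\infty]$; in particular, one of them is finite if and only if the other is. -/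

import Mathlib

open MeasureTheory Set
open scoped ENNReal NNReal ContDiff

/-- The one-dimensional heat kernel `Γ₁(x, t)`, extended by `0` to `t ≤ 0`. -/
noncomputable def heatKernel (x t : ℝ) : ℝ :=
  if 0 < t then (Real.sqrt (4 * Real.pi * t))⁻¹ * Real.exp (-x ^ 2 / (4 * t)) else 0

/-- `f(x, t) = ∫ Γ₁(x, t - s) g(s) ds`. -/
noncomputable def heatExtension (g : ℝ → ℂ) (x t : ℝ) : ℂ :=
  ∫ s : ℝ, (heatKernel x (t - s) : ℂ) * g s

/-- The second derivative in `x` of the heat extension, as a function of the pair `(x, t)`. -/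
noncomputable def heatExtensionXX (g : ℝ → ℂ) (p : ℝ × ℝ) : ℂ :=
  iteratedDeriv 2 (fun x : ℝ => heatExtension g x p.2) p.1

/-- A measurable function that is integrable against some negative power of `1 + |s|`. Such a
function is locally integrable and defines a tempered distribution. -/
def IsTemperedFunction (g : ℝ → ℂ) : Prop :=
  ∃ N : ℕ, Integrable (fun s : ℝ => (((1 + |s|) ^ N)⁻¹ : ℝ) • g s)

/-- `φ` is the symbol of a homogeneous Littlewood-Paley decomposition of the line: it is smooth,
supported in an annulus, and its dyadic dilates sum to one away from the origin. -/
structure IsLittlewoodPaleyCutoff (φ : ℝ → ℝ) : Prop where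
  smooth : ContDiff ℝ ∞ φ
  annulus : ∃ a b : ℝ, 0 < a ∧ a < b ∧ ∀ ξ : ℝ, φ ξ ≠ 0 → a ≤ |ξ| ∧ |ξ| ≤ b
  partition : ∀ ξ : ℝ, ξ ≠ 0 → HasSum (fun j : ℤ => φ ((2 : ℝ) ^ (-j) * ξ)) 1

/-- The inverse Fourier transform `h(t) = (2π)⁻¹ ∫ e^{iξt} φ(ξ) dξ` of the symbol. -/
noncomputable def lpKernel (φ : ℝ → ℝ) (t : ℝ) : ℂ :=
  ((2 * Real.pi)⁻¹ : ℝ) * ∫ ξ : ℝ, Complex.exp (Complex.I * ξ * t) * (φ ξ : ℂ)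

/-- The Littlewood-Paley operator `Δ_j g = φ(2^{-j} D) g`, written as the convolution
`Δ_j g(t) = 2^j ∫ h(2^j (t - s)) g(s) ds`. For a tempered function `g` the integral converges
absolutely, because `h` is a Schwartz function. -/
noncomputable def lpBlock (φ : ℝ → ℝ) (j : ℤ) (g : ℝ → ℂ) (t : ℝ) : ℂ :=
  ((2 : ℝ) ^ j : ℝ) * ∫ s : ℝ, lpKernel φ ((2 : ℝ) ^ j * (t - s)) * g s

/-- The homogeneous Besov norm `(∑_{j ∈ ℤ} 2^{rjs} ‖Δ_j g‖_{L^p}^r)^{1/r}` for `r < ∞`, with values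
in `[0, ∞]`. -/
noncomputable def homBesovNorm (φ : ℝ → ℝ) (s : ℝ) (p : ℝ≥0∞) (r : ℝ) (g : ℝ → ℂ) : ℝ≥0∞ :=
  (∑' j : ℤ, (2 : ℝ≥0∞) ^ (r * j * s) * eLpNorm (lpBlock φ j g) p volume ^ r) ^ (1 / r)

open Filter Topology

/-! Fix the height `x` and regard `∂ₓ²f(x, ·)` (`heatSlice`) as a convolution in time of `g` with
`heatKernelXX x`. Since `∂ₓ²Γ₁ = ∂ₜΓ₁`, its symbol for `ξ ≠ 0` is `(√(iξ)/2) e^{-x√(iξ)}`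
(`angularFourier_heatKernelXX`), where `Re √(iξ) = √(|ξ|/2)`. On the band `|ξ| ~ 2^j` the symbol
therefore has size about `2^{j/2} e^{-c x 2^{j/2}}`, so the natural height of this band is `x ~
2^{-j/2}`.

Lower bound for `∂ₓ²f`: at heights `x ≲ 2^{-j/2}` the symbol can be inverted on the band, so `Δ_j g`
is a convolution of the slice with a kernel of `L¹` norm `O(2^{-j/2})`
(`exists_eLpNorm_lpBlock_le`). Integrating `q`-th powers over the dyadic tile of heights of length
comparable to `2^{-j/2}` gives the weight `2^{j(q-1)/2}` of the Besov norm, and the tiles are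
disjoint.

Upper bound: `‖Δ_j (slice)‖_q` is at most `C 2^{j/2} min(1, (x 2^{j/2})^{-2}) ‖Δ_j g‖_q`
(`exists_eLpNorm_lpBlock_heatSlice_le`). Summing over `j` at a height in the `i`-th tile produces a
discrete convolution with the geometric weights `2^{-|i-j|/(2q)}` (`coefficient_le`), to which
Young's inequality in `ℓ^q` applies. Both kernel estimates come from
`AnnulusSymbol.exists_lintegral_symbolKernel_le`.

The delicate point is that a homogeneous decomposition does not see polynomials, so `‖U‖_q ≤ ∑ ‖Δ_j
U‖_q` fails for general `U` of polynomial growth. For a slice it holds (`eLpNorm_le_tsum`):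
convergence of `f` makes `|s|^{-1/2} g(s)` integrable near `-∞`, hence averages of `|U|` over far
past intervals tend to zero (`meanVanishesInPast_integral_heatKernelXX`). On the other hand,
high-order finite differences of the low-frequency parts of `U` tend to zero as the cutoff frequency
tends to zero (`tendsto_fwdDiff_iter_dilatedConv`). Expanding such a difference bounds `U(t)` by its
blocks plus values at the points `t - iR`. Averaging over `R` in `[n, 2n]` and letting `n → ∞`
removes those values (`enorm_le_tsum`). -/

/-! ### The heat kernel and its derivatives in space -/

/-- The first space derivative of the heat kernel. -/
noncomputable def heatKernelX (x τ : ℝ) : ℝ := -(x / (2 * τ)) * heatKernel x τ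

/-- The second space derivative of the heat kernel. -/
noncomputable def heatKernelXX (x τ : ℝ) : ℝ :=
  (x ^ 2 / (4 * τ ^ 2) - 1 / (2 * τ)) * heatKernel x τ

lemma heatKernel_of_pos {x τ : ℝ} (h : 0 < τ) :
    heatKernel x τ = (Real.sqrt (4 * Real.pi * τ))⁻¹ * Real.exp (-x ^ 2 / (4 * τ)) := by
  simp [heatKernel, h]

lemma heatKernel_of_nonpos {x τ : ℝ} (h : τ ≤ 0) : heatKernel x τ = 0 := by
  simp [heatKernel, not_lt.2 h]

lemma heatKernelXX_of_nonpos {x τ : ℝ} (h : τ ≤ 0) : heatKernelXX x τ = 0 := by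
  simp [heatKernelXX, heatKernel_of_nonpos h]

lemma heatKernel_nonneg (x τ : ℝ) : 0 ≤ heatKernel x τ := by
  unfold heatKernel; split_ifs <;> positivity

lemma hasDerivAt_heatKernel (x τ : ℝ) :
    HasDerivAt (fun y => heatKernel y τ) (heatKernelX x τ) x := by
  rcases le_or_gt τ 0 with h | h
  · simpa [heatKernelX, heatKernel_of_nonpos h] using hasDerivAt_const x (0 : ℝ)
  · simp only [heatKernelX, heatKernel_of_pos h]
    have h1 : HasDerivAt (fun y : ℝ => -y ^ 2 / (4 * τ)) (-(2 * x) / (4 * τ)) x := by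
      simpa using ((hasDerivAt_pow 2 x).neg.div_const (4 * τ))
    refine (h1.exp.const_mul (Real.sqrt (4 * Real.pi * τ))⁻¹).congr_deriv ?_
    field_simp
    ring

lemma hasDerivAt_heatKernelX (x τ : ℝ) :
    HasDerivAt (fun y => heatKernelX y τ) (heatKernelXX x τ) x := by
  rcases le_or_gt τ 0 with h | h
  · simpa [heatKernelX, heatKernelXX, heatKernel_of_nonpos h] using hasDerivAt_const x (0 : ℝ)
  · have h1 : HasDerivAt (fun y : ℝ => -(y / (2 * τ))) (-(1 / (2 * τ))) x :=
      ((hasDerivAt_id x).div_const (2 * τ)).neg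
    refine (h1.mul (hasDerivAt_heatKernel x τ)).congr_deriv ?_
    simp only [heatKernelX, heatKernelXX]
    field_simp
    ring

lemma measurable_heatKernel : Measurable (fun p : ℝ × ℝ => heatKernel p.1 p.2) := by
  unfold heatKernel
  refine Measurable.ite (measurableSet_lt measurable_const measurable_snd) ?_ measurable_const
  fun_prop

lemma measurable_heatKernelXX : Measurable (fun p : ℝ × ℝ => heatKernelXX p.1 p.2) := by
  unfold heatKernelXX
  exact (by fun_prop : Measurable fun p : ℝ × ℝ => p.1 ^ 2 / (4 * p.2 ^ 2) - 1 / (2 * p.2)).mul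
    measurable_heatKernel

lemma measurable_heatKernelX : Measurable (fun p : ℝ × ℝ => heatKernelX p.1 p.2) := by
  unfold heatKernelX
  exact (by fun_prop : Measurable fun p : ℝ × ℝ => -(p.1 / (2 * p.2))).mul
    measurable_heatKernel

/-- From `x ≥ x₁/2` the Gaussian exponent is at most `-x₁²/(16τ)`. Keeping `-x₁²/(64τ)` for the
kernel at height `x₁/4` leaves a surplus `-3x₁²/(64τ)`, which absorbs negative powers of `τ`. -/
lemma heatKernel_local_bound {x₁ x τ : ℝ} (h₁ : 0 < x₁) (hx : x₁ / 2 ≤ x) (hτ : 0 < τ) :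
    heatKernel x τ ≤ heatKernel (x₁ / 4) τ * Real.exp (-(3 * x₁ ^ 2 / (64 * τ))) := by
  rw [heatKernel_of_pos hτ, heatKernel_of_pos hτ, mul_assoc (Real.sqrt _)⁻¹, ← Real.exp_add]
  gcongr
  have : x₁ ^ 2 / 4 ≤ x ^ 2 := by nlinarith
  calc -x ^ 2 / (4 * τ) ≤ -(x₁ ^ 2 / 4) / (4 * τ) := by gcongr
    _ = _ := by field_simp; ring

lemma mul_exp_neg_le_one (p : ℝ) : p * Real.exp (-p) ≤ 1 := by
  rw [Real.exp_neg, ← div_eq_mul_inv, div_le_one (Real.exp_pos _)]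
  linarith [Real.add_one_le_exp p]

lemma sq_mul_exp_neg_le_two {p : ℝ} (hp : 0 ≤ p) : p ^ 2 * Real.exp (-p) ≤ 2 := by
  rw [Real.exp_neg, ← div_eq_mul_inv, div_le_iff₀ (Real.exp_pos _)]
  linarith [Real.quadratic_le_exp_of_nonneg hp]

/-- This supplies the majorant for differentiating under the integral: near `x₁` the derivatives are
controlled by the kernel at one smaller height, against which `g` is integrable by hypothesis. With
`p` the surplus exponent, `1/τ` and `1/τ²` are multiples of `p` and `p²`, and `p e^{-p}`, `p²
e^{-p}` are bounded. -/
lemma heatKernels_dominated {x₁ : ℝ} (h₁ : 0 < x₁) :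
    ∃ C : ℝ, ∀ x τ : ℝ, x₁ / 2 ≤ x → x ≤ 2 * x₁ →
      |heatKernelX x τ| ≤ C * heatKernel (x₁ / 4) τ ∧
      |heatKernelXX x τ| ≤ C * heatKernel (x₁ / 4) τ := by
  refine ⟨64 / (3 * x₁) + 10000 / x₁ ^ 2, fun x τ hx hx' => ?_⟩
  rcases le_or_gt τ 0 with h | h
  · simp [heatKernelX, heatKernelXX, heatKernel_of_nonpos h]
  · have hx0 : 0 < x := by linarith
    have hb := heatKernel_local_bound h₁ hx h
    set H := heatKernel (x₁ / 4) τ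
    have hH : 0 ≤ H := heatKernel_nonneg _ _
    set p := 3 * x₁ ^ 2 / (64 * τ) with hp
    have hp0 : 0 ≤ p := by positivity
    have e1 := mul_exp_neg_le_one p
    have e2 := sq_mul_exp_neg_le_two hp0
    have hK := heatKernel_nonneg x τ
    constructor
    · have : |heatKernelX x τ| = x / (2 * τ) * heatKernel x τ := by
        rw [heatKernelX, abs_mul, abs_neg, abs_of_nonneg hK, abs_of_pos (by positivity)]
      rw [this]
      have h2 : x / (2 * τ) ≤ 64 / (3 * x₁) * p := by
        rw [hp]
        calc x / (2 * τ) ≤ (2 * x₁) / (2 * τ) := by gcongr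
          _ = _ := by field_simp
      calc x / (2 * τ) * heatKernel x τ ≤ (64 / (3 * x₁) * p) * (H * Real.exp (-p)) := by gcongr
        _ = 64 / (3 * x₁) * (p * Real.exp (-p)) * H := by ring
        _ ≤ 64 / (3 * x₁) * 1 * H := by gcongr
        _ ≤ _ := by
          have : 0 ≤ 10000 / x₁ ^ 2 := by positivity
          nlinarith
    · have : |heatKernelXX x τ| ≤ (x ^ 2 / (4 * τ ^ 2) + 1 / (2 * τ)) * heatKernel x τ := by
        rw [heatKernelXX, abs_mul, abs_of_nonneg hK]
        gcongr
        refine (abs_sub _ _).trans (le_of_eq ?_)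
        rw [abs_of_pos (by positivity), abs_of_pos (by positivity)]
      have h2 : x ^ 2 / (4 * τ ^ 2) ≤ (64 ^ 2 / (9 * x₁ ^ 2)) * p ^ 2 := by
        rw [hp]
        calc x ^ 2 / (4 * τ ^ 2) ≤ (2 * x₁) ^ 2 / (4 * τ ^ 2) := by gcongr
          _ = _ := by field_simp; norm_num
      have h3 : 1 / (2 * τ) = 32 / (3 * x₁ ^ 2) * p := by
        rw [hp]; field_simp; norm_num
      calc _ ≤ _ := this
        _ ≤ ((64 ^ 2 / (9 * x₁ ^ 2)) * p ^ 2 + 32 / (3 * x₁ ^ 2) * p) * (H * Real.exp (-p)) := by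
          rw [h3]; gcongr
        _ = ((64 ^ 2 / (9 * x₁ ^ 2)) * (p ^ 2 * Real.exp (-p))
            + 32 / (3 * x₁ ^ 2) * (p * Real.exp (-p))) * H := by ring
        _ ≤ ((64 ^ 2 / (9 * x₁ ^ 2)) * 2 + 32 / (3 * x₁ ^ 2) * 1) * H := by gcongr
        _ ≤ _ := by
          refine mul_le_mul_of_nonneg_right ?_ hH
          have : (64 ^ 2 / (9 * x₁ ^ 2)) * 2 + 32 / (3 * x₁ ^ 2) * 1
            = (64 ^ 2 * 2 / 9 + 32 / 3) / x₁ ^ 2 := by field_simp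
          rw [this]
          have h4 : 0 ≤ 64 / (3 * x₁) := by positivity
          have h5 : (64 ^ 2 * 2 / 9 + 32 / 3 : ℝ) / x₁ ^ 2 ≤ 10000 / x₁ ^ 2 := by
            gcongr; norm_num
          linarith

/-- The second space derivative of the heat kernel decays like `τ ^ (-3/2)`. -/
lemma heatKernelXX_decay {x : ℝ} (hx : 0 < x) :
    ∃ C : ℝ, 0 ≤ C ∧ ∀ τ, |heatKernelXX x τ| ≤ C * (1 + |τ|) ^ (-(3 / 2) : ℝ) := by
  -- The factor `4` comes from `(1 + τ)^{3/2} ≤ 4 τ^{3/2}` for `τ ≥ 1`; the number `128 = 16 · 8`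
  -- comes from the two bounds used for `τ < 1`.
  refine ⟨4 * (1 + 128 / x ^ 4), by positivity, fun τ => ?_⟩
  rcases le_or_gt τ 0 with h | h
  · rw [heatKernelXX_of_nonpos h, abs_zero]; positivity
  set p := x ^ 2 / (4 * τ) with hp
  have hp0 : 0 < p := by positivity
  have hpi : 1 ≤ 4 * Real.pi := by linarith [Real.pi_gt_three]
  have hk : |heatKernelXX x τ| ≤ (p + 1) * Real.exp (-p) * (τ⁻¹ * (Real.sqrt τ)⁻¹) := by
    rw [heatKernelXX, heatKernel_of_pos h, abs_mul, abs_of_nonneg (a := _ * Real.exp _)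
      (by positivity)]
    have h1 : |x ^ 2 / (4 * τ ^ 2) - 1 / (2 * τ)| ≤ (p + 1) * τ⁻¹ := by
      have e : x ^ 2 / (4 * τ ^ 2) - 1 / (2 * τ) = (p - 1 / 2) * τ⁻¹ := by
        rw [hp]; field_simp
      rw [e, abs_mul, abs_of_pos (inv_pos.2 h)]
      gcongr
      rw [abs_le]; constructor <;> linarith
    have h2 : (Real.sqrt (4 * Real.pi * τ))⁻¹ ≤ (Real.sqrt τ)⁻¹ := by
      gcongr
      nlinarith
    have h3 : -x ^ 2 / (4 * τ) = -p := by rw [hp]; ring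
    rw [h3]
    calc _ ≤ ((p + 1) * τ⁻¹) * ((Real.sqrt τ)⁻¹ * Real.exp (-p)) := by gcongr
      _ = _ := by ring
  have h4 : (1 + |τ|) ^ (-(3 / 2) : ℝ) = ((1 + τ) * Real.sqrt (1 + τ))⁻¹ := by
    rw [abs_of_pos h, Real.rpow_neg (by positivity), Real.sqrt_eq_rpow]
    congr 1
    conv_rhs => rw [← Real.rpow_one_add' (by positivity) (by norm_num)]
    norm_num
  rw [h4]
  rcases le_or_gt 1 τ with h1 | h1
  · have e1 : (p + 1) * Real.exp (-p) ≤ 1 := by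
      rw [Real.exp_neg, ← div_eq_mul_inv, div_le_one (Real.exp_pos _)]
      exact Real.add_one_le_exp p
    have e2 : (1 + τ) * Real.sqrt (1 + τ) ≤ 4 * (τ * Real.sqrt τ) := by
      have : Real.sqrt (1 + τ) ≤ 2 * Real.sqrt τ := by
        rw [Real.sqrt_le_left (by positivity), mul_pow, Real.sq_sqrt h.le]; linarith
      calc _ ≤ (2 * τ) * (2 * Real.sqrt τ) := by gcongr; linarith
        _ = _ := by ring
    calc _ ≤ _ := hk
      _ ≤ 1 * (τ⁻¹ * (Real.sqrt τ)⁻¹) := by gcongr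
      _ = 4 * (4 * (τ * Real.sqrt τ))⁻¹ := by field_simp
      _ ≤ 4 * ((1 + τ) * Real.sqrt (1 + τ))⁻¹ := by gcongr
      _ ≤ _ := by
        gcongr
        have : 0 ≤ 128 / x ^ 4 := by positivity
        linarith
  · have e1 : (p + 1) * Real.exp (-p) * p ^ 2 ≤ 8 := by
      rw [Real.exp_neg]
      have h2 := Real.pow_div_factorial_le_exp _ hp0.le 2
      have h3 := Real.pow_div_factorial_le_exp _ hp0.le 3
      norm_num [Nat.factorial] at h2 h3
      have : (p + 1) * p ^ 2 ≤ 8 * Real.exp p := by nlinarith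
      calc _ = ((p + 1) * p ^ 2) / Real.exp p := by ring
        _ ≤ 8 := by rwa [div_le_iff₀ (Real.exp_pos _)]
    -- For `τ < 1` the singularity `τ^{-3/2}` is at most `τ^{-2} = 16 p² / x⁴`, and `p²` is then
    -- absorbed by the exponential.
    have e2 : τ⁻¹ * (Real.sqrt τ)⁻¹ ≤ 16 / x ^ 4 * p ^ 2 := by
      have : τ ≤ Real.sqrt τ := by
        rw [Real.le_sqrt' h]; nlinarith
      calc τ⁻¹ * (Real.sqrt τ)⁻¹ ≤ τ⁻¹ * τ⁻¹ := by gcongr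
        _ = _ := by rw [hp]; field_simp; norm_num
    have e3 : (1 + τ) * Real.sqrt (1 + τ) ≤ 4 := by
      have : Real.sqrt (1 + τ) ≤ 2 := by
        rw [Real.sqrt_le_left (by positivity)]; linarith
      calc (1 + τ) * Real.sqrt (1 + τ) ≤ 2 * 2 := by gcongr; linarith
        _ = 4 := by norm_num
    calc _ ≤ _ := hk
      _ ≤ (p + 1) * Real.exp (-p) * (16 / x ^ 4 * p ^ 2) := by gcongr
      _ = 16 / x ^ 4 * ((p + 1) * Real.exp (-p) * p ^ 2) := by ring
      _ ≤ 16 / x ^ 4 * 8 := by gcongr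
      _ ≤ 4 * (1 + 128 / x ^ 4) * 4⁻¹ := by
        have : 16 / x ^ 4 * 8 = 128 / x ^ 4 := by ring
        rw [this]; nlinarith
      _ ≤ _ := by gcongr

lemma integrable_heatKernelXX {x : ℝ} (hx : 0 < x) : Integrable (heatKernelXX x) := by
  obtain ⟨C, -, hC⟩ := heatKernelXX_decay hx
  have h1 : Integrable (fun τ : ℝ => C * (1 + ‖τ‖) ^ (-(3 / 2) : ℝ)) :=
    (integrable_one_add_norm (by norm_num)).const_mul C
  refine h1.mono' ?_ (Eventually.of_forall hC)
  exact (measurable_heatKernelXX.comp (measurable_const.prodMk measurable_id)).aestronglyMeasurable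

/-! ### Differentiation of the heat extension -/

lemma IsTemperedFunction.aestronglyMeasurable {g : ℝ → ℂ} (hg : IsTemperedFunction g) :
    AEStronglyMeasurable g volume := by
  obtain ⟨N, hN⟩ := hg
  have hc : Continuous (fun s : ℝ => (1 + |s|) ^ N) := by fun_prop
  refine (hc.aestronglyMeasurable.smul hN.aestronglyMeasurable).congr
    (Eventually.of_forall fun s => ?_)
  have : (1 + |s|) ^ N ≠ 0 := by positivity
  simp only [Pi.smul_apply', smul_smul, mul_inv_cancel₀ this, one_smul]

lemma aestronglyMeasurable_kernel_mul {k : ℝ → ℝ → ℝ} (hk : Measurable fun p : ℝ × ℝ => k p.1 p.2)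
    {g : ℝ → ℂ} (hg : AEStronglyMeasurable g volume) (x t : ℝ) :
    AEStronglyMeasurable (fun s : ℝ => (k x (t - s) : ℂ) * g s) volume := by
  refine AEStronglyMeasurable.mul ?_ hg
  have : Measurable fun s : ℝ => k x (t - s) :=
    hk.comp (measurable_const.prodMk (measurable_const.sub measurable_id))
  exact (Complex.measurable_ofReal.comp this).aestronglyMeasurable

section HeatExtension

variable {g : ℝ → ℂ} (hg : AEStronglyMeasurable g volume)
  (hi : ∀ x t : ℝ, 0 < x → Integrable (fun s : ℝ => (heatKernel x (t - s) : ℂ) * g s))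

lemma heat_bound_integrable (hi : ∀ x t : ℝ, 0 < x →
    Integrable (fun s : ℝ => (heatKernel x (t - s) : ℂ) * g s)) (C : ℝ) {x : ℝ} (hx : 0 < x)
    (t : ℝ) : Integrable (fun s : ℝ => C * heatKernel x (t - s) * ‖g s‖) := by
  refine ((hi x t hx).norm.const_mul C).congr (Eventually.of_forall fun s => ?_)
  simp [abs_of_nonneg (heatKernel_nonneg x (t - s)), mul_assoc]

lemma norm_kernel_mul_le {k H C : ℝ} (z : ℂ) (h : |k| ≤ C * H) : ‖(k : ℂ) * z‖ ≤ C * H * ‖z‖ := by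
  rw [norm_mul, Complex.norm_real, Real.norm_eq_abs]
  gcongr

include hg hi

lemma hasDerivAt_heatExtension {x : ℝ} (hx : 0 < x) (t : ℝ) :
    Integrable (fun s : ℝ => (heatKernelX x (t - s) : ℂ) * g s) ∧
    HasDerivAt (fun y => heatExtension g y t)
      (∫ s : ℝ, (heatKernelX x (t - s) : ℂ) * g s) x := by
  obtain ⟨C, hC⟩ := heatKernels_dominated hx
  have hnhds : Ioo (x / 2) (2 * x) ∈ 𝓝 x := Ioo_mem_nhds (by linarith) (by linarith)
  refine hasDerivAt_integral_of_dominated_loc_of_deriv_le (F := fun y s =>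
    (heatKernel y (t - s) : ℂ) * g s) (F' := fun y s => (heatKernelX y (t - s) : ℂ) * g s)
    (bound := fun s => C * heatKernel (x / 4) (t - s) * ‖g s‖) hnhds
    (Eventually.of_forall fun y => aestronglyMeasurable_kernel_mul measurable_heatKernel hg y t)
    (hi x t hx) (aestronglyMeasurable_kernel_mul measurable_heatKernelX hg x t) ?_
    (heat_bound_integrable hi C (by positivity) t) ?_
  · exact Eventually.of_forall fun s y hy => norm_kernel_mul_le _ (hC y (t - s) hy.1.le hy.2.le).1
  · exact Eventually.of_forall fun s y _ =>
      ((hasDerivAt_heatKernel y (t - s)).ofReal_comp).mul_const (g s)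

lemma hasDerivAt_heatExtensionX {x : ℝ} (hx : 0 < x) (t : ℝ) :
    Integrable (fun s : ℝ => (heatKernelXX x (t - s) : ℂ) * g s) ∧
    HasDerivAt (fun y => ∫ s : ℝ, (heatKernelX y (t - s) : ℂ) * g s)
      (∫ s : ℝ, (heatKernelXX x (t - s) : ℂ) * g s) x := by
  obtain ⟨C, hC⟩ := heatKernels_dominated hx
  have hnhds : Ioo (x / 2) (2 * x) ∈ 𝓝 x := Ioo_mem_nhds (by linarith) (by linarith)
  refine hasDerivAt_integral_of_dominated_loc_of_deriv_le (F := fun y s =>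
    (heatKernelX y (t - s) : ℂ) * g s) (F' := fun y s => (heatKernelXX y (t - s) : ℂ) * g s)
    (bound := fun s => C * heatKernel (x / 4) (t - s) * ‖g s‖) hnhds
    (Eventually.of_forall fun y => aestronglyMeasurable_kernel_mul measurable_heatKernelX hg y t)
    (hasDerivAt_heatExtension hg hi hx t).1
    (aestronglyMeasurable_kernel_mul measurable_heatKernelXX hg x t) ?_
    (heat_bound_integrable hi C (by positivity) t) ?_
  · exact Eventually.of_forall fun s y hy => norm_kernel_mul_le _ (hC y (t - s) hy.1.le hy.2.le).2
  · exact Eventually.of_forall fun s y _ =>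
      ((hasDerivAt_heatKernelX y (t - s)).ofReal_comp).mul_const (g s)

lemma continuousAt_integral_heatKernelXX {x : ℝ} (hx : 0 < x) (t : ℝ) :
    ContinuousAt (fun y => ∫ s : ℝ, (heatKernelXX y (t - s) : ℂ) * g s) x := by
  obtain ⟨C, hC⟩ := heatKernels_dominated hx
  have hnhds : Ioo (x / 2) (2 * x) ∈ 𝓝 x := Ioo_mem_nhds (by linarith) (by linarith)
  refine continuousAt_of_dominated (bound := fun s => C * heatKernel (x / 4) (t - s) * ‖g s‖)
    (Eventually.of_forall fun y => aestronglyMeasurable_kernel_mul measurable_heatKernelXX hg y t)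
    ?_ (heat_bound_integrable hi C (by positivity) t) ?_
  · filter_upwards [hnhds] with y hy
    exact Eventually.of_forall fun s => norm_kernel_mul_le _ (hC y (t - s) hy.1.le hy.2.le).2
  · refine Eventually.of_forall fun s => ?_
    have : Continuous fun y => heatKernelXX y (t - s) := by
      unfold heatKernelXX
      exact (by fun_prop : Continuous fun y : ℝ => y ^ 2 / (4 * (t - s) ^ 2) - 1 / (2 * (t - s))).mul
        (continuous_iff_continuousAt.2 fun y => (hasDerivAt_heatKernel y _).continuousAt)
    exact ((Complex.continuous_ofReal.comp this).mul continuous_const).continuousAt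

lemma deriv_heatExtension_eqOn (t : ℝ) :
    EqOn (deriv fun y => heatExtension g y t)
      (fun y => ∫ s : ℝ, (heatKernelX y (t - s) : ℂ) * g s) (Ioi 0) :=
  fun _ hy => (hasDerivAt_heatExtension hg hi hy t).2.deriv

lemma deriv_deriv_heatExtension_eqOn (t : ℝ) :
    EqOn (deriv (deriv fun y => heatExtension g y t))
      (fun y => ∫ s : ℝ, (heatKernelXX y (t - s) : ℂ) * g s) (Ioi 0) := fun y hy => by
  have : deriv (fun y => heatExtension g y t) =ᶠ[𝓝 y]
      (fun y => ∫ s : ℝ, (heatKernelX y (t - s) : ℂ) * g s) :=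
    (deriv_heatExtension_eqOn hg hi t).eventuallyEq_of_mem (Ioi_mem_nhds hy)
  rw [this.deriv_eq]
  exact (hasDerivAt_heatExtensionX hg hi hy t).2.deriv

lemma contDiffOn_heatExtension (t : ℝ) :
    ContDiffOn ℝ 2 (fun x : ℝ => heatExtension g x t) (Ioi 0) := by
  have h2 : (2 : WithTop ℕ∞) = 1 + 1 := by norm_num
  have h1 : (1 : WithTop ℕ∞) = 0 + 1 := by norm_num
  rw [h2, contDiffOn_succ_iff_deriv_of_isOpen isOpen_Ioi]
  refine ⟨fun x hx => (hasDerivAt_heatExtension hg hi hx t).2.differentiableAt.differentiableWithinAt,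
    by simp, ?_⟩
  rw [h1, contDiffOn_succ_iff_deriv_of_isOpen isOpen_Ioi]
  refine ⟨fun x hx => ?_, by simp, ?_⟩
  · exact (hasDerivAt_heatExtensionX hg hi hx t).2.differentiableAt.differentiableWithinAt.congr
      (fun y hy => deriv_heatExtension_eqOn hg hi t hy) (deriv_heatExtension_eqOn hg hi t hx)
  · rw [contDiffOn_zero]
    exact ContinuousOn.congr (fun x hx => (continuousAt_integral_heatKernelXX hg hi hx
      t).continuousWithinAt) (deriv_deriv_heatExtension_eqOn hg hi t)

lemma heatExtensionXX_eq {x : ℝ} (hx : 0 < x) (t : ℝ) :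
    heatExtensionXX g (x, t) = ∫ s : ℝ, (heatKernelXX x (t - s) : ℂ) * g s := by
  rw [heatExtensionXX, iteratedDeriv_succ, iteratedDeriv_one]
  exact deriv_deriv_heatExtension_eqOn hg hi t hx

lemma aestronglyMeasurable_heatExtensionXX :
    AEStronglyMeasurable (heatExtensionXX g) (volume.restrict (Ioi (0 : ℝ) ×ˢ univ)) := by
  -- Joint measurability requires a strongly measurable representative of `g`; passing to it does
  -- not change the integrals in `s`.
  have h1 : StronglyMeasurable fun p : (ℝ × ℝ) × ℝ =>
      (heatKernelXX p.1.1 (p.1.2 - p.2) : ℂ) * hg.mk g p.2 := by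
    refine StronglyMeasurable.mul ?_ (hg.stronglyMeasurable_mk.comp_measurable measurable_snd)
    have : Measurable fun p : (ℝ × ℝ) × ℝ => heatKernelXX p.1.1 (p.1.2 - p.2) :=
      measurable_heatKernelXX.comp (f := fun p : (ℝ × ℝ) × ℝ => (p.1.1, p.1.2 - p.2))
        (by fun_prop)
    exact (Complex.measurable_ofReal.comp this).stronglyMeasurable
  refine (h1.integral_prod_right' (ν := volume)).aestronglyMeasurable.congr ?_
  refine (ae_restrict_iff' (measurableSet_Ioi.prod MeasurableSet.univ)).2
    (Eventually.of_forall fun p hp => ?_)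
  rw [show heatExtensionXX g p = _ from heatExtensionXX_eq hg hi hp.1 p.2]
  refine integral_congr_ae ?_
  filter_upwards [hg.ae_eq_mk] with s hs
  rw [hs]

end HeatExtension

/-! ### Size of the heat extension as a function of time -/

lemma enorm_complex_ofReal (r : ℝ) : ‖(r : ℂ)‖ₑ = ‖r‖ₑ := by
  rw [← ofReal_norm, ← ofReal_norm, Complex.norm_real]

lemma lintegral_comp_sub_mul (f : ℝ → ℝ≥0∞) (t : ℝ) {c : ℝ} (hc : c ≠ 0) :
    ∫⁻ r, f (t - c * r) = ENNReal.ofReal |c⁻¹| * ∫⁻ r, f r := by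
  have h1 : ∫⁻ r, f (t - c * r) = ∫⁻ r, f (t - r) ∂(Measure.map (c * ·) volume) :=
    ((Homeomorph.mulLeft₀ c hc).measurableEmbedding.lintegral_map fun r => f (t - r)).symm
  rw [h1, Real.map_volume_mul_left hc, lintegral_smul_measure, lintegral_sub_left_eq_self,
    smul_eq_mul]

/-- A weight which is of order `|s| ^ (-1/2)` in the past and of order `s ^ (-N)` in the future. -/
noncomputable def pastWeight (N : ℕ) (s : ℝ) : ℝ :=
  if s ≤ 0 then (Real.sqrt (1 + |s|))⁻¹ else ((1 + |s|) ^ N)⁻¹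

lemma pastWeight_nonneg (N : ℕ) (s : ℝ) : 0 ≤ pastWeight N s := by
  unfold pastWeight; split_ifs <;> positivity

lemma measurable_pastWeight (N : ℕ) : Measurable (pastWeight N) := by
  unfold pastWeight
  refine Measurable.ite (measurableSet_le measurable_id measurable_const) ?_ ?_ <;> fun_prop

lemma sqrt_one_add_abs_le (t s : ℝ) :
    Real.sqrt (1 + |s|) ≤ Real.sqrt (1 + |t - s|) * Real.sqrt (1 + |t|) := by
  rw [← Real.sqrt_mul (by positivity)]
  apply Real.sqrt_le_sqrt
  have := abs_sub_abs_le_abs_sub s t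
  rw [abs_sub_comm] at this
  nlinarith [abs_nonneg (t - s), abs_nonneg t]

lemma rpow_neg_three_halves {a : ℝ} (ha : 0 < a) :
    a ^ (-(3 / 2) : ℝ) = a⁻¹ * (Real.sqrt a)⁻¹ := by
  rw [Real.rpow_neg ha.le, Real.sqrt_eq_rpow, ← mul_inv]
  congr 1
  conv_rhs => rw [← Real.rpow_one_add' ha.le (by norm_num)]
  norm_num

/-- For `s ≤ 0` half a power of the decay `(1 + |t - s|)^{-3/2}` is enough to produce `|s|^{-1/2}`.
For `s > 0` the kernel vanishes unless `s < t`, so the weight in the future is paid for by a power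
of `1 + |t|`. -/
lemma heatKernelXX_le_pastWeight {x : ℝ} (hx : 0 < x) (N : ℕ) :
    ∃ C : ℝ, 0 ≤ C ∧ ∀ t s, |heatKernelXX x (t - s)| ≤ C * (1 + |t|) ^ (N + 1) * pastWeight N s := by
  obtain ⟨C, hC0, hC⟩ := heatKernelXX_decay hx
  refine ⟨C, hC0, fun t s => ?_⟩
  have hw := pastWeight_nonneg N s
  rcases le_or_gt (t - s) 0 with h | h
  · rw [heatKernelXX_of_nonpos h, abs_zero]; positivity
  refine (hC _).trans ?_
  rw [mul_assoc]
  gcongr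
  have ha : (1 : ℝ) ≤ 1 + |t - s| := by linarith [abs_nonneg (t - s)]
  have hb : (1 : ℝ) ≤ 1 + |t| := by linarith [abs_nonneg t]
  rw [rpow_neg_three_halves (by positivity)]
  have h1 : (1 + |t - s|)⁻¹ ≤ 1 := inv_le_one_of_one_le₀ ha
  unfold pastWeight
  split_ifs with hs
  · have h2 : (Real.sqrt (1 + |t - s|))⁻¹ ≤ Real.sqrt (1 + |t|) * (Real.sqrt (1 + |s|))⁻¹ := by
      rw [← div_eq_mul_inv, le_div_iff₀ (by positivity), inv_mul_le_iff₀ (by positivity)]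
      exact sqrt_one_add_abs_le t s
    have h3 : Real.sqrt (1 + |t|) ≤ (1 + |t|) ^ (N + 1) := by
      calc Real.sqrt (1 + |t|) ≤ 1 + |t| := by
            rw [Real.sqrt_le_left (by positivity)]; nlinarith
        _ ≤ _ := le_self_pow₀ hb (by omega)
    calc _ ≤ 1 * (Real.sqrt (1 + |t| ) * (Real.sqrt (1 + |s|))⁻¹) := by gcongr
      _ ≤ _ := by rw [one_mul]; gcongr
  · have h2 : (Real.sqrt (1 + |t - s|))⁻¹ ≤ 1 :=
      inv_le_one_of_one_le₀ (Real.one_le_sqrt.2 ha)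
    have h3 : (1 + |s|) ^ N ≤ (1 + |t|) ^ (N + 1) := by
      have : |s| ≤ |t| := by
        rw [abs_of_pos (not_le.1 hs), abs_of_pos (by linarith)]; linarith
      calc (1 + |s|) ^ N ≤ (1 + |t|) ^ N := by gcongr
        _ ≤ _ := pow_le_pow_right₀ hb (by omega)
    calc _ ≤ (1 : ℝ) * 1 := by gcongr
      _ ≤ _ := by
        rw [one_mul, ← div_eq_mul_inv, le_div_iff₀ (by positivity), one_mul]; exact h3

/-- In the far past the weight is bounded by `Γ₁(1, -s)`, up to a constant, so absolute convergence
of `f(1, 0)` gives integrability there. For `s ≥ -1` the tempered weight suffices. -/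
lemma integrable_pastWeight {g : ℝ → ℂ} (hg : IsTemperedFunction g)
    (hi : ∀ x t : ℝ, 0 < x → Integrable (fun s : ℝ => (heatKernel x (t - s) : ℂ) * g s)) :
    ∃ N : ℕ, Integrable (fun s => pastWeight N s * ‖g s‖) := by
  have hm := hg.aestronglyMeasurable
  obtain ⟨N, hN⟩ := hg
  refine ⟨N, ?_⟩
  -- The factor `√(4π)` cancels the normalisation of `Γ₁(1, -s)`, and `e` compensates `e^{-1/(4|s|)}
  -- ≥ e^{-1}` for `s < -1`.
  set c : ℝ := Real.sqrt (4 * Real.pi) * Real.exp 1 with hc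
  refine ((hN.norm.const_mul (2 ^ N)).add ((hi 1 0 one_pos).norm.const_mul c)).mono'
    ((measurable_pastWeight N).aestronglyMeasurable.mul hm.norm)
    (Eventually.of_forall fun s => ?_)
  have e1 : ‖(((1 + |s|) ^ N)⁻¹ : ℝ) • g s‖ = ((1 + |s|) ^ N)⁻¹ * ‖g s‖ := by
    rw [norm_smul, Real.norm_of_nonneg (by positivity)]
  have e2 : ‖(heatKernel 1 (0 - s) : ℂ) * g s‖ = heatKernel 1 (0 - s) * ‖g s‖ := by
    rw [norm_mul, Complex.norm_real, Real.norm_of_nonneg (heatKernel_nonneg _ _)]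
  simp only [Pi.add_apply]
  rw [e1, e2, Real.norm_of_nonneg (mul_nonneg (pastWeight_nonneg N s) (norm_nonneg _)),
    ← mul_assoc, ← mul_assoc, ← add_mul]
  gcongr
  have hH := heatKernel_nonneg 1 (0 - s)
  have hc0 : 0 ≤ c := by positivity
  have hW : 0 ≤ ((1 + |s|) ^ N)⁻¹ := by positivity
  rcases lt_or_ge s (-1) with h | h
  · have : pastWeight N s ≤ c * heatKernel 1 (0 - s) := by
      rw [pastWeight, if_pos (by linarith), heatKernel_of_pos (by linarith), hc,
        abs_of_neg (by linarith), zero_sub, Real.sqrt_mul (x := 4 * Real.pi) (by positivity)]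
      have h1 : (Real.sqrt (1 + -s))⁻¹ ≤ (Real.sqrt (-s))⁻¹ := by
        have : 0 < -s := by linarith
        gcongr; linarith
      have h2 : 1 ≤ Real.exp 1 * Real.exp (-1 ^ 2 / (4 * -s)) := by
        rw [← Real.exp_add]
        apply Real.one_le_exp
        have : (1 : ℝ) / (4 * -s) ≤ 1 := by
          rw [div_le_one (by linarith)]; linarith
        have h3 : (-1 ^ 2 / (4 * -s) : ℝ) = -(1 / (4 * -s)) := by ring
        rw [h3]; linarith
      have h3 : 0 < Real.sqrt (4 * Real.pi) := by positivity
      calc (Real.sqrt (1 + -s))⁻¹ ≤ (Real.sqrt (-s))⁻¹ * 1 := by rw [mul_one]; exact h1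
        _ ≤ (Real.sqrt (-s))⁻¹ * (Real.exp 1 * Real.exp (-1 ^ 2 / (4 * -s))) := by gcongr
        _ = _ := by field_simp
    have h4 : 0 ≤ 2 ^ N * ((1 + |s|) ^ N)⁻¹ := by positivity
    linarith
  · have : pastWeight N s ≤ 2 ^ N * ((1 + |s|) ^ N)⁻¹ := by
      unfold pastWeight
      split_ifs with hs
      · have h1 : (Real.sqrt (1 + |s|))⁻¹ ≤ 1 :=
          inv_le_one_of_one_le₀ (Real.one_le_sqrt.2 (by linarith [abs_nonneg s]))
        refine h1.trans ?_
        rw [← div_eq_mul_inv, ← div_pow]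
        apply one_le_pow₀
        rw [le_div_iff₀ (by positivity), abs_of_nonpos hs]; linarith
      · exact le_mul_of_one_le_left hW (one_le_pow₀ (by norm_num))
    have h4 : 0 ≤ c * heatKernel 1 (0 - s) := by positivity
    linarith

/-- Continuous functions of at most polynomial growth. -/
structure PolyGrowth (U : ℝ → ℂ) : Prop where
  continuous : Continuous U
  growth : ∃ (C : ℝ) (N : ℕ), 0 ≤ C ∧ ∀ t, ‖U t‖ ≤ C * (1 + |t|) ^ N

section Past

variable {g : ℝ → ℂ} {N : ℕ}

lemma integral_heatKernelXX_growth (hm : AEStronglyMeasurable g volume)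
    (hw : Integrable (fun s => pastWeight N s * ‖g s‖)) {x : ℝ} (hx : 0 < x) :
    ∃ C : ℝ, 0 ≤ C ∧ ∀ t, Integrable (fun s => (heatKernelXX x (t - s) : ℂ) * g s) ∧
      ∫ s, ‖(heatKernelXX x (t - s) : ℂ) * g s‖ ≤ C * (1 + |t|) ^ (N + 1) := by
  obtain ⟨C, hC0, hC⟩ := heatKernelXX_le_pastWeight hx N
  have key : ∀ t s, ‖(heatKernelXX x (t - s) : ℂ) * g s‖ ≤
      C * (1 + |t|) ^ (N + 1) * (pastWeight N s * ‖g s‖) := fun t s => by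
    rw [← mul_assoc]; exact norm_kernel_mul_le _ (hC t s)
  refine ⟨C * ∫ s, pastWeight N s * ‖g s‖, mul_nonneg hC0 (integral_nonneg fun s =>
    mul_nonneg (pastWeight_nonneg N s) (norm_nonneg _)), fun t => ?_⟩
  have hI : Integrable (fun s => (heatKernelXX x (t - s) : ℂ) * g s) :=
    (hw.const_mul (C * (1 + |t|) ^ (N + 1))).mono'
      (aestronglyMeasurable_kernel_mul measurable_heatKernelXX hm x t)
      (Eventually.of_forall (key t))
  refine ⟨hI, (integral_mono hI.norm (hw.const_mul _) (key t)).trans (le_of_eq ?_)⟩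
  rw [integral_const_mul]; ring

lemma polyGrowth_integral_heatKernelXX (hm : AEStronglyMeasurable g volume)
    (hw : Integrable (fun s => pastWeight N s * ‖g s‖)) {x : ℝ} (hx : 0 < x) :
    PolyGrowth (fun t => ∫ s, (heatKernelXX x (t - s) : ℂ) * g s) := by
  refine ⟨continuous_iff_continuousAt.2 fun t₀ => ?_, ?_⟩
  · obtain ⟨C, hC0, hC⟩ := heatKernelXX_le_pastWeight hx N
    refine continuousAt_of_dominated
      (bound := fun s => C * (2 + |t₀|) ^ (N + 1) * (pastWeight N s * ‖g s‖))
      (Eventually.of_forall fun t => aestronglyMeasurable_kernel_mul measurable_heatKernelXX hm x t)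
      ?_ (hw.const_mul _) ?_
    · filter_upwards [Metric.ball_mem_nhds t₀ one_pos] with t ht
      refine Eventually.of_forall fun s => ?_
      rw [← mul_assoc]
      refine norm_kernel_mul_le _ ((hC t s).trans ?_)
      have hwn := pastWeight_nonneg N s
      rw [Metric.mem_ball, Real.dist_eq] at ht
      have := abs_sub_abs_le_abs_sub t t₀
      have h1 : 1 + |t| ≤ 2 + |t₀| := by linarith
      gcongr C * ?_ ^ _ * _
    -- Discarding the null set `{t₀}` makes continuity of the kernel at time zero unnecessary.
    · filter_upwards [compl_mem_ae_iff.2 (measure_singleton (μ := volume) t₀)] with s hs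
      have hne : t₀ - s ≠ 0 := sub_ne_zero.2 (Ne.symm hs)
      have hcont : ContinuousAt (heatKernelXX x) (t₀ - s) := by
        rcases lt_or_gt_of_ne hne with h | h
        · refine (continuousAt_const (y := (0 : ℝ))).congr ?_
          filter_upwards [Iio_mem_nhds h] with τ hτ
          exact (heatKernelXX_of_nonpos (le_of_lt hτ)).symm
        · have : ContinuousAt (fun τ => (x ^ 2 / (4 * τ ^ 2) - 1 / (2 * τ)) *
              ((Real.sqrt (4 * Real.pi * τ))⁻¹ * Real.exp (-x ^ 2 / (4 * τ)))) (t₀ - s) := by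
            have h1 : Real.sqrt (4 * Real.pi * (t₀ - s)) ≠ 0 := by positivity
            fun_prop (disch := first | exact h1 | positivity)
          refine this.congr ?_
          filter_upwards [Ioi_mem_nhds h] with τ hτ
          rw [heatKernelXX, heatKernel_of_pos hτ]
      have : ContinuousAt (fun t => heatKernelXX x (t - s)) t₀ :=
        ContinuousAt.comp (f := fun t => t - s) hcont (by fun_prop)
      exact (Complex.continuous_ofReal.continuousAt.comp this).mul continuousAt_const
  · obtain ⟨C, hC0, hC⟩ := integral_heatKernelXX_growth hm hw hx
    exact ⟨C, N + 1, hC0, fun t => (norm_integral_le_integral_norm _).trans (hC t).2⟩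

/-! ### Vanishing means in the far past. -/

/-- In the past `√(1+|s|) ≤ √(1+|t-s|) + √b`. The first summand is absorbed by the decay of the
kernel; the second leaves an integrable profile in `t - s`, whose average over a long interval
compensates `√b`. Thus averages in `t` are dominated by `pastWeight` uniformly, whereas a pointwise
bound would grow with `t`. -/
lemma heatKernelXX_mean_bound {x : ℝ} (hx : 0 < x) (N : ℕ) :
    ∃ C : ℝ, 0 ≤ C ∧ ∀ t s b : ℝ, t ≤ 0 → |t| ≤ b → |heatKernelXX x (t - s)| ≤
      pastWeight N s * (C + C * Real.sqrt b * (1 + |t - s|) ^ (-(3 / 2) : ℝ)) := by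
  obtain ⟨C, hC0, hC⟩ := heatKernelXX_decay hx
  refine ⟨C, hC0, fun t s b ht hb => ?_⟩
  have hw := pastWeight_nonneg N s
  rcases le_or_gt (t - s) 0 with h | h
  · rw [heatKernelXX_of_nonpos h, abs_zero]; positivity
  refine (hC _).trans ?_
  rw [pastWeight, if_pos (by linarith), ← div_eq_inv_mul, le_div_iff₀ (by positivity)]
  set a := 1 + |t - s| with ha
  have ha1 : 1 ≤ a := by linarith [abs_nonneg (t - s)]
  have h1 : Real.sqrt (1 + |s|) ≤ Real.sqrt a + Real.sqrt b := by
    have hs : 1 + |s| ≤ a + b := by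
      have := abs_sub_abs_le_abs_sub s t
      rw [abs_sub_comm] at this
      linarith
    have hb0 : 0 ≤ b := (abs_nonneg t).trans hb
    rw [Real.sqrt_le_left (by positivity), add_sq, Real.sq_sqrt (by linarith), Real.sq_sqrt hb0]
    have : 0 ≤ 2 * Real.sqrt a * Real.sqrt b := by positivity
    linarith
  have h2 : a ^ (-(3 / 2) : ℝ) * Real.sqrt a ≤ 1 := by
    rw [rpow_neg_three_halves (by positivity), mul_assoc, inv_mul_cancel₀ (by positivity), mul_one]
    exact inv_le_one_of_one_le₀ ha1
  have h3 : 0 ≤ a ^ (-(3 / 2) : ℝ) := by positivity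
  calc C * a ^ (-(3 / 2) : ℝ) * Real.sqrt (1 + |s|)
      ≤ C * a ^ (-(3 / 2) : ℝ) * (Real.sqrt a + Real.sqrt b) := by gcongr
    _ = C * (a ^ (-(3 / 2) : ℝ) * Real.sqrt a) + C * Real.sqrt b * a ^ (-(3 / 2) : ℝ) := by ring
    _ ≤ C * 1 + C * Real.sqrt b * a ^ (-(3 / 2) : ℝ) := by gcongr
    _ = _ := by ring

/-- Means of `‖U‖` over the far past tend to zero. -/
def MeanVanishesInPast (U : ℝ → ℝ≥0∞) : Prop :=
  ∀ t c : ℝ, 0 < c →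
    Tendsto (fun n : ℕ => (n : ℝ≥0∞)⁻¹ * ∫⁻ r in Icc (n : ℝ) (2 * n), U (t - c * r)) atTop (𝓝 0)

/-- After Tonelli the mean becomes `∫ A n s |g(s)| ds`, where `A n s` is the mean of the kernel.
Dominated convergence applies: `A n s` is at most a multiple of `pastWeight`, uniformly in large
`n`, and tends to zero for each `s`. -/
lemma meanVanishesInPast_integral_heatKernelXX (hm : AEStronglyMeasurable g volume)
    (hw : Integrable (fun s => pastWeight N s * ‖g s‖)) {x : ℝ} (hx : 0 < x) :
    MeanVanishesInPast (fun t => ‖∫ s, (heatKernelXX x (t - s) : ℂ) * g s‖ₑ) := by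
  intro t c hc
  obtain ⟨C, hC0, hC⟩ := heatKernelXX_mean_bound hx N
  set A : ℕ → ℝ → ℝ≥0∞ := fun n s =>
    (n : ℝ≥0∞)⁻¹ * ∫⁻ r in Icc (n : ℝ) (2 * n), ‖heatKernelXX x (t - c * r - s)‖ₑ with hA
  have hmeas : Measurable fun p : ℝ × ℝ => heatKernelXX x (t - c * p.1 - p.2) :=
    measurable_heatKernelXX.comp (f := fun p : ℝ × ℝ => (x, t - c * p.1 - p.2)) (by fun_prop)
  have hAm : ∀ n, Measurable (A n) := fun n =>
    (Measurable.lintegral_prod_left' hmeas.enorm).const_mul _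
  set J : ℝ≥0∞ := ∫⁻ r : ℝ, ENNReal.ofReal ((1 + |r|) ^ (-(3 / 2) : ℝ)) with hJ
  have hJtop : J ≠ ⊤ := by
    have h1 : Integrable (fun τ : ℝ => (1 + ‖τ‖) ^ (-(3 / 2) : ℝ)) :=
      integrable_one_add_norm (by norm_num)
    exact h1.lintegral_lt_top.ne
  set M : ℝ≥0∞ := ENNReal.ofReal C + ENNReal.ofReal (C * Real.sqrt (|t| + 2 * c)) *
    (ENNReal.ofReal |c⁻¹| * J) with hM
  have hMtop : M ≠ ⊤ := by
    rw [hM]; finiteness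
  have hbound : ∀ᶠ n : ℕ in atTop, ∀ s, A n s ≤ ENNReal.ofReal (pastWeight N s) * M := by
    filter_upwards [eventually_ge_atTop 1, eventually_ge_atTop ⌈|t| / c⌉₊] with n hn1 hn2 s
    have hn1' : (1 : ℝ) ≤ n := by exact_mod_cast hn1
    have hnt : |t| ≤ c * n := by
      rw [← div_le_iff₀' hc]; exact Nat.ceil_le.1 hn2
    have hwn := pastWeight_nonneg N s
    set b : ℝ := |t| + 2 * c * n with hb
    have hpt : ∀ r ∈ Icc (n : ℝ) (2 * n), ‖heatKernelXX x (t - c * r - s)‖ₑ ≤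
        ENNReal.ofReal (pastWeight N s) * (ENNReal.ofReal C + ENNReal.ofReal (C * Real.sqrt b) *
          ENNReal.ofReal ((1 + |t - s - c * r|) ^ (-(3 / 2) : ℝ))) := by
      intro r hr
      have hr1 : c * n ≤ c * r := by gcongr; exact hr.1
      have hr2 : c * r ≤ c * (2 * n) := by gcongr; exact hr.2
      have := hC (t - c * r) s b (by linarith [le_abs_self t])
        (by
          have := abs_sub t (c * r)
          rw [abs_of_nonneg (a := c * r) (by nlinarith)] at this
          rw [hb]; linarith)
      rw [Real.enorm_eq_ofReal_abs, ← ENNReal.ofReal_mul (by positivity),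
        ← ENNReal.ofReal_add hC0 (by positivity), ← ENNReal.ofReal_mul hwn]
      rw [show t - s - c * r = t - c * r - s by ring]
      exact ENNReal.ofReal_le_ofReal this
    have hint : ∫⁻ r in Icc (n : ℝ) (2 * n), ‖heatKernelXX x (t - c * r - s)‖ₑ ≤
        ENNReal.ofReal (pastWeight N s) * (ENNReal.ofReal C * n + ENNReal.ofReal (C * Real.sqrt b) *
          (ENNReal.ofReal |c⁻¹| * J)) := by
      refine (setLIntegral_mono' measurableSet_Icc hpt).trans ?_
      rw [lintegral_const_mul' _ _ ENNReal.ofReal_ne_top]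
      gcongr
      rw [lintegral_add_left measurable_const, setLIntegral_const, Real.volume_Icc,
        lintegral_const_mul' _ _ ENNReal.ofReal_ne_top]
      gcongr
      · rw [show (2 * n - n : ℝ) = n by ring, ENNReal.ofReal_natCast]
      · refine (setLIntegral_le_lintegral _ _).trans (le_of_eq ?_)
        exact lintegral_comp_sub_mul (fun r => ENNReal.ofReal ((1 + |r|) ^ (-(3 / 2) : ℝ))) (t - s)
          hc.ne'
    have hn0 : (n : ℝ≥0∞) ≠ 0 := by exact_mod_cast (by omega : n ≠ 0)
    -- Here `b` grows linearly in `n`, so `√b ≤ n √(|t| + 2c)` is crude; it is enough because only a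
    -- bound uniform in `n` is needed.
    have hsq : ENNReal.ofReal (C * Real.sqrt b) ≤
        n * ENNReal.ofReal (C * Real.sqrt (|t| + 2 * c)) := by
      rw [← ENNReal.ofReal_natCast, ← ENNReal.ofReal_mul (by positivity)]
      apply ENNReal.ofReal_le_ofReal
      have : Real.sqrt b ≤ n * Real.sqrt (|t| + 2 * c) := by
        rw [Real.sqrt_le_left (by positivity), mul_pow, Real.sq_sqrt (by positivity), hb]
        have h2 : (n : ℝ) ≤ n ^ 2 := by nlinarith
        have h3 : (1 : ℝ) ≤ n ^ 2 := by nlinarith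
        nlinarith [abs_nonneg t]
      nlinarith
    calc A n s ≤ (n : ℝ≥0∞)⁻¹ * (ENNReal.ofReal (pastWeight N s) *
          (ENNReal.ofReal C * n + (n * ENNReal.ofReal (C * Real.sqrt (|t| + 2 * c))) *
          (ENNReal.ofReal |c⁻¹| * J))) := by
          rw [hA]; dsimp only; gcongr; exact hint.trans (by gcongr)
      _ = ((n : ℝ≥0∞)⁻¹ * n) * (ENNReal.ofReal (pastWeight N s) * M) := by rw [hM]; ring
      _ = _ := by rw [ENNReal.inv_mul_cancel hn0 (by simp), one_mul]
  -- By causality the means are eventually equal to zero: once `c n ≥ |t - s|`, every time `t - c r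
  -- - s` with `r ≥ n` is nonpositive.
  have hlim : ∀ s, Tendsto (fun n => A n s) atTop (𝓝 0) := by
    intro s
    refine tendsto_const_nhds.congr' ?_
    filter_upwards [eventually_ge_atTop ⌈|t - s| / c⌉₊] with n hn
    have hnt : |t - s| ≤ c * n := by
      rw [← div_le_iff₀' hc]; exact Nat.ceil_le.1 hn
    rw [hA]
    dsimp only
    rw [setLIntegral_congr_fun (g := fun _ => 0) measurableSet_Icc, lintegral_zero, mul_zero]
    intro r hr
    have hr1 : c * n ≤ c * r := by gcongr; exact hr.1
    dsimp only
    rw [heatKernelXX_of_nonpos (by linarith [le_abs_self (t - s)]), enorm_zero]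
  have hD : Tendsto (fun n => ∫⁻ s, A n s * ‖g s‖ₑ) atTop (𝓝 (∫⁻ _ : ℝ, 0)) := by
    refine tendsto_lintegral_filter_of_dominated_convergence'
      (fun s => ENNReal.ofReal (pastWeight N s) * M * ‖g s‖ₑ)
      (Eventually.of_forall fun n => (hAm n).aemeasurable.mul hm.enorm) ?_ ?_ ?_
    · filter_upwards [hbound] with n hn
      exact Eventually.of_forall fun s => by gcongr; exact hn s
    · have h2 := hw.lintegral_lt_top
      have : ∀ s, ENNReal.ofReal (pastWeight N s) * M * ‖g s‖ₑ =
          M * ENNReal.ofReal (pastWeight N s * ‖g s‖) := fun s => by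
        rw [ENNReal.ofReal_mul (pastWeight_nonneg N s), ofReal_norm]; ring
      simp_rw [this]
      rw [lintegral_const_mul' _ _ hMtop]
      exact ENNReal.mul_ne_top hMtop h2.ne
    · filter_upwards [] with s
      rcases eq_or_ne (‖g s‖ₑ) 0 with h | h
      · simp [h]
      · simpa using ENNReal.Tendsto.mul_const (hlim s) (b := ‖g s‖ₑ) (Or.inr enorm_ne_top)
  rw [lintegral_zero] at hD
  refine tendsto_of_tendsto_of_tendsto_of_le_of_le tendsto_const_nhds hD (fun _ => zero_le)
    fun n => ?_
  calc (n : ℝ≥0∞)⁻¹ * ∫⁻ r in Icc (n : ℝ) (2 * n),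
        ‖∫ s, (heatKernelXX x (t - c * r - s) : ℂ) * g s‖ₑ
      ≤ (n : ℝ≥0∞)⁻¹ * ∫⁻ r in Icc (n : ℝ) (2 * n),
        ∫⁻ s, ‖heatKernelXX x (t - c * r - s)‖ₑ * ‖g s‖ₑ := by
        gcongr with r
        refine (enorm_integral_le_lintegral_enorm _).trans (le_of_eq ?_)
        refine lintegral_congr fun s => ?_
        rw [enorm_mul, enorm_complex_ofReal]
    _ = (n : ℝ≥0∞)⁻¹ * ∫⁻ s, ∫⁻ r in Icc (n : ℝ) (2 * n),
        ‖heatKernelXX x (t - c * r - s)‖ₑ * ‖g s‖ₑ := by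
        rw [lintegral_lintegral_swap]
        exact hmeas.enorm.aemeasurable.mul hm.enorm.comp_snd
    _ = ∫⁻ s, A n s * ‖g s‖ₑ := by
        rw [← lintegral_const_mul'' _ (by
          refine AEMeasurable.lintegral_prod_left' (μ := volume.restrict (Icc (n : ℝ) (2 * n)))
            (f := fun p : ℝ × ℝ => ‖heatKernelXX x (t - c * p.1 - p.2)‖ₑ * ‖g p.2‖ₑ) ?_
          exact hmeas.enorm.aemeasurable.mul hm.enorm.comp_snd)]
        refine lintegral_congr fun s => ?_
        rw [lintegral_mul_const' _ _ enorm_ne_top, hA, mul_assoc]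

end Past

/-! ### Fourier transforms in angular frequency -/

/-- The convolution kernel `(2π)⁻¹ ∫ e^{iξt} m(ξ) dξ` of the Fourier multiplier with symbol `m`. -/
noncomputable def symbolKernel (m : ℝ → ℂ) (t : ℝ) : ℂ :=
  ((2 * Real.pi)⁻¹ : ℝ) * ∫ ξ : ℝ, Complex.exp (Complex.I * ξ * t) * m ξ

/-- The Fourier transform `∫ e^{-iξt} k(t) dt`. -/
noncomputable def angularFourier (k : ℝ → ℂ) (ξ : ℝ) : ℂ :=
  ∫ t : ℝ, Complex.exp (-(Complex.I * ξ * t)) * k t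

lemma norm_exp_I_mul (a b : ℝ) : ‖Complex.exp (Complex.I * a * b)‖ = 1 := by
  rw [Complex.norm_exp]; simp

lemma integrable_exp_I_mul {m : ℝ → ℂ} (hm : Integrable m) (t : ℝ) :
    Integrable (fun ξ : ℝ => Complex.exp (Complex.I * ξ * t) * m ξ) := by
  refine hm.bdd_mul (c := 1) (by fun_prop) (Eventually.of_forall fun ξ => (norm_exp_I_mul ξ t).le)

lemma fourier_eq_angularFourier (k : ℝ → ℂ) (ν : ℝ) :
    FourierTransform.fourier k ν = angularFourier k (2 * Real.pi * ν) := by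
  rw [Real.fourier_real_eq_integral_exp_smul, angularFourier]
  refine integral_congr_ae (Eventually.of_forall fun t => ?_)
  simp only [smul_eq_mul]
  congr 2
  push_cast; ring

lemma fourierInv_eq_symbolKernel (m : ℝ → ℂ) (t : ℝ) :
    FourierTransformInv.fourierInv (fun ν => m (2 * Real.pi * ν)) t = symbolKernel m t := by
  rw [Real.fourierInv_eq', symbolKernel]
  have := Measure.integral_comp_mul_left
    (fun ξ : ℝ => Complex.exp (Complex.I * ξ * t) * m ξ) (2 * Real.pi)
  rw [abs_of_pos (by positivity)] at this
  rw [← Complex.real_smul, ← this]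
  refine integral_congr_ae (Eventually.of_forall fun ξ => ?_)
  simp only [smul_eq_mul, RCLike.inner_apply, conj_trivial]
  congr 2
  push_cast; ring

/-- Fourier inversion, carried over from the normalisation `e^{2πiνt}` by the substitution `ξ =
2πν`. -/
lemma symbolKernel_angularFourier {f : ℝ → ℂ} (hc : Continuous f) (hf : Integrable f)
    (hF : Integrable (angularFourier f)) : symbolKernel (angularFourier f) = f := by
  have h1 : FourierTransform.fourier f = fun ν => angularFourier f (2 * Real.pi * ν) :=
    funext (fourier_eq_angularFourier f)
  have h2 : Integrable (FourierTransform.fourier f) := by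
    rw [h1]; exact hF.comp_mul_left' (by positivity)
  have h3 := hc.fourierInv_fourier_eq hf h2
  rw [h1] at h3
  funext t
  rw [← fourierInv_eq_symbolKernel, h3]

lemma angularFourier_symbolKernel {m : ℝ → ℂ} (hc : Continuous m) (hm : Integrable m)
    (hK : Integrable (symbolKernel m)) : angularFourier (symbolKernel m) = m := by
  have h1 : FourierTransformInv.fourierInv (fun ν => m (2 * Real.pi * ν)) = symbolKernel m :=
    funext (fourierInv_eq_symbolKernel m)
  have h3 := Continuous.fourier_fourierInv_eq (f := fun ν => m (2 * Real.pi * ν)) (by fun_prop)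
    (hm.comp_mul_left' (by positivity)) (by
      have : FourierTransform.fourier (fun ν => m (2 * Real.pi * ν)) =
          fun ν => symbolKernel m (-ν) := funext fun ν => by
        rw [← h1, Real.fourierInv_eq_fourier_neg, neg_neg]
      rw [this]; exact hK.comp_neg)
  rw [h1] at h3
  funext ξ
  have h4 := congrFun h3 (ξ / (2 * Real.pi))
  rw [fourier_eq_angularFourier] at h4
  have h5 : 2 * Real.pi * (ξ / (2 * Real.pi)) = ξ := by field_simp
  rwa [h5] at h4

/-! ### The Laplace transform of the heat kernel in time -/

lemma sqrt_re_pos {z : ℂ} (hz : z ∈ Complex.slitPlane) : 0 < (Complex.sqrt z).re := by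
  rw [Complex.sqrt, Complex.cpow_inv_two_re]
  apply Real.sqrt_pos.2
  rcases hz with h | h
  · have := norm_nonneg z
    linarith
  · have h1 : |z.re| < ‖z‖ := Complex.abs_re_lt_norm.2 h
    have := neg_abs_le z.re
    linarith

lemma sqrt_sq (z : ℂ) : Complex.sqrt z ^ 2 = z := by
  rw [Complex.sqrt]; exact Complex.cpow_nat_inv_pow z two_ne_zero

lemma add_sq_ne_zero {z : ℂ} (hz : 0 < z.re) (ξ : ℝ) : z + (ξ : ℂ) ^ 2 ≠ 0 := by
  intro h
  have := congrArg Complex.re h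
  rw [← Complex.ofReal_pow] at this
  simp only [Complex.add_re, Complex.ofReal_re, Complex.zero_re] at this
  nlinarith [sq_nonneg ξ]

lemma integral_split_abs {f : ℝ → ℂ} (h1 : IntegrableOn f (Iic 0)) (h2 : IntegrableOn f (Ioi 0)) :
    Integrable f ∧ ∫ x, f x = (∫ x in Iic 0, f x) + ∫ x in Ioi 0, f x := by
  have : Integrable f := by
    rw [← integrableOn_univ, ← Iic_union_Ioi (a := (0 : ℝ))]
    exact h1.union h2
  exact ⟨this, (intervalIntegral.integral_Iic_add_Ioi h1 h2).symm⟩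

lemma angularFourier_exp_neg_abs {s : ℂ} (hs : 0 < s.re) :
    Integrable (fun x : ℝ => Complex.exp (-s * |x|)) ∧
    angularFourier (fun x : ℝ => Complex.exp (-s * |x|)) =
      fun ξ : ℝ => 2 * s / (s ^ 2 + (ξ : ℂ) ^ 2) := by
  have key : ∀ ξ : ℝ,
      Integrable (fun x : ℝ => Complex.exp (-(Complex.I * ξ * x)) * Complex.exp (-s * |x|)) ∧
      ∫ x : ℝ, Complex.exp (-(Complex.I * ξ * x)) * Complex.exp (-s * |x|) =
        1 / (s - Complex.I * ξ) + 1 / (s + Complex.I * ξ) := by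
    intro ξ
    have ha : 0 < (s - Complex.I * ξ).re := by simpa using hs
    have hb : (-(s + Complex.I * ξ)).re < 0 := by simpa using hs
    have e1 : EqOn (fun x : ℝ => Complex.exp (-(Complex.I * ξ * x)) * Complex.exp (-s * |x|))
        (fun x : ℝ => Complex.exp ((s - Complex.I * ξ) * x)) (Iic 0) := fun x hx => by
      dsimp only
      rw [abs_of_nonpos hx, ← Complex.exp_add]; congr 1; push_cast; ring
    have e2 : EqOn (fun x : ℝ => Complex.exp (-(Complex.I * ξ * x)) * Complex.exp (-s * |x|))
        (fun x : ℝ => Complex.exp (-(s + Complex.I * ξ) * x)) (Ioi 0) := fun x hx => by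
      dsimp only
      rw [abs_of_pos hx, ← Complex.exp_add]; congr 1; ring
    have := integral_split_abs
      ((integrableOn_congr_fun e1 measurableSet_Iic).2 (integrableOn_exp_mul_complex_Iic ha 0))
      ((integrableOn_congr_fun e2 measurableSet_Ioi).2 (integrableOn_exp_mul_complex_Ioi hb 0))
    refine ⟨this.1, this.2.trans ?_⟩
    rw [setIntegral_congr_fun measurableSet_Iic e1, setIntegral_congr_fun measurableSet_Ioi e2,
      integral_exp_mul_complex_Iic ha, integral_exp_mul_complex_Ioi hb]
    simp only [Complex.ofReal_zero, mul_zero, Complex.exp_zero, neg_div_neg_eq]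
  refine ⟨by simpa using (key 0).1, funext fun ξ => ?_⟩
  rw [angularFourier, (key ξ).2]
  have h1 : s - Complex.I * ξ ≠ 0 := fun h => by
    have := congrArg Complex.re h; simp at this; exact hs.ne' this
  have h2 : s + Complex.I * ξ ≠ 0 := fun h => by
    have := congrArg Complex.re h; simp at this; exact hs.ne' this
  have h3 : s ^ 2 + (ξ : ℂ) ^ 2 = (s - Complex.I * ξ) * (s + Complex.I * ξ) := by
    linear_combination (ξ : ℂ) ^ 2 * Complex.I_sq
  rw [h3, div_add_div _ _ h1 h2]
  congr 1
  ring

lemma integrable_inv_add_sq {z : ℂ} (hz : 0 < z.re) :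
    Integrable (fun ξ : ℝ => (z + (ξ : ℂ) ^ 2)⁻¹) := by
  set c := min z.re 1 with hc
  have hc0 : 0 < c := lt_min hz one_pos
  refine (integrable_inv_one_add_sq.const_mul c⁻¹).mono' ?_ (Eventually.of_forall fun ξ => ?_)
  · exact (Continuous.inv₀ (by fun_prop) (add_sq_ne_zero hz)).aestronglyMeasurable
  · rw [norm_inv, ← mul_inv]
    have h1 : c * (1 + ξ ^ 2) ≤ (z + (ξ : ℂ) ^ 2).re := by
      rw [← Complex.ofReal_pow, Complex.add_re, Complex.ofReal_re]
      nlinarith [min_le_left z.re 1, min_le_right z.re 1, sq_nonneg ξ]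
    have h2 := h1.trans (Complex.re_le_norm _)
    gcongr

lemma heatKernel_eq_gaussian_integral (x : ℝ) {t : ℝ} (ht : 0 < t) :
    ∫ ξ : ℝ, Complex.exp (Complex.I * ξ * x) * Complex.exp (-(t * (ξ : ℂ) ^ 2)) =
      2 * Real.pi * heatKernel x t := by
  have := fourierIntegral_gaussian (b := (t : ℂ)) (by simpa using ht) x
  have e : ∀ ξ : ℝ, Complex.exp (Complex.I * ξ * x) * Complex.exp (-(t * (ξ : ℂ) ^ 2)) =
      Complex.exp (Complex.I * x * ξ) * Complex.exp (-(t : ℂ) * ξ ^ 2) := fun ξ => by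
    congr 2 <;> ring
  simp_rw [e]
  rw [this, heatKernel_of_pos ht]
  have h1 : ((Real.pi : ℂ) / t) ^ (1 / 2 : ℂ) = ((Real.sqrt (Real.pi / t) : ℝ) : ℂ) := by
    rw [Real.sqrt_eq_rpow, Complex.ofReal_cpow (by positivity)]
    push_cast; rfl
  have h2 : Real.sqrt (Real.pi / t) = 2 * Real.pi * (Real.sqrt (4 * Real.pi * t))⁻¹ := by
    have h3 : Real.sqrt (4 * Real.pi * t) ^ 2 = 4 * Real.pi * t := Real.sq_sqrt (by positivity)
    have h4 : Real.pi / t = (2 * Real.pi * (Real.sqrt (4 * Real.pi * t))⁻¹) ^ 2 := by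
      rw [mul_pow, inv_pow, h3]; field_simp; ring
    rw [h4, Real.sqrt_sq (by positivity)]
  rw [h1, h2]
  push_cast
  ring

/-- Writing `Γ₁(x, t)` as a Gaussian Fourier integral and applying Fubini turns the Laplace
transform into `(2π)⁻¹ ∫ e^{iξx} (z + ξ²)⁻¹ dξ`. This is evaluated by Fourier inversion, since
`2s/(s² + ξ²)` with `s = √z` is the transform of `e^{-s|x|}`. -/
lemma integral_exp_mul_heatKernel {z : ℂ} (hz : 0 < z.re) {x : ℝ} (hx : 0 < x) :
    ∫ t in Ioi (0 : ℝ), Complex.exp (-(z * t)) * heatKernel x t =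
      Complex.exp (-(Complex.sqrt z * x)) / (2 * Complex.sqrt z) := by
  set s := Complex.sqrt z with hs
  have hs0 : 0 < s.re := sqrt_re_pos (Or.inl hz)
  have hsne : s ≠ 0 := fun h => by simp [h] at hs0
  obtain ⟨hI, hF⟩ := angularFourier_exp_neg_abs hs0
  have hinv := integrable_inv_add_sq hz
  have h1 := symbolKernel_angularFourier (by fun_prop) hI (by
    rw [hF, sqrt_sq]
    simpa only [div_eq_mul_inv] using hinv.const_mul (2 * s))
  rw [hF] at h1
  have h2 := congrFun h1 x
  rw [symbolKernel, sqrt_sq] at h2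
  have h3 : ∀ ξ : ℝ, ∫ t in Ioi (0 : ℝ), Complex.exp (-(z + (ξ : ℂ) ^ 2) * t) =
      (z + (ξ : ℂ) ^ 2)⁻¹ := fun ξ => by
    rw [integral_exp_mul_complex_Ioi]
    · simp only [Complex.ofReal_zero, mul_zero, Complex.exp_zero, neg_div_neg_eq, one_div]
    · rw [← Complex.ofReal_pow, Complex.neg_re, Complex.add_re, Complex.ofReal_re]
      nlinarith [sq_nonneg ξ]
  have hint : Integrable (Function.uncurry fun (t ξ : ℝ) =>
      Complex.exp (Complex.I * ξ * x) * Complex.exp (-(z + (ξ : ℂ) ^ 2) * t))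
      ((volume.restrict (Ioi 0)).prod volume) := by
    rw [integrable_prod_iff' (by
      apply Continuous.aestronglyMeasurable; unfold Function.uncurry; fun_prop)]
    refine ⟨Eventually.of_forall fun ξ => ?_, ?_⟩
    · have hneg : (-(z + (ξ : ℂ) ^ 2)).re < 0 := by
        rw [← Complex.ofReal_pow, Complex.neg_re, Complex.add_re, Complex.ofReal_re]
        nlinarith [sq_nonneg ξ]
      exact (integrableOn_exp_mul_complex_Ioi hneg 0).const_mul (Complex.exp (Complex.I * ξ * x))
    · have hr := integrable_inv_add_sq (z := (z.re : ℂ)) (by simpa using hz)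
      refine hr.norm.congr (Eventually.of_forall fun ξ => ?_)
      have hpos : 0 < z.re + ξ ^ 2 := by positivity
      have e1 : ∀ t : ℝ, ‖Complex.exp (Complex.I * ξ * x) * Complex.exp (-(z + (ξ : ℂ) ^ 2) * t)‖ =
          Real.exp (-(z.re + ξ ^ 2) * t) := fun t => by
        rw [norm_mul, norm_exp_I_mul, one_mul, Complex.norm_exp, ← Complex.ofReal_pow,
          Complex.re_mul_ofReal, Complex.neg_re, Complex.add_re, Complex.ofReal_re]
      simp only [Function.uncurry]
      simp_rw [e1]
      rw [integral_exp_mul_Ioi (by linarith), mul_zero, Real.exp_zero, neg_div_neg_eq, one_div,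
        norm_inv, ← Complex.ofReal_pow, ← Complex.ofReal_add, Complex.norm_real,
        Real.norm_of_nonneg hpos.le]
  have h4 : ∫ t in Ioi (0 : ℝ), Complex.exp (-(z * t)) * (2 * Real.pi * heatKernel x t) =
      ∫ ξ : ℝ, Complex.exp (Complex.I * ξ * x) * (z + (ξ : ℂ) ^ 2)⁻¹ := by
    calc _ = ∫ t in Ioi (0 : ℝ), ∫ ξ : ℝ,
          Complex.exp (Complex.I * ξ * x) * Complex.exp (-(z + (ξ : ℂ) ^ 2) * t) := by
          refine setIntegral_congr_fun measurableSet_Ioi fun t ht => ?_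
          rw [← heatKernel_eq_gaussian_integral x ht, ← integral_const_mul]
          refine integral_congr_ae (Eventually.of_forall fun ξ => ?_)
          dsimp only
          rw [← Complex.exp_add, ← Complex.exp_add, ← Complex.exp_add]
          congr 1; ring
      _ = _ := by
          rw [integral_integral_swap hint]
          refine integral_congr_ae (Eventually.of_forall fun ξ => ?_)
          dsimp only
          rw [integral_const_mul, h3]
  have h5 : ∫ ξ : ℝ, Complex.exp (Complex.I * ξ * x) * (2 * s / (z + (ξ : ℂ) ^ 2)) =
      2 * s * ∫ ξ : ℝ, Complex.exp (Complex.I * ξ * x) * (z + (ξ : ℂ) ^ 2)⁻¹ := by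
    rw [← integral_const_mul]
    refine integral_congr_ae (Eventually.of_forall fun ξ => ?_)
    dsimp only
    ring
  have h6 : ∫ t in Ioi (0 : ℝ), Complex.exp (-(z * t)) * (2 * Real.pi * heatKernel x t) =
      2 * Real.pi * ∫ t in Ioi (0 : ℝ), Complex.exp (-(z * t)) * heatKernel x t := by
    rw [← integral_const_mul]
    refine integral_congr_ae (Eventually.of_forall fun ξ => ?_)
    dsimp only
    ring
  rw [h5, ← h4, h6, abs_of_pos hx] at h2
  have hpi : (Real.pi : ℂ) ≠ 0 := by exact_mod_cast Real.pi_ne_zero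
  rw [eq_div_iff (by simpa using hsne), show -(s * x) = -s * (x : ℂ) by ring, ← h2]
  push_cast
  field_simp

lemma hasDerivAt_heatKernel_time {x t : ℝ} (ht : 0 < t) :
    HasDerivAt (heatKernel x) (heatKernelXX x t) t := by
  have h0 : (heatKernel x) =ᶠ[𝓝 t] fun τ => (Real.sqrt (4 * Real.pi * τ))⁻¹ *
      Real.exp (-x ^ 2 / (4 * τ)) := by
    filter_upwards [Ioi_mem_nhds ht] with τ hτ
    exact heatKernel_of_pos hτ
  refine HasDerivAt.congr_of_eventuallyEq ?_ h0
  have hne : 4 * Real.pi * t ≠ 0 := by positivity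
  have h1 : HasDerivAt (fun τ : ℝ => Real.sqrt (4 * Real.pi * τ))
      (4 * Real.pi / (2 * Real.sqrt (4 * Real.pi * t))) t := by
    simpa using ((hasDerivAt_id t).const_mul (4 * Real.pi)).sqrt hne
  have h2 : HasDerivAt (fun τ : ℝ => -x ^ 2 / (4 * τ)) (x ^ 2 / (4 * t ^ 2)) t := by
    have := (hasDerivAt_inv ht.ne').const_mul (-x ^ 2 / 4)
    refine (this.congr_of_eventuallyEq (Eventually.of_forall fun τ => ?_)).congr_deriv ?_
    · simp only [div_eq_mul_inv, mul_inv]; ring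
    · field_simp
  have hsq : Real.sqrt (4 * Real.pi * t) ≠ 0 := by positivity
  refine ((h1.inv hsq).mul h2.exp).congr_deriv ?_
  rw [heatKernelXX, heatKernel_of_pos ht]
  have h3 : Real.sqrt (4 * Real.pi * t) ^ 2 = 4 * Real.pi * t := Real.sq_sqrt (by positivity)
  rw [h3]
  simp only [Pi.inv_apply]
  field_simp
  ring

/-- Together with `heatKernel_le_inv_sqrt` this removes the boundary terms at `t = 0` and `t = ∞`
when the heat equation is integrated by parts in time. -/
lemma heatKernel_le_sqrt {x : ℝ} (hx : 0 < x) {t : ℝ} (ht : 0 ≤ t) :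
    heatKernel x t ≤ 4 / x ^ 2 * Real.sqrt t := by
  rcases ht.eq_or_lt with rfl | ht
  · simp [heatKernel]
  rw [heatKernel_of_pos ht]
  set p := x ^ 2 / (4 * t) with hp
  have hp0 : 0 < p := by positivity
  have h1 : Real.exp (-x ^ 2 / (4 * t)) ≤ 1 / p := by
    rw [show -x ^ 2 / (4 * t) = -p by rw [hp]; ring, le_div_iff₀ hp0, mul_comm]
    exact mul_exp_neg_le_one p
  have h2 : (Real.sqrt (4 * Real.pi * t))⁻¹ ≤ (Real.sqrt t)⁻¹ := by
    gcongr
    nlinarith [Real.pi_gt_three]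
  have h3 : Real.sqrt t ^ 2 = t := Real.sq_sqrt ht.le
  calc _ ≤ (Real.sqrt t)⁻¹ * (1 / p) := by gcongr
    _ = 4 / x ^ 2 * (t / Real.sqrt t) := by rw [hp]; field_simp
    _ = _ := by rw [Real.div_sqrt]

lemma heatKernel_le_inv_sqrt (x : ℝ) {t : ℝ} (ht : 0 < t) :
    heatKernel x t ≤ (Real.sqrt t)⁻¹ := by
  rw [heatKernel_of_pos ht]
  have h2 : (Real.sqrt (4 * Real.pi * t))⁻¹ ≤ (Real.sqrt t)⁻¹ := by
    gcongr
    nlinarith [Real.pi_gt_three]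
  have h3 : Real.exp (-x ^ 2 / (4 * t)) ≤ 1 := by
    rw [Real.exp_le_one_iff, neg_div, neg_nonpos]; positivity
  calc _ ≤ (Real.sqrt t)⁻¹ * 1 := by gcongr
    _ = _ := mul_one _

lemma norm_exp_neg_mul_le_one {z : ℂ} (hz : 0 ≤ z.re) {t : ℝ} (ht : 0 ≤ t) :
    ‖Complex.exp (-(z * t))‖ ≤ 1 := by
  rw [Complex.norm_exp, Real.exp_le_one_iff]
  simp
  positivity

lemma integrable_exp_mul_heatKernelXX {z : ℂ} (hz : 0 ≤ z.re) {x : ℝ} (hx : 0 < x) :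
    IntegrableOn (fun t : ℝ => Complex.exp (-(z * t)) * heatKernelXX x t) (Ioi 0) := by
  refine (integrable_heatKernelXX hx).ofReal.integrableOn.bdd_mul (c := 1) (by fun_prop) ?_
  refine (ae_restrict_iff' measurableSet_Ioi).2 (Eventually.of_forall fun t ht => ?_)
  exact norm_exp_neg_mul_le_one hz (le_of_lt ht)

lemma integrable_exp_mul_heatKernel {z : ℂ} (hz : 0 < z.re) {x : ℝ} (hx : 0 < x) :
    IntegrableOn (fun t : ℝ => Complex.exp (-(z * t)) * heatKernel x t) (Ioi 0) := by
  have h1 : IntegrableOn (fun t : ℝ => Complex.exp (-z * t)) (Ioi 0) :=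
    integrableOn_exp_mul_complex_Ioi (by simpa using hz) 0
  have h2 : IntegrableOn (fun t : ℝ => Complex.exp (-(z * t))) (Ioi 0) := by
    simpa only [neg_mul] using h1
  refine Integrable.mul_bdd (c := 4 / x ^ 2 + 1) h2 ?_ ?_
  · exact (Complex.measurable_ofReal.comp (measurable_heatKernel.comp
      (measurable_const.prodMk measurable_id))).aestronglyMeasurable
  · refine (ae_restrict_iff' measurableSet_Ioi).2 (Eventually.of_forall fun t ht => ?_)
    rw [Complex.norm_real, Real.norm_of_nonneg (heatKernel_nonneg x t)]
    have hp : 0 < 4 / x ^ 2 := by positivity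
    rcases le_total t 1 with h | h
    · have := heatKernel_le_sqrt hx (le_of_lt ht)
      have h3 : Real.sqrt t ≤ 1 := Real.sqrt_le_one.2 h
      nlinarith
    · have := heatKernel_le_inv_sqrt x ht
      have h3 : (Real.sqrt t)⁻¹ ≤ 1 := inv_le_one_of_one_le₀ (Real.one_le_sqrt.2 h)
      linarith

/-- As `∂ₓ²Γ₁ = ∂ₜΓ₁` and the boundary terms vanish, integration by parts in time multiplies the
Laplace transform of `Γ₁` by `z`. -/
lemma integral_exp_mul_heatKernelXX_of_re_pos {z : ℂ} (hz : 0 < z.re) {x : ℝ} (hx : 0 < x) :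
    ∫ t in Ioi (0 : ℝ), Complex.exp (-(z * t)) * heatKernelXX x t =
      Complex.sqrt z / 2 * Complex.exp (-(x * Complex.sqrt z)) := by
  have hI1 := integrable_exp_mul_heatKernelXX hz.le hx
  have hI2 := (integrable_exp_mul_heatKernel hz hx).const_mul z
  have key := integral_Ioi_of_hasDerivAt_of_tendsto (a := 0) (m := 0)
    (f := fun t : ℝ => Complex.exp (-(z * t)) * heatKernel x t)
    (f' := fun t : ℝ => Complex.exp (-(z * t)) * heatKernelXX x t -
      z * (Complex.exp (-(z * t)) * heatKernel x t)) ?_ ?_ (hI1.sub hI2) ?_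
  · rw [integral_sub hI1 hI2, integral_const_mul, integral_exp_mul_heatKernel hz hx] at key
    have hs0 : 0 < (Complex.sqrt z).re := sqrt_re_pos (Or.inl hz)
    have hsne : Complex.sqrt z ≠ 0 := fun h => by simp [h] at hs0
    simp only [heatKernel_of_nonpos le_rfl, Complex.ofReal_zero, mul_zero, sub_zero] at key
    rw [sub_eq_zero] at key
    rw [key, mul_comm (x : ℂ)]
    nth_rw 1 [← sqrt_sq z]
    field_simp
  · have h1 : Tendsto (fun t : ℝ => 4 / x ^ 2 * Real.sqrt t) (𝓝[Ici 0] 0) (𝓝 0) := by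
      have : Tendsto (fun t : ℝ => 4 / x ^ 2 * Real.sqrt t) (𝓝 0) (𝓝 (4 / x ^ 2 * Real.sqrt 0)) :=
        (by fun_prop : Continuous fun t : ℝ => 4 / x ^ 2 * Real.sqrt t).tendsto 0
      rw [Real.sqrt_zero, mul_zero] at this
      exact this.mono_left nhdsWithin_le_nhds
    have h2 : Tendsto (fun t : ℝ => Complex.exp (-(z * t)) * heatKernel x t) (𝓝[Ici 0] 0) (𝓝 0) := by
      refine squeeze_zero_norm' ?_ h1
      filter_upwards [self_mem_nhdsWithin] with t ht
      rw [norm_mul, Complex.norm_real, Real.norm_of_nonneg (heatKernel_nonneg x t)]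
      calc _ ≤ 1 * heatKernel x t := by
            gcongr
            · exact heatKernel_nonneg x t
            · exact norm_exp_neg_mul_le_one hz.le ht
        _ ≤ _ := by rw [one_mul]; exact heatKernel_le_sqrt hx ht
    rw [ContinuousWithinAt]
    simpa [heatKernel_of_nonpos le_rfl] using h2
  · intro t ht
    have h1 : HasDerivAt (fun t : ℝ => Complex.exp (-(z * t))) (Complex.exp (-(z * t)) * -z) t := by
      have : HasDerivAt (fun t : ℝ => -(z * (t : ℂ))) (-z) t := by
        simpa using ((Complex.ofRealCLM.hasDerivAt (x := t)).const_mul z).fun_neg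
      exact this.cexp
    refine (h1.mul (hasDerivAt_heatKernel_time (x := x) ht).ofReal_comp).congr_deriv ?_
    ring
  · have h1 : Tendsto (fun t : ℝ => (Real.sqrt t)⁻¹) atTop (𝓝 0) :=
      tendsto_inv_atTop_zero.comp Real.tendsto_sqrt_atTop
    refine squeeze_zero_norm' ?_ h1
    filter_upwards [eventually_gt_atTop 0] with t ht
    rw [norm_mul, Complex.norm_real, Real.norm_of_nonneg (heatKernel_nonneg x t)]
    calc _ ≤ 1 * heatKernel x t := by
          gcongr
          · exact heatKernel_nonneg x t
          · exact norm_exp_neg_mul_le_one hz.le ht.le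
      _ ≤ _ := by rw [one_mul]; exact heatKernel_le_inv_sqrt x ht

lemma I_mul_mem_slitPlane {ξ : ℝ} (hξ : ξ ≠ 0) : Complex.I * (ξ : ℂ) ∈ Complex.slitPlane :=
  Or.inr (by simpa using hξ)

lemma continuousAt_sqrt {z : ℂ} (hz : z ∈ Complex.slitPlane) : ContinuousAt Complex.sqrt z := by
  unfold Complex.sqrt
  exact continuousAt_id.cpow continuousAt_const hz

/-- The Fourier transform in time of the second space derivative of the heat kernel. -/
lemma angularFourier_heatKernelXX {x : ℝ} (hx : 0 < x) {ξ : ℝ} (hξ : ξ ≠ 0) :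
    angularFourier (fun t => (heatKernelXX x t : ℂ)) ξ =
      Complex.sqrt (Complex.I * ξ) / 2 * Complex.exp (-(x * Complex.sqrt (Complex.I * ξ))) := by
  have h0 : angularFourier (fun t => (heatKernelXX x t : ℂ)) ξ =
      ∫ t in Ioi (0 : ℝ), Complex.exp (-((Complex.I * ξ) * t)) * heatKernelXX x t := by
    rw [angularFourier, setIntegral_eq_integral_of_forall_compl_eq_zero]
    intro t ht
    rw [heatKernelXX_of_nonpos (not_lt.1 ht), Complex.ofReal_zero, mul_zero]
  rw [h0]
  -- The imaginary axis is reached as the limit of `ε + iξ`, `ε ↓ 0`. The limit passes under the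
  -- integral because `heatKernelXX x` is integrable in time. On the other side `√` is continuous at
  -- `iξ`, as `ξ ≠ 0` keeps `iξ` off the branch cut.
  have hz : Tendsto (fun ε : ℝ => (ε : ℂ) + Complex.I * ξ) (𝓝[>] 0) (𝓝 (Complex.I * ξ)) := by
    have : Tendsto (fun ε : ℝ => (ε : ℂ) + Complex.I * ξ) (𝓝 0) (𝓝 ((0 : ℝ) + Complex.I * ξ)) :=
      (by fun_prop : Continuous fun ε : ℝ => (ε : ℂ) + Complex.I * ξ).tendsto 0
    rw [Complex.ofReal_zero, zero_add] at this
    exact this.mono_left nhdsWithin_le_nhds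
  have hs := (continuousAt_sqrt (I_mul_mem_slitPlane hξ)).tendsto.comp hz
  have hR : Tendsto (fun ε : ℝ => Complex.sqrt (ε + Complex.I * ξ) / 2 *
      Complex.exp (-(x * Complex.sqrt (ε + Complex.I * ξ)))) (𝓝[>] 0)
      (𝓝 (Complex.sqrt (Complex.I * ξ) / 2 * Complex.exp (-(x * Complex.sqrt (Complex.I * ξ))))) :=
    ((by fun_prop : Continuous fun w : ℂ => w / 2 * Complex.exp (-(x * w))).tendsto _).comp hs
  refine tendsto_nhds_unique (f := fun ε : ℝ => ∫ t in Ioi (0 : ℝ),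
    Complex.exp (-((ε + Complex.I * ξ) * t)) * heatKernelXX x t) ?_ (hR.congr' ?_)
  rotate_left
  · filter_upwards [self_mem_nhdsWithin] with ε hε
    rw [integral_exp_mul_heatKernelXX_of_re_pos (by simpa using hε) hx]
  · refine tendsto_integral_filter_of_dominated_convergence (fun t => |heatKernelXX x t|) ?_ ?_ ?_ ?_
    · filter_upwards [self_mem_nhdsWithin] with ε hε
      exact (integrable_exp_mul_heatKernelXX (by simpa using le_of_lt hε) hx).aestronglyMeasurable
    · filter_upwards [self_mem_nhdsWithin] with ε hε
      refine (ae_restrict_iff' measurableSet_Ioi).2 (Eventually.of_forall fun t ht => ?_)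
      rw [norm_mul, Complex.norm_real, Real.norm_eq_abs]
      exact mul_le_of_le_one_left (abs_nonneg _)
        (norm_exp_neg_mul_le_one (by simpa using le_of_lt hε) (le_of_lt ht))
    · exact (integrable_heatKernelXX hx).abs.integrableOn
    · refine Eventually.of_forall fun t => ?_
      exact ((by fun_prop : Continuous fun w : ℂ => Complex.exp (-(w * t)) *
        heatKernelXX x t).tendsto _).comp hz

/-! ### Kernels of smooth compactly supported symbols -/

/-- Smooth compactly supported symbols. -/
structure TestSymbol (m : ℝ → ℂ) : Prop where
  smooth : ContDiff ℝ ∞ m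
  compact : HasCompactSupport m

namespace TestSymbol

variable {m : ℝ → ℂ}

lemma continuous (hm : TestSymbol m) : Continuous m := hm.smooth.continuous

lemma integrable (hm : TestSymbol m) : Integrable m :=
  hm.continuous.integrable_of_hasCompactSupport hm.compact

lemma deriv (hm : TestSymbol m) : TestSymbol (deriv m) :=
  ⟨(contDiff_infty_iff_deriv.1 hm.smooth).2, hm.compact.deriv⟩

lemma iteratedDeriv (hm : TestSymbol m) (n : ℕ) : TestSymbol (iteratedDeriv n m) := by
  induction n with
  | zero => simpa [iteratedDeriv_zero] using hm
  | succ n ih => rw [iteratedDeriv_succ]; exact ih.deriv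

lemma mul_smooth (hm : TestSymbol m) {f : ℝ → ℂ} (hf : ContDiff ℝ ∞ f) :
    TestSymbol (fun ξ => f ξ * m ξ) :=
  ⟨hf.mul hm.smooth, hm.compact.mul_left⟩

lemma dilate (hm : TestSymbol m) {c : ℝ} (hc : c ≠ 0) : TestSymbol (fun ξ => m (c * ξ)) := by
  refine ⟨hm.smooth.comp (by fun_prop : ContDiff ℝ ∞ fun ξ : ℝ => c * ξ), ?_⟩
  exact hm.compact.comp_homeomorph (Homeomorph.mulLeft₀ c hc)

end TestSymbol

lemma symbolKernel_const_mul (m : ℝ → ℂ) (z : ℂ) :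
    symbolKernel (fun ξ => z * m ξ) = fun t => z * symbolKernel m t := by
  funext t
  simp only [symbolKernel]
  rw [mul_left_comm z, ← integral_const_mul z]
  congr 1
  refine integral_congr_ae (Eventually.of_forall fun ξ => ?_)
  dsimp only
  ring

lemma symbolKernel_add {m₁ m₂ : ℝ → ℂ} (h₁ : Integrable m₁) (h₂ : Integrable m₂) :
    symbolKernel (fun ξ => m₁ ξ + m₂ ξ) = fun t => symbolKernel m₁ t + symbolKernel m₂ t := by
  funext t
  simp only [symbolKernel]
  rw [← mul_add, ← integral_add (integrable_exp_I_mul h₁ t) (integrable_exp_I_mul h₂ t)]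
  simp only [mul_add]

lemma symbolKernel_dilate (m : ℝ → ℂ) {c : ℝ} (hc : 0 < c) (t : ℝ) :
    symbolKernel (fun ξ => m (c⁻¹ * ξ)) t = c * symbolKernel m (c * t) := by
  have := Measure.integral_comp_mul_left
    (fun ξ : ℝ => Complex.exp (Complex.I * ξ * (c * t : ℝ)) * m ξ) c⁻¹
  rw [inv_inv, abs_of_pos hc] at this
  rw [symbolKernel, symbolKernel, mul_left_comm, ← Complex.real_smul (x := c), ← this]
  congr 1
  refine integral_congr_ae (Eventually.of_forall fun ξ => ?_)
  have hc' : (c : ℂ) ≠ 0 := by exact_mod_cast hc.ne'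
  dsimp only
  congr 2
  push_cast
  field_simp

lemma norm_symbolKernel_le (m : ℝ → ℂ) (t : ℝ) : ‖symbolKernel m t‖ ≤ ∫ ξ, ‖m ξ‖ := by
  rw [symbolKernel, norm_mul, Complex.norm_real, Real.norm_of_nonneg (by positivity)]
  have h1 : ‖∫ ξ : ℝ, Complex.exp (Complex.I * ξ * t) * m ξ‖ ≤ ∫ ξ, ‖m ξ‖ := by
    refine (norm_integral_le_integral_norm _).trans (le_of_eq ?_)
    simp only [norm_mul, norm_exp_I_mul, one_mul]
  have h2 : (2 * Real.pi)⁻¹ ≤ 1 := inv_le_one_of_one_le₀ (by linarith [Real.pi_gt_three])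
  calc _ ≤ 1 * ∫ ξ, ‖m ξ‖ := by gcongr
    _ = _ := one_mul _

lemma continuous_symbolKernel {m : ℝ → ℂ} (hm : Integrable m) : Continuous (symbolKernel m) := by
  unfold symbolKernel
  refine continuous_const.mul (continuous_of_dominated (bound := fun ξ => ‖m ξ‖)
    (fun t => (integrable_exp_I_mul hm t).aestronglyMeasurable) (fun t => ?_) hm.norm ?_)
  · exact Eventually.of_forall fun ξ => by rw [norm_mul, norm_exp_I_mul, one_mul]
  · exact Eventually.of_forall fun ξ => by fun_prop

lemma hasDerivAt_symbolKernel {m : ℝ → ℂ} (hm : TestSymbol m) (t : ℝ) :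
    HasDerivAt (symbolKernel m) (symbolKernel (fun ξ => Complex.I * ξ * m ξ) t) t := by
  have h1 : TestSymbol (fun ξ : ℝ => Complex.I * ξ * m ξ) :=
    hm.mul_smooth (contDiff_const.mul Complex.ofRealCLM.contDiff)
  have := (hasDerivAt_integral_of_dominated_loc_of_deriv_le (μ := volume) (s := univ) (x₀ := t)
    (F := fun (t ξ : ℝ) => Complex.exp (Complex.I * ξ * t) * m ξ)
    (F' := fun (t ξ : ℝ) => Complex.exp (Complex.I * ξ * t) * (Complex.I * ξ * m ξ))
    (bound := fun ξ => ‖Complex.I * ξ * m ξ‖) univ_mem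
    (Eventually.of_forall fun t => (integrable_exp_I_mul hm.integrable t).aestronglyMeasurable)
    (integrable_exp_I_mul hm.integrable t)
    (integrable_exp_I_mul h1.integrable t).aestronglyMeasurable
    (Eventually.of_forall fun ξ t _ => by rw [norm_mul, norm_exp_I_mul, one_mul])
    h1.integrable.norm (Eventually.of_forall fun ξ t _ => ?_)).2
  · exact this.const_mul _
  · have h2 : HasDerivAt (fun t : ℝ => Complex.I * ξ * (t : ℂ)) (Complex.I * ξ) t := by
      simpa using (Complex.ofRealCLM.hasDerivAt (x := t)).const_mul (Complex.I * ξ)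
    refine (h2.cexp.mul_const (m ξ)).congr_deriv ?_
    ring

lemma symbolKernel_deriv {m : ℝ → ℂ} (hm : TestSymbol m) (t : ℝ) :
    symbolKernel (deriv m) t = -(Complex.I * t) * symbolKernel m t := by
  have h1 : ∀ ξ : ℝ, HasDerivAt (fun ξ : ℝ => Complex.exp (Complex.I * ξ * t))
      (Complex.I * t * Complex.exp (Complex.I * ξ * t)) ξ := fun ξ => by
    have h2 : HasDerivAt (fun ξ : ℝ => Complex.I * (ξ : ℂ) * t) (Complex.I * t) ξ := by
      simpa using ((Complex.ofRealCLM.hasDerivAt (x := ξ)).const_mul Complex.I).mul_const (t : ℂ)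
    exact h2.cexp.congr_deriv (by ring)
  have hI := integrable_exp_I_mul hm.integrable t
  have key := integral_mul_deriv_eq_deriv_mul_of_integrable (fun ξ _ => h1 ξ)
    (fun ξ _ => (hm.smooth.differentiable (by simp) ξ).hasDerivAt)
    (integrable_exp_I_mul hm.deriv.integrable t)
    ((hI.const_mul (Complex.I * t)).congr (Eventually.of_forall fun ξ => by simp [mul_assoc])) hI
  rw [symbolKernel, symbolKernel, key, mul_left_comm, ← integral_const_mul, ← integral_neg]
  congr 1
  refine integral_congr_ae (Eventually.of_forall fun ξ => ?_)
  dsimp only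
  ring

/-- Each power of `t` is traded for a derivative of the symbol by integration by parts. -/
lemma pow_mul_norm_symbolKernel {m : ℝ → ℂ} (hm : TestSymbol m) (n : ℕ) (t : ℝ) :
    |t| ^ n * ‖symbolKernel m t‖ ≤ ∫ ξ, ‖iteratedDeriv n m ξ‖ := by
  have : |t| ^ n * ‖symbolKernel m t‖ = ‖symbolKernel (iteratedDeriv n m) t‖ := by
    induction n with
    | zero => simp
    | succ n ih =>
      rw [iteratedDeriv_succ, symbolKernel_deriv (hm.iteratedDeriv n), norm_mul, ← ih, norm_neg,
        norm_mul, Complex.norm_I, one_mul, Complex.norm_real, Real.norm_eq_abs]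
      ring
  rw [this]
  exact norm_symbolKernel_le _ t

lemma symbolKernel_rapid_decay {m : ℝ → ℂ} (hm : TestSymbol m) (n : ℕ) :
    ∃ C : ℝ, 0 ≤ C ∧ ∀ t, (1 + |t|) ^ n * ‖symbolKernel m t‖ ≤ C := by
  refine ⟨2 ^ n * ((∫ ξ, ‖m ξ‖) + ∫ ξ, ‖iteratedDeriv n m ξ‖), by positivity, fun t => ?_⟩
  have h1 : (1 + |t|) ^ n ≤ 2 ^ n * (1 + |t| ^ n) := by
    have h0 := abs_nonneg t
    rcases le_total |t| 1 with h | h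
    · calc (1 + |t|) ^ n ≤ 2 ^ n := by gcongr; linarith
        _ ≤ _ := le_mul_of_one_le_right (by positivity) (by linarith [pow_nonneg h0 n])
    · calc (1 + |t|) ^ n ≤ (2 * |t|) ^ n := by gcongr; linarith
        _ = 2 ^ n * |t| ^ n := mul_pow _ _ _
        _ ≤ _ := by gcongr; linarith
  calc _ ≤ 2 ^ n * (1 + |t| ^ n) * ‖symbolKernel m t‖ := by gcongr
    _ = 2 ^ n * (‖symbolKernel m t‖ + |t| ^ n * ‖symbolKernel m t‖) := by ring
    _ ≤ _ := by
      gcongr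
      · exact norm_symbolKernel_le m t
      · exact pow_mul_norm_symbolKernel hm n t

lemma symbolKernel_weighted_decay {m : ℝ → ℂ} (hm : TestSymbol m) (N : ℕ) :
    ∃ C : ℝ, 0 ≤ C ∧ ∀ t, (1 + |t|) ^ N * ‖symbolKernel m t‖ ≤ C * (1 + t ^ 2)⁻¹ := by
  obtain ⟨C, hC0, hC⟩ := symbolKernel_rapid_decay hm (N + 2)
  refine ⟨C, hC0, fun t => ?_⟩
  rw [← div_eq_mul_inv, le_div_iff₀ (by positivity)]
  have h1 : 1 + t ^ 2 ≤ (1 + |t|) ^ 2 := by nlinarith [abs_nonneg t, sq_abs t]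
  calc _ ≤ (1 + |t|) ^ N * ‖symbolKernel m t‖ * (1 + |t|) ^ 2 := by gcongr
    _ = (1 + |t|) ^ (N + 2) * ‖symbolKernel m t‖ := by ring
    _ ≤ C := hC t

lemma integrable_symbolKernel {m : ℝ → ℂ} (hm : TestSymbol m) : Integrable (symbolKernel m) := by
  obtain ⟨C, -, hC⟩ := symbolKernel_weighted_decay hm 0
  refine (integrable_inv_one_add_sq.const_mul C).mono'
    (continuous_symbolKernel hm.integrable).aestronglyMeasurable (Eventually.of_forall fun t => ?_)
  simpa using hC t

lemma angularFourier_symbolKernel_eq {m : ℝ → ℂ} (hm : TestSymbol m) :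
    angularFourier (symbolKernel m) = m :=
  angularFourier_symbolKernel hm.continuous hm.integrable (integrable_symbolKernel hm)

/-- The bounds by the `L¹` norms of `m` and `m''` add up to decay like `(1 + t²)⁻¹`, whose integral
is `π`. Two derivatives of the symbol therefore control the norm of the convolution operator. -/
lemma lintegral_symbolKernel_le {m : ℝ → ℂ} (hm : TestSymbol m) :
    ∫⁻ t, ‖symbolKernel m t‖ₑ ≤
      ENNReal.ofReal (Real.pi * ((∫ ξ, ‖m ξ‖) + ∫ ξ, ‖iteratedDeriv 2 m ξ‖)) := by
  set c := (∫ ξ, ‖m ξ‖) + ∫ ξ, ‖iteratedDeriv 2 m ξ‖ with hc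
  have h1 : ∀ t, ‖symbolKernel m t‖ ≤ c * (1 + t ^ 2)⁻¹ := fun t => by
    rw [← div_eq_mul_inv, le_div_iff₀ (by positivity), hc]
    have := pow_mul_norm_symbolKernel hm 2 t
    rw [sq_abs] at this
    linarith [norm_symbolKernel_le m t]
  rw [← ofReal_integral_norm_eq_lintegral_enorm (integrable_symbolKernel hm)]
  apply ENNReal.ofReal_le_ofReal
  calc _ ≤ ∫ t : ℝ, c * (1 + t ^ 2)⁻¹ :=
        integral_mono (integrable_symbolKernel hm).norm (integrable_inv_one_add_sq.const_mul c) h1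
    _ = _ := by rw [integral_const_mul, integral_univ_inv_one_add_sq, mul_comm]

lemma lintegral_symbolKernel_dilate (m : ℝ → ℂ) {c : ℝ} (hc : 0 < c) :
    ∫⁻ t, ‖symbolKernel (fun ξ => m (c⁻¹ * ξ)) t‖ₑ = ∫⁻ t, ‖symbolKernel m t‖ₑ := by
  have h1 : ∀ t, ‖symbolKernel (fun ξ => m (c⁻¹ * ξ)) t‖ₑ =
      ENNReal.ofReal c * ‖symbolKernel m (0 - -c * t)‖ₑ := fun t => by
    rw [symbolKernel_dilate m hc, enorm_mul, enorm_complex_ofReal, Real.enorm_of_nonneg hc.le]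
    congr 3; ring
  simp_rw [h1]
  rw [lintegral_const_mul' _ _ ENNReal.ofReal_ne_top,
    lintegral_comp_sub_mul (fun t => ‖symbolKernel m t‖ₑ) 0 (by linarith : -c ≠ 0).symm.symm,
    ← mul_assoc, ← ENNReal.ofReal_mul hc.le, inv_neg, abs_neg, abs_of_pos (inv_pos.2 hc),
    mul_inv_cancel₀ hc.ne', ENNReal.ofReal_one, one_mul]

/-! ### Composition of convolution operators -/

lemma one_add_abs_le (t r : ℝ) : 1 + |r| ≤ (1 + |t|) * (1 + |t - r|) := by
  have h1 := abs_sub_abs_le_abs_sub r t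
  rw [abs_sub_comm] at h1
  nlinarith [abs_nonneg t, abs_nonneg (t - r)]

lemma symbolKernel_mul_growth_le {m : ℝ → ℂ} (hm : TestSymbol m) (N : ℕ) :
    ∃ C : ℝ, 0 ≤ C ∧ ∀ t r, ‖symbolKernel m (t - r)‖ * (1 + |r|) ^ N ≤
      C * (1 + |t|) ^ N * (1 + (t - r) ^ 2)⁻¹ := by
  obtain ⟨C, hC0, hC⟩ := symbolKernel_weighted_decay hm N
  refine ⟨C, hC0, fun t r => ?_⟩
  calc _ ≤ ‖symbolKernel m (t - r)‖ * ((1 + |t|) * (1 + |t - r|)) ^ N := by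
        gcongr; exact one_add_abs_le t r
    _ = (1 + |t|) ^ N * ((1 + |t - r|) ^ N * ‖symbolKernel m (t - r)‖) := by rw [mul_pow]; ring
    _ ≤ (1 + |t|) ^ N * (C * (1 + (t - r) ^ 2)⁻¹) := mul_le_mul_of_nonneg_left (hC _) (by positivity)
    _ = _ := by ring

lemma symbolKernel_mul_growth {m : ℝ → ℂ} (hm : TestSymbol m) (N : ℕ) (t : ℝ) :
    Integrable (fun r : ℝ => ‖symbolKernel m (t - r)‖ * (1 + |r|) ^ N) := by
  obtain ⟨C, hC0, hC⟩ := symbolKernel_mul_growth_le hm N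
  have hI : Integrable (fun r : ℝ => C * (1 + |t|) ^ N * (1 + (t - r) ^ 2)⁻¹) :=
    (integrable_inv_one_add_sq.comp_sub_left t).const_mul _
  have hc := continuous_symbolKernel hm.integrable
  refine hI.mono' (by fun_prop) (Eventually.of_forall fun r => ?_)
  rw [Real.norm_of_nonneg (by positivity)]
  exact hC t r

/-- The convolution of `g` with `K` converges absolutely and has at most polynomial growth. -/
def ConvGrowth (K g : ℝ → ℂ) : Prop :=
  ∃ (C : ℝ) (N : ℕ), ∀ t, Integrable (fun s => K (t - s) * g s) ∧
    ∫ s, ‖K (t - s) * g s‖ ≤ C * (1 + |t|) ^ N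

lemma symbolKernel_conv {m K : ℝ → ℂ} (hm : Integrable m) (hK : Integrable K) (t : ℝ) :
    ∫ r, symbolKernel m (t - r) * K r = symbolKernel (fun ξ => m ξ * angularFourier K ξ) t := by
  have hint : Integrable (Function.uncurry fun r ξ : ℝ =>
      Complex.exp (Complex.I * ξ * (t - r)) * m ξ * K r) (volume.prod volume) := by
    have h1 : Integrable (fun p : ℝ × ℝ => K p.1 * m p.2) (volume.prod volume) := hK.mul_prod hm
    have h2 := h1.bdd_mul (c := 1) (f := fun p : ℝ × ℝ => Complex.exp (Complex.I * p.2 * (t - p.1)))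
      (by fun_prop) (Eventually.of_forall fun p => by
        rw [← Complex.ofReal_sub, norm_exp_I_mul])
    refine h2.congr (Eventually.of_forall fun p => ?_)
    simp only [Function.uncurry]; ring
  have h3 : ∀ r, symbolKernel m (t - r) * K r = ((2 * Real.pi)⁻¹ : ℝ) *
      ∫ ξ : ℝ, Complex.exp (Complex.I * ξ * (t - r)) * m ξ * K r := fun r => by
    rw [symbolKernel, integral_mul_const, mul_assoc, Complex.ofReal_sub]
  simp_rw [h3]
  rw [integral_const_mul, integral_integral_swap hint, symbolKernel]
  congr 1
  refine integral_congr_ae (Eventually.of_forall fun ξ => ?_)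
  dsimp only
  rw [angularFourier, ← mul_assoc, ← integral_const_mul]
  refine integral_congr_ae (Eventually.of_forall fun r => ?_)
  dsimp only
  rw [show Complex.I * ξ * ((t : ℂ) - r) = Complex.I * ξ * t + -(Complex.I * ξ * r) by ring,
    Complex.exp_add]
  ring

/-- Associativity of convolution, for a function `g` that need not have a classical Fourier
transform. Fubini is justified by the rapid decay of the kernel of `m` against the polynomial growth
of `|K| * |g|`. -/
lemma symbolKernel_conv_conv {m K g : ℝ → ℂ} (hm : TestSymbol m) (hKm : StronglyMeasurable K)
    (hK : Integrable K) (hg : AEStronglyMeasurable g volume) (hKg : ConvGrowth K g) (t : ℝ) :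
    ∫ r, symbolKernel m (t - r) * ∫ s, K (r - s) * g s =
      ∫ s, symbolKernel (fun ξ => m ξ * angularFourier K ξ) (t - s) * g s := by
  obtain ⟨C, N, hC⟩ := hKg
  have hcont := continuous_symbolKernel hm.integrable
  have hmeas : AEStronglyMeasurable (Function.uncurry fun r s : ℝ =>
      symbolKernel m (t - r) * (K (r - s) * g s)) (volume.prod volume) := by
    refine AEStronglyMeasurable.mul ?_ (AEStronglyMeasurable.mul ?_ hg.comp_snd)
    · exact (by fun_prop : Continuous fun p : ℝ × ℝ =>
        symbolKernel m (t - p.1)).aestronglyMeasurable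
    · exact (hKm.comp_measurable (g := fun p : ℝ × ℝ => p.1 - p.2)
        (by fun_prop)).aestronglyMeasurable
  have hint : Integrable (Function.uncurry fun r s : ℝ =>
      symbolKernel m (t - r) * (K (r - s) * g s)) (volume.prod volume) := by
    rw [integrable_prod_iff hmeas]
    refine ⟨Eventually.of_forall fun r => (hC r).1.const_mul (symbolKernel m (t - r)), ?_⟩
    refine ((symbolKernel_mul_growth hm N t).const_mul C).mono'
      hmeas.norm.integral_prod_right' (Eventually.of_forall fun r => ?_)
    simp only [Function.uncurry, norm_mul (symbolKernel m (t - r))]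
    rw [integral_const_mul, norm_mul, norm_norm,
      Real.norm_of_nonneg (integral_nonneg fun _ => norm_nonneg _)]
    calc _ ≤ ‖symbolKernel m (t - r)‖ * (C * (1 + |r|) ^ N) := by gcongr; exact (hC r).2
      _ = _ := by ring
  simp_rw [← integral_const_mul]
  rw [integral_integral_swap hint]
  refine integral_congr_ae (Eventually.of_forall fun s => ?_)
  dsimp only
  rw [← symbolKernel_conv hm.integrable hK]
  simp_rw [← mul_assoc]
  rw [integral_mul_const]
  congr 1
  rw [← integral_add_right_eq_self (fun r => symbolKernel m (t - r) * K (r - s)) s]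
  refine integral_congr_ae (Eventually.of_forall fun r => ?_)
  dsimp only
  rw [add_sub_cancel_right, show t - (r + s) = t - s - r by ring]

lemma convGrowth_symbolKernel {m g : ℝ → ℂ} (hm : TestSymbol m) (hg : IsTemperedFunction g) :
    ConvGrowth (symbolKernel m) g := by
  have hgm := hg.aestronglyMeasurable
  obtain ⟨N, hN⟩ := hg
  obtain ⟨C, hC0, hC⟩ := symbolKernel_mul_growth_le hm N
  have hcont := continuous_symbolKernel hm.integrable
  refine ⟨C * ∫ s, ‖(((1 + |s|) ^ N)⁻¹ : ℝ) • g s‖, N, fun t => ?_⟩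
  have key : ∀ s, ‖symbolKernel m (t - s) * g s‖ ≤
      C * (1 + |t|) ^ N * ‖(((1 + |s|) ^ N)⁻¹ : ℝ) • g s‖ := fun s => by
    rw [norm_mul, norm_smul, Real.norm_of_nonneg (by positivity), ← mul_assoc]
    gcongr
    rw [← div_eq_mul_inv, le_div_iff₀ (by positivity)]
    refine (hC t s).trans (mul_le_of_le_one_right (by positivity) ?_)
    exact inv_le_one_of_one_le₀ (by nlinarith [sq_nonneg (t - s)])
  have hI : Integrable (fun s => symbolKernel m (t - s) * g s) :=
    (hN.norm.const_mul (C * (1 + |t|) ^ N)).mono'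
      ((by fun_prop : Continuous fun s => symbolKernel m (t - s)).aestronglyMeasurable.mul hgm)
      (Eventually.of_forall key)
  refine ⟨hI, (integral_mono hI.norm (hN.norm.const_mul _) key).trans (le_of_eq ?_)⟩
  rw [integral_const_mul]; ring

lemma PolyGrowth.isTemperedFunction {U : ℝ → ℂ} (hU : PolyGrowth U) : IsTemperedFunction U := by
  obtain ⟨hc, C, N, hC0, hC⟩ := hU
  refine ⟨N + 2, (integrable_inv_one_add_sq.const_mul C).mono' ?_ (Eventually.of_forall fun s => ?_)⟩
  · refine Continuous.aestronglyMeasurable (Continuous.smul (Continuous.inv₀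
      (by fun_prop : Continuous fun s : ℝ => (1 + |s|) ^ (N + 2)) ?_) hc)
    intro s; positivity
  · rw [norm_smul, Real.norm_of_nonneg (by positivity), pow_add, mul_inv]
    have h1 : ((1 + |s|) ^ 2)⁻¹ ≤ (1 + s ^ 2)⁻¹ := by
      gcongr; nlinarith [abs_nonneg s, sq_abs s]
    have h2 : ((1 + |s|) ^ N)⁻¹ * ‖U s‖ ≤ C := by
      rw [inv_mul_le_iff₀ (by positivity), mul_comm]; exact hC s
    calc _ = (((1 + |s|) ^ N)⁻¹ * ‖U s‖) * ((1 + |s|) ^ 2)⁻¹ := by ring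
      _ ≤ C * (1 + s ^ 2)⁻¹ := by gcongr

lemma continuous_symbolKernel_conv {m g : ℝ → ℂ} (hm : TestSymbol m) (hg : IsTemperedFunction g) :
    Continuous fun t => ∫ s, symbolKernel m (t - s) * g s := by
  have hgm := hg.aestronglyMeasurable
  obtain ⟨N, hN⟩ := hg
  obtain ⟨C, hC0, hC⟩ := symbolKernel_mul_growth_le hm N
  have hcont := continuous_symbolKernel hm.integrable
  refine continuous_iff_continuousAt.2 fun t₀ => ?_
  refine continuousAt_of_dominated
    (bound := fun s => C * (2 + |t₀|) ^ N * ‖(((1 + |s|) ^ N)⁻¹ : ℝ) • g s‖)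
    (Eventually.of_forall fun t =>
      (by fun_prop : Continuous fun s => symbolKernel m (t - s)).aestronglyMeasurable.mul hgm)
    ?_ (hN.norm.const_mul _) (Eventually.of_forall fun s =>
      ((hcont.comp (continuous_id.sub continuous_const)).mul continuous_const).continuousAt)
  filter_upwards [Metric.ball_mem_nhds t₀ one_pos] with t ht
  refine Eventually.of_forall fun s => ?_
  rw [Metric.mem_ball, Real.dist_eq] at ht
  have h0 := abs_sub_abs_le_abs_sub t t₀
  have h1 : 1 + |t| ≤ 2 + |t₀| := by linarith
  rw [norm_mul, norm_smul, Real.norm_of_nonneg (by positivity), ← mul_assoc]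
  gcongr
  rw [← div_eq_mul_inv, le_div_iff₀ (by positivity)]
  refine (hC t s).trans ((mul_le_of_le_one_right (by positivity) ?_).trans (by gcongr))
  exact inv_le_one_of_one_le₀ (by nlinarith [sq_nonneg (t - s)])

/-! ### Inequalities for integrals of nonnegative functions -/

/-- Jensen's inequality with a weight. -/
lemma lintegral_mul_rpow_le {β : Type*} [MeasurableSpace β] {ν : Measure β} {w f : β → ℝ≥0∞}
    (hw : Measurable w) (hf : AEMeasurable f ν) {q : ℝ} (hq : 1 ≤ q) :
    (∫⁻ y, w y * f y ∂ν) ^ q ≤ (∫⁻ y, w y ∂ν) ^ (q - 1) * ∫⁻ y, w y * f y ^ q ∂ν := by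
  have hq0 : 0 < q := by linarith
  rcases hq.eq_or_lt with rfl | hq1
  · simp
  have hpq : (q / (q - 1)).HolderConjugate q :=
    (Real.HolderConjugate.conjExponent hq1).symm
  -- Hölder's inequality is applied to the splitting `w = w^{1/q'} · w^{1/q}`; the case `q = 1`,
  -- where `q'` is infinite, is already settled.
  have hKe : ∀ y, w y * f y = (w y) ^ (1 / (q / (q - 1))) * ((w y) ^ (1 / q) * f y) := by
    intro y
    rw [← mul_assoc, ← ENNReal.rpow_add_of_nonneg _ _ (by have := hpq.pos; positivity)
      (by positivity)]
    have : 1 / (q / (q - 1)) + 1 / q = 1 := by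
      simpa [one_div] using hpq.inv_add_inv_eq_one
    rw [this, ENNReal.rpow_one]
  have hH := ENNReal.lintegral_mul_le_Lp_mul_Lq ν hpq
    (f := fun y => (w y) ^ (1 / (q / (q - 1)))) (g := fun y => (w y) ^ (1 / q) * f y)
    (by fun_prop) (by fun_prop)
  have e1 : ∀ y, ((w y) ^ (1 / (q / (q - 1)))) ^ (q / (q - 1)) = w y := fun y => by
    rw [← ENNReal.rpow_mul, one_div_mul_cancel hpq.pos.ne', ENNReal.rpow_one]
  have e2 : ∀ y, ((w y) ^ (1 / q) * f y) ^ q = w y * f y ^ q := fun y => by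
    rw [ENNReal.mul_rpow_of_nonneg _ _ hq0.le, ← ENNReal.rpow_mul,
      one_div_mul_cancel hq0.ne', ENNReal.rpow_one]
  simp only [Pi.mul_apply, e1, e2, ← hKe] at hH
  calc (∫⁻ y, w y * f y ∂ν) ^ q
      ≤ ((∫⁻ y, w y ∂ν) ^ (1 / (q / (q - 1))) *
          (∫⁻ y, w y * f y ^ q ∂ν) ^ (1 / q)) ^ q := by gcongr
    _ = (∫⁻ y, w y ∂ν) ^ (q - 1) * ∫⁻ y, w y * f y ^ q ∂ν := by
      rw [ENNReal.mul_rpow_of_nonneg _ _ hq0.le, ← ENNReal.rpow_mul, ← ENNReal.rpow_mul,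
        one_div_mul_cancel hq0.ne', ENNReal.rpow_one]
      congr 2
      field_simp

/-- Schur's test. -/
lemma lintegral_rpow_kernel_le {α β : Type*} [MeasurableSpace α] [MeasurableSpace β]
    {μ : Measure α} {ν : Measure β} [SFinite μ] [SFinite ν] {K : α → β → ℝ≥0∞}
    (hK : Measurable (Function.uncurry K)) {f : β → ℝ≥0∞} (hf : AEMeasurable f ν) {A : ℝ≥0∞}
    (h₁ : ∀ x, ∫⁻ y, K x y ∂ν ≤ A) (h₂ : ∀ y, ∫⁻ x, K x y ∂μ ≤ A) {q : ℝ} (hq : 1 ≤ q) :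
    ∫⁻ x, (∫⁻ y, K x y * f y ∂ν) ^ q ∂μ ≤ A ^ q * ∫⁻ y, f y ^ q ∂ν := by
  have hq0 : 0 < q := by linarith
  have step : ∀ x, (∫⁻ y, K x y * f y ∂ν) ^ q ≤ A ^ (q - 1) * ∫⁻ y, K x y * f y ^ q ∂ν := by
    intro x
    refine (lintegral_mul_rpow_le (hK.comp measurable_prodMk_left) hf hq).trans ?_
    exact mul_le_mul_left (ENNReal.rpow_le_rpow (h₁ x) (by linarith)) _
  have hKf : AEMeasurable (Function.uncurry fun x y => K x y * f y ^ q) (μ.prod ν) :=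
    hK.aemeasurable.mul (hf.pow_const q).comp_snd
  calc ∫⁻ x, (∫⁻ y, K x y * f y ∂ν) ^ q ∂μ
      ≤ ∫⁻ x, A ^ (q - 1) * ∫⁻ y, K x y * f y ^ q ∂ν ∂μ := lintegral_mono step
    _ = A ^ (q - 1) * ∫⁻ x, ∫⁻ y, K x y * f y ^ q ∂ν ∂μ :=
        lintegral_const_mul'' _ (AEMeasurable.lintegral_prod_right' hKf)
    _ = A ^ (q - 1) * ∫⁻ y, ∫⁻ x, K x y * f y ^ q ∂μ ∂ν := by rw [lintegral_lintegral_swap hKf]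
    _ = A ^ (q - 1) * ∫⁻ y, (∫⁻ x, K x y ∂μ) * f y ^ q ∂ν := by
        congr 1
        refine lintegral_congr fun y => ?_
        exact lintegral_mul_const _ (hK.comp measurable_prodMk_right)
    _ ≤ A ^ (q - 1) * ∫⁻ y, A * f y ^ q ∂ν := by gcongr with y; exact h₂ y
    _ = A ^ (q - 1) * (A * ∫⁻ y, f y ^ q ∂ν) := by
        rw [lintegral_const_mul'' _ (hf.pow_const q)]
    _ = _ := by
        rw [← mul_assoc]
        congr 1
        conv_lhs => rw [← ENNReal.rpow_one A, ← ENNReal.rpow_mul, mul_comm (1 : ℝ), mul_one]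
        rw [← ENNReal.rpow_add_of_nonneg _ _ (by linarith) (by norm_num)]
        congr 1; ring

/-- The `q`-th power of the `L^q` norm. -/
lemma eLpNorm_rpow_eq {α : Type*} [MeasurableSpace α] {μ : Measure α} (f : α → ℂ) {q : ℝ}
    (hq : 1 ≤ q) : eLpNorm f (ENNReal.ofReal q) μ ^ q = ∫⁻ x, ‖f x‖ₑ ^ q ∂μ := by
  have hq0 : 0 < q := by linarith
  rw [eLpNorm_eq_lintegral_rpow_enorm_toReal (by simpa using hq0) ENNReal.ofReal_ne_top,
    ENNReal.toReal_ofReal hq0.le, ← ENNReal.rpow_mul, one_div_mul_cancel hq0.ne',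
    ENNReal.rpow_one]

/-- Young's inequality for the convolution of an integrable kernel with an `L^q` function. -/
lemma eLpNorm_conv_le {L U : ℝ → ℂ} (hL : Continuous L) (hU : AEStronglyMeasurable U volume)
    {q : ℝ} (hq : 1 ≤ q) :
    eLpNorm (fun t => ∫ r, L (t - r) * U r) (ENNReal.ofReal q) volume ≤
      (∫⁻ t, ‖L t‖ₑ) * eLpNorm U (ENNReal.ofReal q) volume := by
  have hq0 : 0 < q := by linarith
  rw [← ENNReal.rpow_le_rpow_iff hq0, ENNReal.mul_rpow_of_nonneg _ _ hq0.le,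
    eLpNorm_rpow_eq _ hq, eLpNorm_rpow_eq _ hq]
  refine le_trans (lintegral_mono fun t => ?_) (lintegral_rpow_kernel_le
    (K := fun t r => ‖L (t - r)‖ₑ) (f := fun r => ‖U r‖ₑ) ?_ hU.enorm (fun t => ?_) (fun r => ?_) hq)
  · refine ENNReal.rpow_le_rpow ((enorm_integral_le_lintegral_enorm _).trans (le_of_eq ?_)) hq0.le
    simp only [enorm_mul]
  · exact (by fun_prop : Continuous fun p : ℝ × ℝ => L (p.1 - p.2)).enorm.measurable
  · exact (lintegral_sub_left_eq_self (fun r => ‖L r‖ₑ) t).le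
  · exact (lintegral_sub_right_eq_self (fun t => ‖L t‖ₑ) r).le

/-- Minkowski's inequality for countable sums. -/
lemma lintegral_rpow_tsum_le {α ι : Type*} [MeasurableSpace α] {μ : Measure α} [Countable ι]
    {d : ι → α → ℝ≥0∞} (hd : ∀ i, Measurable (d i)) {q : ℝ} (hq : 1 ≤ q) :
    (∫⁻ x, (∑' i, d i x) ^ q ∂μ) ^ (1 / q) ≤ ∑' i, (∫⁻ x, d i x ^ q ∂μ) ^ (1 / q) := by
  classical
  have hq0 : 0 < q := by linarith
  have hfin : ∀ s : Finset ι, (∫⁻ x, (∑ i ∈ s, d i x) ^ q ∂μ) ^ (1 / q) ≤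
      ∑ i ∈ s, (∫⁻ x, d i x ^ q ∂μ) ^ (1 / q) := by
    intro s
    induction s using Finset.induction_on with
    | empty => simp [hq0]
    | insert i s hi ih =>
      simp only [Finset.sum_insert hi]
      refine (ENNReal.lintegral_Lp_add_le (f := d i) (g := fun x => ∑ i ∈ s, d i x)
        (hd i).aemeasurable (Finset.measurable_fun_sum s fun i _ => hd i).aemeasurable hq).trans ?_
      gcongr
  rw [one_div, ENNReal.rpow_inv_le_iff hq0]
  -- Monotone convergence along the directed family of finite subsets passes from finite sums to the
  -- series.
  have hsup : ∀ x, (∑' i, d i x) ^ q = ⨆ s : Finset ι, (∑ i ∈ s, d i x) ^ q := fun x => by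
    rw [ENNReal.tsum_eq_iSup_sum]
    exact (ENNReal.orderIsoRpow q hq0).map_iSup _
  simp_rw [hsup]
  rw [lintegral_iSup_directed (fun s => ((Finset.measurable_fun_sum s fun i _ =>
    hd i).pow_const q).aemeasurable)]
  · refine iSup_le fun s => ?_
    rw [← ENNReal.rpow_inv_le_iff hq0, ← one_div]
    exact (hfin s).trans (ENNReal.sum_le_tsum s)
  · intro s t
    refine ⟨s ∪ t, fun x => ?_, fun x => ?_⟩
    · exact ENNReal.rpow_le_rpow (Finset.sum_le_sum_of_subset Finset.subset_union_left) hq0.le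
    · exact ENNReal.rpow_le_rpow (Finset.sum_le_sum_of_subset Finset.subset_union_right) hq0.le

/-- By Jensen the mean over an interval of length `n` is at most `(n⁻¹ M)^{1/q}`, where `M` is a
fixed multiple of the integral of `E^q`. -/
lemma meanVanishesInPast_of_Lq {E : ℝ → ℝ≥0∞} (hE : Measurable E) {q : ℝ} (hq : 1 ≤ q)
    (hfin : ∫⁻ t, E t ^ q ≠ ⊤) : MeanVanishesInPast E := by
  have hq0 : 0 < q := by linarith
  intro t c hc
  set M : ℝ≥0∞ := ENNReal.ofReal |c⁻¹| * ∫⁻ t, E t ^ q with hM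
  have hMtop : M ≠ ⊤ := ENNReal.mul_ne_top ENNReal.ofReal_ne_top hfin
  have hbound : ∀ n : ℕ, 1 ≤ n → ((n : ℝ≥0∞)⁻¹ * ∫⁻ r in Icc (n : ℝ) (2 * n), E (t - c * r)) ≤
      ((n : ℝ≥0∞)⁻¹ * M) ^ (1 / q) := by
    intro n hn
    have hn0 : (n : ℝ≥0∞) ≠ 0 := by exact_mod_cast (by omega : n ≠ 0)
    have hnt : (n : ℝ≥0∞)⁻¹ ≠ ⊤ := by simpa using hn0
    have hEm : Measurable fun r => E (t - c * r) := hE.comp (by fun_prop)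
    have h1 := lintegral_mul_rpow_le (ν := volume.restrict (Icc (n : ℝ) (2 * n)))
      (measurable_const (a := (n : ℝ≥0∞)⁻¹)) hEm.aemeasurable hq
    rw [lintegral_const_mul' _ _ hnt, lintegral_const_mul' _ _ hnt, setLIntegral_const,
      Real.volume_Icc, show (2 * n - n : ℝ) = n by ring, ENNReal.ofReal_natCast,
      ENNReal.inv_mul_cancel hn0 (by simp), ENNReal.one_rpow, one_mul] at h1
    rw [one_div, ENNReal.le_rpow_inv_iff hq0]
    refine h1.trans ?_
    gcongr
    exact (setLIntegral_le_lintegral _ _).trans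
      (lintegral_comp_sub_mul (fun r => E r ^ q) t hc.ne').le
  have hlim : Tendsto (fun n : ℕ => ((n : ℝ≥0∞)⁻¹ * M) ^ (1 / q)) atTop (𝓝 0) := by
    have h1 : Tendsto (fun n : ℕ => (n : ℝ≥0∞)⁻¹ * M) atTop (𝓝 (0 * M)) :=
      ENNReal.Tendsto.mul_const ENNReal.tendsto_inv_nat_nhds_zero (Or.inr hMtop)
    have h2 := h1.ennrpow_const (1 / q)
    rwa [zero_mul, ENNReal.zero_rpow_of_pos (by positivity)] at h2
  refine tendsto_of_tendsto_of_tendsto_of_le_of_le' tendsto_const_nhds hlim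
    (Eventually.of_forall fun _ => zero_le) ?_
  filter_upwards [eventually_ge_atTop 1] with n hn using hbound n hn

/-! ### Finite differences of convolutions -/

lemma hasDerivAt_fwdDiff_iter {F F' : ℝ → ℂ} (h : ∀ z, HasDerivAt F (F' z) z) (δ : ℝ) (k : ℕ)
    (z : ℝ) : HasDerivAt ((fwdDiff δ)^[k] F) ((fwdDiff δ)^[k] F' z) z := by
  induction k generalizing z with
  | zero => exact h z
  | succ k ih =>
    rw [Function.iterate_succ_apply', Function.iterate_succ_apply']
    have h1 : HasDerivAt (fun z => (fwdDiff δ)^[k] F (z + δ)) ((fwdDiff δ)^[k] F' (z + δ)) z :=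
      (ih (z + δ)).comp_add_const z δ
    exact h1.sub (ih z)

/-- By the mean value inequality each difference gains a factor `δ` and replaces the symbol `m` by
`iξ m`, which is again a test symbol; hence the induction over all symbols. -/
lemma fwdDiff_iter_symbolKernel_decay (k n : ℕ) {m : ℝ → ℂ} (hm : TestSymbol m) :
    ∃ C : ℝ, 0 ≤ C ∧ ∀ δ, 0 ≤ δ → δ ≤ 1 → ∀ z,
      (1 + |z|) ^ n * ‖(fwdDiff (-δ))^[k] (symbolKernel m) z‖ ≤ C * δ ^ k := by
  induction k generalizing m with
  | zero =>
    obtain ⟨C, hC0, hC⟩ := symbolKernel_rapid_decay hm n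
    exact ⟨C, hC0, fun δ _ _ z => by simpa using hC z⟩
  | succ k ih =>
    have hm' : TestSymbol (fun ξ : ℝ => Complex.I * ξ * m ξ) :=
      hm.mul_smooth (contDiff_const.mul Complex.ofRealCLM.contDiff)
    obtain ⟨C, hC0, hC⟩ := ih hm'
    refine ⟨2 ^ n * C, by positivity, fun δ hδ0 hδ1 z => ?_⟩
    rw [Function.iterate_succ_apply', fwdDiff]
    have hder := hasDerivAt_fwdDiff_iter (hasDerivAt_symbolKernel hm) (-δ) k
    have hb : ∀ y ∈ Icc (z - δ) z, ‖(fwdDiff (-δ))^[k]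
        (symbolKernel fun ξ => Complex.I * ξ * m ξ) y‖ ≤ 2 ^ n * C * δ ^ k / (1 + |z|) ^ n := by
      intro y hy
      rw [le_div_iff₀ (by positivity)]
      -- As `δ ≤ 1`, the weight changes by at most a factor `2` on `[z - δ, z]`, which accounts for
      -- `2 ^ n`.
      have h1 : 1 + |z| ≤ 2 * (1 + |y|) := by
        have h2 := abs_sub_abs_le_abs_sub z y
        rw [abs_of_nonneg (by linarith [hy.2] : 0 ≤ z - y)] at h2
        linarith [hy.1, abs_nonneg y]
      calc _ ≤ ‖(fwdDiff (-δ))^[k] (symbolKernel fun ξ => Complex.I * ξ * m ξ) y‖ *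
            (2 * (1 + |y|)) ^ n := by gcongr
        _ = 2 ^ n * ((1 + |y|) ^ n *
            ‖(fwdDiff (-δ))^[k] (symbolKernel fun ξ => Complex.I * ξ * m ξ) y‖) := by
            rw [mul_pow]; ring
        _ ≤ 2 ^ n * (C * δ ^ k) := 
            mul_le_mul_of_nonneg_left (hC δ hδ0 hδ1 y) (by positivity)
        _ = _ := by ring
    have key := Convex.norm_image_sub_le_of_norm_hasDerivWithin_le
      (f := (fwdDiff (-δ))^[k] (symbolKernel m)) (s := Icc (z - δ) z) (x := z) (y := z - δ)
      (fun y _ => (hder y).hasDerivWithinAt) hb (convex_Icc _ _)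
      ⟨by linarith, le_rfl⟩ ⟨le_rfl, by linarith⟩
    rw [show z - δ - z = -δ by ring, norm_neg, Real.norm_of_nonneg hδ0] at key
    rw [← sub_eq_add_neg]
    calc _ ≤ (1 + |z|) ^ n * (2 ^ n * C * δ ^ k / (1 + |z|) ^ n * δ) := by gcongr
      _ = _ := by field_simp; ring

/-- A dilated convolution operator, written with the dilation in the argument of `U`. -/
noncomputable def dilatedConv (k U : ℝ → ℂ) (c t : ℝ) : ℂ := ∫ z, k z * U (t - c * z)

lemma integral_symbolKernel_dilate_mul (m U : ℝ → ℂ) {c : ℝ} (hc : 0 < c) (t : ℝ) :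
    ∫ s, symbolKernel (fun ξ => m (c * ξ)) (t - s) * U s =
      dilatedConv (symbolKernel m) U c t := by
  have h1 := Measure.integral_comp_mul_left
    (fun z : ℝ => symbolKernel m z * U (t - c * z)) c⁻¹
  have h2 := integral_sub_left_eq_self
    (fun s : ℝ => symbolKernel m (c⁻¹ * s) * U (t - c * (c⁻¹ * s))) volume t
  rw [h1, inv_inv, abs_of_pos hc] at h2
  have h3 : ∀ s, symbolKernel (fun ξ => m (c * ξ)) (t - s) * U s = ((c⁻¹ : ℝ) : ℂ) *
      (symbolKernel m (c⁻¹ * (t - s)) * U (t - c * (c⁻¹ * (t - s)))) := fun s => by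
    have := symbolKernel_dilate m (inv_pos.2 hc) (t - s)
    rw [inv_inv] at this
    rw [this, mul_assoc, mul_inv_cancel_left₀ hc.ne', sub_sub_cancel]
  simp_rw [h3]
  rw [integral_const_mul, h2, Complex.real_smul, ← mul_assoc, ← Complex.ofReal_mul,
    inv_mul_cancel₀ hc.ne', Complex.ofReal_one, one_mul, dilatedConv]

lemma dilated_growth_le {U : ℝ → ℂ} {C : ℝ} {N : ℕ} (hC0 : 0 ≤ C)
    (hC : ∀ t, ‖U t‖ ≤ C * (1 + |t|) ^ N) {c : ℝ} (hc : 0 ≤ c) (t z : ℝ) :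
    ‖U (t - c * z)‖ ≤ C * ((1 + |t|) * (1 + c)) ^ N * (1 + |z|) ^ N := by
  refine (hC _).trans ?_
  rw [mul_assoc, ← mul_pow]
  gcongr
  have h1 := abs_sub t (c * z)
  rw [abs_mul, abs_of_nonneg hc] at h1
  have h2 : 0 ≤ c * |z| := by positivity
  have h3 : 0 ≤ |t| * (c + |z| + c * |z|) := by positivity
  nlinarith [abs_nonneg z]

lemma integrable_dilated {m U : ℝ → ℂ} (hm : TestSymbol m) (hU : PolyGrowth U) {c : ℝ} (hc : 0 ≤ c)
    (t : ℝ) : Integrable (fun z => symbolKernel m z * U (t - c * z)) := by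
  obtain ⟨hUc, C, N, hC0, hC⟩ := hU
  obtain ⟨C', hC0', hC'⟩ := symbolKernel_weighted_decay hm N
  have hcont := continuous_symbolKernel hm.integrable
  refine (integrable_inv_one_add_sq.const_mul (C * ((1 + |t|) * (1 + c)) ^ N * C')).mono'
    (by fun_prop) (Eventually.of_forall fun z => ?_)
  rw [norm_mul]
  calc _ ≤ ‖symbolKernel m z‖ * (C * ((1 + |t|) * (1 + c)) ^ N * (1 + |z|) ^ N) := by
        gcongr; exact dilated_growth_le hC0 hC hc t z
    _ = C * ((1 + |t|) * (1 + c)) ^ N * ((1 + |z|) ^ N * ‖symbolKernel m z‖) := by ring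
    _ ≤ C * ((1 + |t|) * (1 + c)) ^ N * (C' * (1 + z ^ 2)⁻¹) := mul_le_mul_of_nonneg_left (hC' z) (by positivity)
    _ = _ := by ring

/-- As `c → 0` the symbol `m(cξ)` tends to `m(0)`. The integral of the kernel is `m 0`, by
evaluating its Fourier transform at zero. -/
lemma tendsto_dilatedConv_zero {m U : ℝ → ℂ} (hm : TestSymbol m) (hU : PolyGrowth U) (t : ℝ) :
    Tendsto (fun c => dilatedConv (symbolKernel m) U c t) (𝓝[>] 0) (𝓝 (m 0 * U t)) := by
  have h0 : m 0 * U t = ∫ z, symbolKernel m z * U t := by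
    rw [integral_mul_const]
    congr 1
    have := congrFun (angularFourier_symbolKernel_eq hm) 0
    rw [← this, angularFourier]
    simp
  rw [h0]
  obtain ⟨hUc, C, N, hC0, hC⟩ := hU
  obtain ⟨C', hC0', hC'⟩ := symbolKernel_weighted_decay hm N
  have hcont := continuous_symbolKernel hm.integrable
  refine tendsto_integral_filter_of_dominated_convergence
    (fun z => C * ((1 + |t|) * 2) ^ N * C' * (1 + z ^ 2)⁻¹) ?_ ?_
    (integrable_inv_one_add_sq.const_mul _) ?_
  · exact Eventually.of_forall fun c => by fun_prop
  · filter_upwards [Ioo_mem_nhdsGT (zero_lt_one' ℝ)] with c hc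
    refine Eventually.of_forall fun z => ?_
    have hc2 : 1 + c ≤ 2 := by linarith [hc.2]
    have hc0 := hc.1.le
    rw [norm_mul]
    calc _ ≤ ‖symbolKernel m z‖ * (C * ((1 + |t|) * (1 + c)) ^ N * (1 + |z|) ^ N) := by
          gcongr; exact dilated_growth_le hC0 hC hc0 t z
      _ ≤ ‖symbolKernel m z‖ * (C * ((1 + |t|) * 2) ^ N * (1 + |z|) ^ N) := by gcongr
      _ = C * ((1 + |t|) * 2) ^ N * ((1 + |z|) ^ N * ‖symbolKernel m z‖) := by ring
      _ ≤ C * ((1 + |t|) * 2) ^ N * (C' * (1 + z ^ 2)⁻¹) := mul_le_mul_of_nonneg_left (hC' z) (by positivity)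
      _ = _ := by ring
  · refine Eventually.of_forall fun z => ?_
    have : Continuous fun c : ℝ => symbolKernel m z * U (t - c * z) := by fun_prop
    have h2 := this.tendsto 0
    rw [zero_mul, sub_zero] at h2
    exact h2.mono_left nhdsWithin_le_nhds

/-- Translating `t` by `R` amounts to translating the kernel variable `z` by `R / c`, so differences
can be moved from the rough `U` to the smooth kernel. -/
lemma fwdDiff_iter_dilatedConv {m U : ℝ → ℂ} (hm : TestSymbol m) (hU : PolyGrowth U) {c : ℝ}
    (hc : 0 < c) (R : ℝ) (k : ℕ) (t : ℝ) :
    (fwdDiff (-R))^[k] (dilatedConv (symbolKernel m) U c) t =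
      dilatedConv ((fwdDiff (-(R / c)))^[k] (symbolKernel m)) U c t := by
  rw [fwdDiff_iter_eq_sum_shift]
  simp only [dilatedConv, fwdDiff_iter_eq_sum_shift]
  have h1 : ∀ (a : ℝ) (z : ℝ), symbolKernel m (z + -a) * U (t - c * z) =
      symbolKernel m (z + -a) * U (t + -(c * a) - c * (z + -a)) := fun a z => by
    congr 2; ring
  have h2 : ∀ a : ℝ, Integrable (fun z => symbolKernel m (z + -a) * U (t - c * z)) := fun a => by
    simp_rw [h1 a]
    exact (integrable_dilated hm hU hc.le (t + -(c * a))).comp_add_right (-a)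
  have h3 : ∀ a : ℝ, ∫ z, symbolKernel m (z + -a) * U (t - c * z) =
      ∫ z, symbolKernel m z * U (t + -(c * a) - c * z) := fun a => by
    simp_rw [h1 a]
    exact integral_add_right_eq_self
      (fun z => symbolKernel m z * U (t + -(c * a) - c * z)) (-a)
  have h4 : ∀ (i : ℕ) (z : ℝ), z + i • -(R / c) = z + -(i * (R / c)) := fun i z => by
    rw [nsmul_eq_mul]; ring
  have h5 : ∀ (i : ℕ), t + i • -R = t + -(c * (i * (R / c))) := fun i => by
    rw [nsmul_eq_mul]; field_simp
  simp only [h4, h5, Finset.sum_mul, zsmul_eq_mul, mul_assoc]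
  rw [integral_finsetSum _ fun i _ => (h2 _).const_mul _]
  refine Finset.sum_congr rfl fun i _ => ?_
  rw [integral_const_mul, h3]

/-- If `U` grows with degree `N`, then `U(t - c z)` costs `c ^ N`, while `N + 1` differences of the
kernel gain `(R / c) ^ (N + 1)`. The result is `O(1 / c)`: low-frequency parts behave like
polynomials of degree at most `N`. The order of the difference depends neither on `R` nor on `t`. -/
lemma tendsto_fwdDiff_iter_dilatedConv {m U : ℝ → ℂ} (hm : TestSymbol m) (hU : PolyGrowth U) :
    ∃ k : ℕ, ∀ R t : ℝ, 0 ≤ R →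
      Tendsto (fun c => (fwdDiff (-R))^[k] (dilatedConv (symbolKernel m) U c) t) atTop (𝓝 0) := by
  have hU' := hU
  obtain ⟨hUc, C, N, hC0, hC⟩ := hU
  obtain ⟨C', hC0', hC'⟩ := fwdDiff_iter_symbolKernel_decay (N + 1) (N + 2) hm
  refine ⟨N + 1, fun R t hR => ?_⟩
  set M : ℝ := C * ((1 + |t|) * 2) ^ N * C' * R ^ (N + 1) * Real.pi with hM
  have hlim : Tendsto (fun c : ℝ => M * c⁻¹) atTop (𝓝 0) := by
    simpa using tendsto_inv_atTop_zero.const_mul M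
  refine squeeze_zero_norm' ?_ hlim
  filter_upwards [eventually_ge_atTop 1, eventually_ge_atTop R] with c hc1 hcR
  have hc0 : 0 < c := by linarith
  rw [fwdDiff_iter_dilatedConv hm hU' hc0, dilatedConv]
  have hδ0 : 0 ≤ R / c := by positivity
  have hδ1 : R / c ≤ 1 := by rw [div_le_one hc0]; exact hcR
  have hb : ∀ z, ‖(fwdDiff (-(R / c)))^[N + 1] (symbolKernel m) z * U (t - c * z)‖ ≤
      C * ((1 + |t|) * 2) ^ N * C' * R ^ (N + 1) * c⁻¹ * (1 + z ^ 2)⁻¹ := by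
    intro z
    have h1 : 1 + z ^ 2 ≤ (1 + |z|) ^ 2 := by nlinarith [abs_nonneg z, sq_abs z]
    set D := ‖(fwdDiff (-(R / c)))^[N + 1] (symbolKernel m) z‖ with hD
    have hD0 : 0 ≤ D := norm_nonneg _
    rw [norm_mul, ← div_eq_mul_inv _ (1 + z ^ 2), le_div_iff₀ (by positivity)]
    calc _ ≤ D * (C * ((1 + |t|) * (1 + c)) ^ N * (1 + |z|) ^ N) * (1 + |z|) ^ 2 := by
          gcongr; exact dilated_growth_le hC0 hC hc0.le t z
      _ ≤ D * (C * ((1 + |t|) * (2 * c)) ^ N * (1 + |z|) ^ N) * (1 + |z|) ^ 2 := by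
          gcongr; linarith
      _ = C * ((1 + |t|) * 2) ^ N * c ^ N * ((1 + |z|) ^ (N + 2) * D) := by
          rw [← mul_assoc (1 + |t|), mul_pow _ c]; ring
      _ ≤ C * ((1 + |t|) * 2) ^ N * c ^ N * (C' * (R / c) ^ (N + 1)) := by
          exact mul_le_mul_of_nonneg_left (hC' _ hδ0 hδ1 z) (by positivity)
      _ = _ := by rw [div_pow]; field_simp; ring
  refine (norm_integral_le_of_norm_le (integrable_inv_one_add_sq.const_mul _)
    (Eventually.of_forall hb)).trans (le_of_eq ?_)
  rw [integral_const_mul, integral_univ_inv_one_add_sq, hM]; ring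

/-! ### The Littlewood-Paley decomposition -/

/-- The symbol of the Littlewood-Paley operator `Δ_j`. -/
noncomputable def bandSymbol (φ : ℝ → ℝ) (j : ℤ) (ξ : ℝ) : ℂ := (φ (((2 : ℝ) ^ j)⁻¹ * ξ) : ℂ)

/-- The low-frequency symbol `∑_{j ≤ 0} φ(2^{-j} ξ)`. -/
noncomputable def lowPass (φ : ℝ → ℝ) (ξ : ℝ) : ℝ := 1 - ∑' n : ℕ, φ (((2 : ℝ) ^ (n + 1))⁻¹ * ξ)

lemma lpKernel_eq_symbolKernel (φ : ℝ → ℝ) : lpKernel φ = symbolKernel fun ξ => (φ ξ : ℂ) := rfl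

lemma lpBlock_eq_symbolKernel (φ : ℝ → ℝ) (j : ℤ) (g : ℝ → ℂ) (t : ℝ) :
    lpBlock φ j g t = ∫ s, symbolKernel (bandSymbol φ j) (t - s) * g s := by
  rw [lpBlock, ← integral_const_mul, lpKernel_eq_symbolKernel]
  refine integral_congr_ae (Eventually.of_forall fun s => ?_)
  dsimp only
  rw [← mul_assoc, ← symbolKernel_dilate (fun ξ => (φ ξ : ℂ)) (by positivity)]
  rfl

lemma apply_dilate_eq_zero {φ : ℝ → ℝ} {a : ℝ} (hab : ∀ ξ, φ ξ ≠ 0 → a ≤ |ξ|) {M n : ℕ} {ξ : ℝ}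
    (hξ : |ξ| < 2 ^ M * a) (hn : M ≤ n) : φ (((2 : ℝ) ^ (n + 1))⁻¹ * ξ) = 0 := by
  by_contra h
  have h1 := hab _ h
  rw [abs_mul, abs_of_pos (by positivity), ← div_eq_inv_mul, le_div_iff₀ (by positivity)] at h1
  have h2 : (2 : ℝ) ^ M ≤ 2 ^ (n + 1) := pow_le_pow_right₀ (by norm_num) (by omega)
  have h3 : 0 < a := by
    by_contra h3
    have : 2 ^ M * a ≤ 0 := mul_nonpos_of_nonneg_of_nonpos (by positivity) (not_lt.1 h3)
    linarith [abs_nonneg ξ]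
  nlinarith

lemma exists_lt_two_pow_mul {a : ℝ} (ha : 0 < a) (ξ : ℝ) : ∃ M : ℕ, |ξ| < 2 ^ M * a := by
  obtain ⟨M, hM⟩ := pow_unbounded_of_one_lt (|ξ| / a) (one_lt_two (α := ℝ))
  exact ⟨M, by rwa [div_lt_iff₀ ha] at hM⟩

namespace IsLittlewoodPaleyCutoff

variable {φ : ℝ → ℝ} (hφ : IsLittlewoodPaleyCutoff φ)

include hφ

lemma testSymbol : TestSymbol (fun ξ => (φ ξ : ℂ)) := by
  obtain ⟨a, b, -, -, hab⟩ := hφ.annulus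
  refine ⟨Complex.ofRealCLM.contDiff.comp hφ.smooth, ?_⟩
  refine HasCompactSupport.intro (isCompact_Icc (a := -b) (b := b)) fun ξ hξ => ?_
  by_contra h
  exact hξ (abs_le.1 (hab ξ (by simpa using h)).2)

lemma testSymbol_band (j : ℤ) : TestSymbol (bandSymbol φ j) :=
  hφ.testSymbol.dilate (by positivity)

lemma apply_zero : φ 0 = 0 := by
  obtain ⟨a, b, ha, -, hab⟩ := hφ.annulus
  by_contra h
  have := (hab 0 h).1
  rw [abs_zero] at this
  linarith

lemma summable_dilates (ξ : ℝ) : Summable fun n : ℕ => φ (((2 : ℝ) ^ (n + 1))⁻¹ * ξ) := by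
  obtain ⟨a, b, ha, -, hab⟩ := hφ.annulus
  obtain ⟨M, hM⟩ := exists_lt_two_pow_mul ha ξ
  refine summable_of_ne_finset_zero (s := Finset.range M) fun n hn => ?_
  exact apply_dilate_eq_zero (fun ξ h => (hab ξ h).1) hM (by simpa using hn)

/-- Near any point only finitely many of the dilates with `j ≥ 1` are nonzero, the origin included.
Defining `lowPass` as one minus these dilates thus gives smoothness at zero and the value `1` there,
which the sum over `j ≤ 0` does not have. -/
lemma lowPass_smooth : ContDiff ℝ ∞ (lowPass φ) := by
  obtain ⟨a, b, ha, -, hab⟩ := hφ.annulus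
  refine contDiff_iff_contDiffAt.2 fun ξ => ?_
  obtain ⟨M, hM⟩ := exists_lt_two_pow_mul ha ξ
  have h1 : ContDiff ℝ ∞ fun ζ => 1 - ∑ n ∈ Finset.range M, φ (((2 : ℝ) ^ (n + 1))⁻¹ * ζ) :=
    contDiff_const.sub (ContDiff.sum fun n _ =>
      hφ.smooth.comp (by fun_prop : ContDiff ℝ ∞ fun ζ : ℝ => ((2 : ℝ) ^ (n + 1))⁻¹ * ζ))
  refine h1.contDiffAt.congr_of_eventuallyEq ?_
  have h2 : ∀ᶠ ζ in 𝓝 ξ, |ζ| < 2 ^ M * a := continuous_abs.continuousAt.eventually_lt_const hM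
  filter_upwards [h2] with ζ hζ
  rw [lowPass, tsum_eq_sum (s := Finset.range M)]
  exact fun n hn => apply_dilate_eq_zero (fun ξ h => (hab ξ h).1) hζ (by simpa using hn)

lemma lowPass_zero : lowPass φ 0 = 1 := by
  simp [lowPass, hφ.apply_zero]

/-- Beyond `b` the dilates with `j ≤ 0` vanish, so those with `j ≥ 1` already sum to one. -/
lemma lowPass_eq_zero {b : ℝ} (hb : 0 < b) (hab : ∀ ξ, φ ξ ≠ 0 → |ξ| ≤ b) {ξ : ℝ} (hξ : b < |ξ|) :
    lowPass φ ξ = 0 := by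
  have hξ0 : ξ ≠ 0 := by
    rintro rfl
    rw [abs_zero] at hξ
    linarith
  have hinj : Function.Injective fun n : ℕ => (n : ℤ) + 1 := fun m n h => by
    simpa using h
  have h1 := (hinj.hasSum_iff ?_).2 (hφ.partition ξ hξ0)
  · have h2 : ∀ n : ℕ, φ (((2 : ℝ) ^ (n + 1))⁻¹ * ξ) = φ ((2 : ℝ) ^ (-((n : ℤ) + 1)) * ξ) :=
      fun n => by
        rw [zpow_neg]; norm_cast
    rw [lowPass, tsum_congr h2, sub_eq_zero]
    exact h1.tsum_eq.symm
  · intro j hj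
    have hj0 : j ≤ 0 := by
      by_contra h
      exact hj ⟨(j - 1).toNat, by dsimp only; omega⟩
    by_contra h
    have h3 := hab _ h
    rw [abs_mul, abs_of_pos (by positivity)] at h3
    have h4 : (1 : ℝ) ≤ 2 ^ (-j) := one_le_zpow₀ (by norm_num) (by omega)
    nlinarith

lemma testSymbol_lowPass : TestSymbol (fun ξ => (lowPass φ ξ : ℂ)) := by
  obtain ⟨a, b, ha, hlt, hab⟩ := hφ.annulus
  refine ⟨Complex.ofRealCLM.contDiff.comp hφ.lowPass_smooth, ?_⟩
  refine HasCompactSupport.intro (isCompact_Icc (a := -b) (b := b)) fun ξ hξ => ?_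
  rw [hφ.lowPass_eq_zero (by linarith) (fun ξ h => (hab ξ h).2), Complex.ofReal_zero]
  by_contra h
  exact hξ (abs_le.1 (not_lt.1 h))

/-- This is the telescoping relation: successive low-pass operators differ by one block. -/
lemma lowPass_eq_add (ξ : ℝ) : lowPass φ ξ = lowPass φ (2 * ξ) + φ ξ := by
  have h1 : ∀ n : ℕ, φ (((2 : ℝ) ^ (n + 1))⁻¹ * (2 * ξ)) = φ (((2 : ℝ) ^ n)⁻¹ * ξ) := fun n => by
    congr 1; field_simp; ring
  have h2 : Summable fun n : ℕ => φ (((2 : ℝ) ^ n)⁻¹ * ξ) :=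
    (summable_nat_add_iff 1).1 (hφ.summable_dilates ξ)
  simp only [lowPass]
  rw [tsum_congr h1, h2.tsum_eq_zero_add]
  simp only [pow_zero, inv_one, one_mul]
  ring

lemma dilatedConv_lowPass_succ {U : ℝ → ℂ} (hU : PolyGrowth U) (j : ℤ) (t : ℝ) :
    dilatedConv (symbolKernel fun ξ => (lowPass φ ξ : ℂ)) U ((2 : ℝ) ^ (j + 1))⁻¹ t =
      dilatedConv (symbolKernel fun ξ => (lowPass φ ξ : ℂ)) U ((2 : ℝ) ^ j)⁻¹ t +
        lpBlock φ (j + 1) U t := by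
  have hc : ∀ i : ℤ, (0 : ℝ) < ((2 : ℝ) ^ i)⁻¹ := fun i => by positivity
  have hint : ∀ {m : ℝ → ℂ}, TestSymbol m →
      Integrable (fun s => symbolKernel m (t - s) * U s) := fun hm => by
    obtain ⟨C, N, h⟩ := convGrowth_symbolKernel hm hU.isTemperedFunction
    exact (h t).1
  rw [← integral_symbolKernel_dilate_mul _ _ (hc _), ← integral_symbolKernel_dilate_mul _ _ (hc _),
    lpBlock_eq_symbolKernel]
  have hl := hφ.testSymbol_lowPass.dilate (hc j).ne'
  have hb := hφ.testSymbol_band (j + 1)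
  rw [← integral_add (hint hl) (hint hb)]
  refine integral_congr_ae (Eventually.of_forall fun s => ?_)
  dsimp only
  rw [← add_mul, ← congrFun (symbolKernel_add hl.integrable hb.integrable) (t - s)]
  congr 3
  funext ξ
  rw [hφ.lowPass_eq_add, bandSymbol]
  have : 2 * (((2 : ℝ) ^ (j + 1))⁻¹ * ξ) = ((2 : ℝ) ^ j)⁻¹ * ξ := by
    rw [zpow_add_one₀ two_ne_zero]; field_simp
  rw [this]
  push_cast
  rfl

lemma enorm_dilatedConv_lowPass_sub_le {U : ℝ → ℂ} (hU : PolyGrowth U) (j : ℤ) (n : ℕ) (t : ℝ) :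
    ‖dilatedConv (symbolKernel fun ξ => (lowPass φ ξ : ℂ)) U ((2 : ℝ) ^ (j + n))⁻¹ t -
      dilatedConv (symbolKernel fun ξ => (lowPass φ ξ : ℂ)) U ((2 : ℝ) ^ j)⁻¹ t‖ₑ ≤
      ∑' i : ℤ, ‖lpBlock φ i U t‖ₑ := by
  have h1 : dilatedConv (symbolKernel fun ξ => (lowPass φ ξ : ℂ)) U ((2 : ℝ) ^ (j + n))⁻¹ t -
      dilatedConv (symbolKernel fun ξ => (lowPass φ ξ : ℂ)) U ((2 : ℝ) ^ j)⁻¹ t =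
      ∑ i ∈ Finset.range n, lpBlock φ (j + i + 1) U t := by
    induction n with
    | zero => simp
    | succ n ih =>
      rw [Finset.sum_range_succ, ← ih]
      have := hφ.dilatedConv_lowPass_succ hU (j + n) t
      push_cast
      rw [← add_assoc, this]
      ring
  rw [h1]
  have hinj : Function.Injective fun n : ℕ => j + (n : ℤ) + 1 := fun m n h => by
    simpa using h
  calc _ ≤ ∑ i ∈ Finset.range n, ‖lpBlock φ (j + i + 1) U t‖ₑ := enorm_sum_le _ _
    _ ≤ ∑' i : ℕ, ‖lpBlock φ (j + i + 1) U t‖ₑ := ENNReal.sum_le_tsum _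
    _ ≤ _ := ENNReal.tsum_comp_le_tsum_of_injective hinj fun i => ‖lpBlock φ i U t‖ₑ

/-- The telescoped bound, passed to the limit of infinite cutoff frequency, where the low-pass
operators reproduce `U(t)`. -/
lemma enorm_sub_dilatedConv_lowPass_le {U : ℝ → ℂ} (hU : PolyGrowth U) (j : ℤ) (t : ℝ) :
    ‖U t - dilatedConv (symbolKernel fun ξ => (lowPass φ ξ : ℂ)) U ((2 : ℝ) ^ j)⁻¹ t‖ₑ ≤
      ∑' i : ℤ, ‖lpBlock φ i U t‖ₑ := by
  have h1 : Tendsto (fun n : ℕ => ((2 : ℝ) ^ (j + n))⁻¹) atTop (𝓝[>] 0) := by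
    refine tendsto_nhdsWithin_iff.2 ⟨?_, Eventually.of_forall fun n => by
      simp only [mem_Ioi]; positivity⟩
    have h2 : ∀ n : ℕ, ((2 : ℝ) ^ (j + n))⁻¹ = ((2 : ℝ) ^ j)⁻¹ * (1 / 2) ^ n := fun n => by
      rw [zpow_add₀ two_ne_zero, mul_inv, zpow_natCast, one_div, inv_pow]
    simp_rw [h2]
    simpa using (tendsto_pow_atTop_nhds_zero_of_lt_one (r := (1 / 2 : ℝ)) (by norm_num)
      (by norm_num)).const_mul ((2 : ℝ) ^ j)⁻¹
  have h2 := (tendsto_dilatedConv_zero hφ.testSymbol_lowPass hU t).comp h1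
  rw [hφ.lowPass_zero, Complex.ofReal_one, one_mul] at h2
  refine le_of_tendsto (h2.sub_const _).enorm (Eventually.of_forall fun n => ?_)
  exact hφ.enorm_dilatedConv_lowPass_sub_le hU j n t

lemma continuous_lpBlock {U : ℝ → ℂ} (hU : IsTemperedFunction U) (j : ℤ) :
    Continuous (lpBlock φ j U) := by
  have := continuous_symbolKernel_conv (hφ.testSymbol_band j) hU
  simpa only [← lpBlock_eq_symbolKernel] using this

end IsLittlewoodPaleyCutoff

/-! ### Removal of the low-frequency part. -/

/-- The binomial expansion of the `k`-th backward difference is solved for its undisplaced term; the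
others are evaluated at `t - R, …, t - kR`, in the past. -/
lemma norm_le_fwdDiff_iter (k : ℕ) (R : ℝ) (F : ℝ → ℂ) (t : ℝ) :
    ‖F t‖ₑ ≤ ‖(fwdDiff (-R))^[k] F t‖ₑ +
      ∑ i ∈ Finset.range k, (k.choose (i + 1) : ℝ≥0∞) * ‖F (t - (i + 1 : ℕ) * R)‖ₑ := by
  have h1 := fwdDiff_iter_eq_sum_shift (-R) F k t
  rw [Finset.sum_range_succ'] at h1
  simp only [zero_smul, add_zero, Nat.sub_zero, Nat.choose_zero_right, Nat.cast_one, mul_one] at h1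
  have h2 : ‖((-1 : ℤ) ^ k) • F t‖ₑ = ‖F t‖ₑ := by
    rcases neg_one_pow_eq_or ℤ k with h | h <;> simp [h]
  rw [← h2, ← sub_eq_iff_eq_add'.2 h1]
  refine (enorm_sub_le).trans ?_
  gcongr
  refine (enorm_sum_le _ _).trans (Finset.sum_le_sum fun i _ => le_of_eq ?_)
  have h3 : t + (i + 1) • -R = t - (i + 1 : ℕ) * R := by rw [nsmul_eq_mul]; ring
  rw [h3, mul_smul]
  have h4 : ∀ z : ℂ, ‖((-1 : ℤ) ^ (k - (i + 1))) • z‖ₑ = ‖z‖ₑ := fun z => by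
    rcases neg_one_pow_eq_or ℤ (k - (i + 1)) with h | h <;> simp [h]
  rw [h4, zsmul_eq_mul, enorm_mul]
  congr 1
  simp [enorm_eq_nnnorm]

lemma MeanVanishesInPast.add {F G : ℝ → ℝ≥0∞} (hF : MeanVanishesInPast F)
    (hG : MeanVanishesInPast G) (hFm : Measurable F) : MeanVanishesInPast (fun t => F t + G t) := by
  intro t c hc
  have h := (hF t c hc).add (hG t c hc)
  rw [add_zero] at h
  refine h.congr fun n => ?_
  have hm : Measurable fun r : ℝ => F (t - c * r) := hFm.comp (by fun_prop)
  dsimp only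
  rw [lintegral_add_left hm, mul_add]

/-- A bound by values in the far past, whose means vanish, is trivial. -/
lemma le_of_le_add_sum_past {G : ℝ → ℝ≥0∞} (hG : MeanVanishesInPast G) (hGm : Measurable G)
    {k : ℕ} {c : ℕ → ℝ≥0∞} (hc : ∀ i, c i ≠ ⊤) {t : ℝ} {u e : ℝ≥0∞}
    (h : ∀ R : ℝ, 0 ≤ R → u ≤ e + ∑ i ∈ Finset.range k, c i * G (t - (i + 1 : ℕ) * R)) : u ≤ e := by
  have h1 : ∀ n : ℕ, 1 ≤ n → u ≤ e + ∑ i ∈ Finset.range k, c i *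
      ((n : ℝ≥0∞)⁻¹ * ∫⁻ r in Icc (n : ℝ) (2 * n), G (t - (i + 1 : ℕ) * r)) := by
    intro n hn
    have hn0 : (n : ℝ≥0∞) ≠ 0 := by exact_mod_cast (by omega : n ≠ 0)
    have hm : ∀ i : ℕ, Measurable fun r : ℝ => G (t - (i + 1 : ℕ) * r) := fun i =>
      hGm.comp (by fun_prop)
    -- Integrating the hypothesis over `R` in `[n, 2n]` and dividing by `n` turns the past values
    -- into the means that vanish.
    have h2 : ∫⁻ _ in Icc (n : ℝ) (2 * n), u ≤ ∫⁻ r in Icc (n : ℝ) (2 * n),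
        (e + ∑ i ∈ Finset.range k, c i * G (t - (i + 1 : ℕ) * r)) :=
      setLIntegral_mono' measurableSet_Icc fun r hr => h r ((Nat.cast_nonneg n).trans hr.1)
    rw [lintegral_add_left measurable_const,
      lintegral_finsetSum _ fun i _ => (hm i).const_mul (c i)] at h2
    simp only [setLIntegral_const, Real.volume_Icc, show (2 * n - n : ℝ) = n by ring,
      ENNReal.ofReal_natCast] at h2
    calc u = (n : ℝ≥0∞)⁻¹ * (u * n) := by
          rw [mul_comm u, ← mul_assoc, ENNReal.inv_mul_cancel hn0 (by simp), one_mul]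
      _ ≤ _ := mul_le_mul_right h2 _
      _ = _ := by
        rw [mul_add, mul_comm e, ← mul_assoc, ENNReal.inv_mul_cancel hn0 (by simp), one_mul,
          Finset.mul_sum]
        congr 1
        refine Finset.sum_congr rfl fun i _ => ?_
        rw [lintegral_const_mul _ (hm i)]
        ring
  have h3 : Tendsto (fun n : ℕ => e + ∑ i ∈ Finset.range k, c i *
      ((n : ℝ≥0∞)⁻¹ * ∫⁻ r in Icc (n : ℝ) (2 * n), G (t - (i + 1 : ℕ) * r))) atTop (𝓝 (e + 0)) := by
    refine tendsto_const_nhds.add ?_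
    have : (0 : ℝ≥0∞) = ∑ i ∈ Finset.range k, c i * 0 := by simp
    rw [this]
    refine tendsto_finsetSum _ fun i _ => ?_
    exact ENNReal.Tendsto.const_mul (hG t (i + 1 : ℕ) (by positivity)) (Or.inr (hc i))
  rw [add_zero] at h3
  refine ge_of_tendsto h3 ?_
  filter_upwards [eventually_ge_atTop 1] with n hn using h1 n hn

/-- A function of polynomial growth whose means vanish in the past has no low-frequency part: it is
controlled by its Littlewood-Paley blocks. -/
lemma IsLittlewoodPaleyCutoff.enorm_le_tsum {φ : ℝ → ℝ} (hφ : IsLittlewoodPaleyCutoff φ)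
    {U : ℝ → ℂ} (hU : PolyGrowth U) (hmean : MeanVanishesInPast fun t => ‖U t‖ₑ)
    (hE : MeanVanishesInPast fun t => ∑' i : ℤ, ‖lpBlock φ i U t‖ₑ) (t : ℝ) :
    ‖U t‖ₑ ≤ ∑' i : ℤ, ‖lpBlock φ i U t‖ₑ := by
  set E : ℝ → ℝ≥0∞ := fun t => ∑' i : ℤ, ‖lpBlock φ i U t‖ₑ with hEdef
  have hEm : Measurable E := Measurable.tsum fun i =>
    (hφ.continuous_lpBlock hU.isTemperedFunction i).enorm.measurable
  set T : ℝ → ℝ → ℂ := dilatedConv (symbolKernel fun ξ => (lowPass φ ξ : ℂ)) U with hT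
  have hUm : Measurable fun t => ‖U t‖ₑ := hU.continuous.enorm.measurable
  obtain ⟨k, hk⟩ := tendsto_fwdDiff_iter_dilatedConv hφ.testSymbol_lowPass hU
  have hlim : Tendsto (fun n : ℕ => ((2 : ℝ) ^ (-(n : ℤ)))⁻¹) atTop atTop := by
    simp only [zpow_neg, inv_inv, zpow_natCast]
    exact tendsto_pow_atTop_atTop_of_one_lt one_lt_two
  refine le_of_le_add_sum_past (G := fun t => ‖U t‖ₑ + E t) (hmean.add hE hUm) (hUm.add hEm)
    (k := k) (c := fun i => (k.choose (i + 1) : ℝ≥0∞)) (fun i => by simp) (t := t) fun R hR => ?_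
  -- The low-pass part is bounded by `|U| + E` uniformly in `n`, so the displaced terms survive the
  -- limit `n → ∞` while the finite difference disappears.
  have hTle : ∀ (n : ℕ) (s : ℝ), ‖T ((2 : ℝ) ^ (-(n : ℤ)))⁻¹ s‖ₑ ≤ ‖U s‖ₑ + E s := fun n s => by
    have h1 := hφ.enorm_sub_dilatedConv_lowPass_le hU (-(n : ℤ)) s
    calc _ = ‖U s - (U s - T ((2 : ℝ) ^ (-(n : ℤ)))⁻¹ s)‖ₑ := by rw [sub_sub_cancel]
      _ ≤ ‖U s‖ₑ + ‖U s - T ((2 : ℝ) ^ (-(n : ℤ)))⁻¹ s‖ₑ := enorm_sub_le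
      _ ≤ _ := by gcongr
  have hstep : ∀ n : ℕ, ‖U t‖ₑ ≤ E t + (‖(fwdDiff (-R))^[k] (T ((2 : ℝ) ^ (-(n : ℤ)))⁻¹) t‖ₑ +
      ∑ i ∈ Finset.range k, (k.choose (i + 1) : ℝ≥0∞) *
        (‖U (t - (i + 1 : ℕ) * R)‖ₑ + E (t - (i + 1 : ℕ) * R))) := fun n => by
    have h1 := hφ.enorm_sub_dilatedConv_lowPass_le hU (-(n : ℤ)) t
    calc ‖U t‖ₑ = ‖(U t - T ((2 : ℝ) ^ (-(n : ℤ)))⁻¹ t) + T ((2 : ℝ) ^ (-(n : ℤ)))⁻¹ t‖ₑ := by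
          rw [sub_add_cancel]
      _ ≤ ‖U t - T ((2 : ℝ) ^ (-(n : ℤ)))⁻¹ t‖ₑ + ‖T ((2 : ℝ) ^ (-(n : ℤ)))⁻¹ t‖ₑ :=
          enorm_add_le _ _
      _ ≤ _ := by
          refine add_le_add h1 ((norm_le_fwdDiff_iter k R _ t).trans ?_)
          gcongr with i
          exact hTle n _
  have h3 : Tendsto (fun n : ℕ => E t + (‖(fwdDiff (-R))^[k] (T ((2 : ℝ) ^ (-(n : ℤ)))⁻¹) t‖ₑ +
      ∑ i ∈ Finset.range k, (k.choose (i + 1) : ℝ≥0∞) *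
        (‖U (t - (i + 1 : ℕ) * R)‖ₑ + E (t - (i + 1 : ℕ) * R)))) atTop
      (𝓝 (E t + (‖(0 : ℂ)‖ₑ + ∑ i ∈ Finset.range k, (k.choose (i + 1) : ℝ≥0∞) *
        (‖U (t - (i + 1 : ℕ) * R)‖ₑ + E (t - (i + 1 : ℕ) * R))))) :=
    tendsto_const_nhds.add ((((hk R t hR).comp hlim).enorm).add tendsto_const_nhds)
  rw [enorm_zero, zero_add] at h3
  exact ge_of_tendsto h3 (Eventually.of_forall hstep)

lemma IsLittlewoodPaleyCutoff.eLpNorm_le_tsum {φ : ℝ → ℝ} (hφ : IsLittlewoodPaleyCutoff φ)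
    {U : ℝ → ℂ} (hU : PolyGrowth U) (hmean : MeanVanishesInPast fun t => ‖U t‖ₑ) {q : ℝ}
    (hq : 1 ≤ q) : eLpNorm U (ENNReal.ofReal q) volume ≤
      ∑' j : ℤ, eLpNorm (lpBlock φ j U) (ENNReal.ofReal q) volume := by
  have hq0 : 0 < q := by linarith
  have hd : ∀ i : ℤ, Measurable fun t => ‖lpBlock φ i U t‖ₑ := fun i =>
    (hφ.continuous_lpBlock hU.isTemperedFunction i).enorm.measurable
  have hroot : ∀ f : ℝ → ℂ, eLpNorm f (ENNReal.ofReal q) volume =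
      (∫⁻ x, ‖f x‖ₑ ^ q) ^ (1 / q) := fun f => by
    rw [← eLpNorm_rpow_eq f hq, ← ENNReal.rpow_mul, mul_one_div_cancel hq0.ne', ENNReal.rpow_one]
  -- When the right side is finite, Minkowski's inequality puts the sum of the moduli of the blocks
  -- in `L^q`, so its past means vanish as well; otherwise there is nothing to prove.
  rcases eq_or_ne (∑' j : ℤ, eLpNorm (lpBlock φ j U) (ENNReal.ofReal q) volume) ⊤ with h | h
  · rw [h]; exact le_top
  have hM := lintegral_rpow_tsum_le (μ := (volume : Measure ℝ)) hd hq
  simp only [← hroot] at hM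
  have hfin : ∫⁻ t, (∑' i : ℤ, ‖lpBlock φ i U t‖ₑ) ^ q ≠ ⊤ := by
    intro htop
    rw [htop, ENNReal.top_rpow_of_pos (by positivity)] at hM
    exact h (top_le_iff.1 hM)
  have hE := meanVanishesInPast_of_Lq (Measurable.tsum hd) hq hfin
  rw [hroot]
  refine le_trans ?_ hM
  gcongr with t
  exact hφ.enorm_le_tsum hU hmean hE t

/-! ### The phase `√(iξ)` -/

/-- The principal square root of `iξ`. -/
noncomputable def heatPhase (ξ : ℝ) : ℂ := Complex.sqrt (Complex.I * ξ)

lemma heatPhase_sq (ξ : ℝ) : heatPhase ξ ^ 2 = Complex.I * ξ := sqrt_sq _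

lemma heatPhase_re (ξ : ℝ) : (heatPhase ξ).re = Real.sqrt (|ξ| / 2) := by
  rw [heatPhase, Complex.sqrt, Complex.cpow_inv_two_re]
  simp

lemma heatPhase_ne_zero {ξ : ℝ} (hξ : ξ ≠ 0) : heatPhase ξ ≠ 0 := fun h => by
  have h1 := heatPhase_sq ξ
  rw [h] at h1
  simp at h1
  exact hξ h1

/-- Both sides have the same square, and their real parts are nonnegative, which excludes the
opposite sign except at `ξ = 0`. -/
lemma heatPhase_sq_mul {c : ℝ} (hc : 0 < c) (ξ : ℝ) : heatPhase (c ^ 2 * ξ) = c * heatPhase ξ := by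
  have h1 : heatPhase (c ^ 2 * ξ) ^ 2 = (c * heatPhase ξ) ^ 2 := by
    rw [mul_pow, heatPhase_sq, heatPhase_sq]; push_cast; ring
  rcases eq_or_eq_neg_of_sq_eq_sq _ _ h1 with h | h
  · exact h
  · have h2 := congrArg Complex.re h
    rw [Complex.neg_re, Complex.re_ofReal_mul, heatPhase_re, heatPhase_re] at h2
    have h3 : 0 ≤ Real.sqrt (|c ^ 2 * ξ| / 2) := Real.sqrt_nonneg _
    have h4 : 0 ≤ c * Real.sqrt (|ξ| / 2) := by positivity
    have h5 : Real.sqrt (|ξ| / 2) = 0 := by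
      have : c * Real.sqrt (|ξ| / 2) = 0 := by linarith
      exact (mul_eq_zero.1 this).resolve_left hc.ne'
    have h6 : ξ = 0 := by
      rw [Real.sqrt_eq_zero (by positivity)] at h5
      exact abs_eq_zero.1 (by linarith)
    subst h6
    simp [heatPhase]

lemma contDiffOn_heatPhase : ContDiffOn ℝ ∞ heatPhase {0}ᶜ := by
  intro ξ hξ
  refine ContDiffAt.contDiffWithinAt ?_
  have h1 : ContDiffAt ℝ ∞ (fun ξ : ℝ => Complex.exp (Complex.log (Complex.I * ξ) / 2)) ξ := by
    have h2 : ContDiffAt ℝ ∞ Complex.log (Complex.I * ξ) :=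
      (Complex.contDiffAt_log (I_mul_mem_slitPlane hξ)).restrict_scalars ℝ
    have h3 : ContDiffAt ℝ ∞ (fun ξ : ℝ => Complex.I * (ξ : ℂ)) ξ :=
      (contDiff_const.mul Complex.ofRealCLM.contDiff).contDiffAt
    exact ((h2.comp ξ h3).div_const 2).cexp
  refine h1.congr_of_eventuallyEq ?_
  filter_upwards [isOpen_compl_singleton.mem_nhds hξ] with ζ hζ
  rw [heatPhase, sqrt_eq_exp (by simpa using hζ)]

lemma contDiffOn_deriv_heatPhase : ContDiffOn ℝ ∞ (deriv heatPhase) {0}ᶜ :=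
  contDiffOn_heatPhase.deriv_of_isOpen isOpen_compl_singleton (by simp)

lemma hasDerivAt_heatPhase {ξ : ℝ} (hξ : ξ ≠ 0) : HasDerivAt heatPhase (deriv heatPhase ξ) ξ :=
  ((contDiffOn_heatPhase.contDiffAt (isOpen_compl_singleton.mem_nhds hξ)).differentiableAt
    (by simp)).hasDerivAt

/-! ### Symbols supported in an annulus -/

/-- Smooth symbols supported in `{a ≤ |ξ| ≤ b}`. -/
structure AnnulusSymbol (a b : ℝ) (A : ℝ → ℂ) : Prop where
  smooth : ContDiff ℝ ∞ A
  support : ∀ ξ, A ξ ≠ 0 → a ≤ |ξ| ∧ |ξ| ≤ b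

namespace AnnulusSymbol

variable {a b : ℝ} {A B : ℝ → ℂ}

lemma testSymbol (hA : AnnulusSymbol a b A) : TestSymbol A := by
  refine ⟨hA.smooth, HasCompactSupport.intro (isCompact_Icc (a := -b) (b := b)) fun ξ hξ => ?_⟩
  by_contra h
  exact hξ (abs_le.1 (hA.support ξ h).2)

lemma eventually_zero (hA : AnnulusSymbol a b A) (ha : 0 < a) : A =ᶠ[𝓝 0] fun _ => 0 := by
  have : ∀ᶠ ξ : ℝ in 𝓝 0, |ξ| < a :=
    continuous_abs.continuousAt.eventually_lt_const (by simpa using ha)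
  filter_upwards [this] with ξ hξ
  by_contra h
  exact absurd (hA.support ξ h).1 (not_le.2 hξ)

/-- The factor may be singular at the origin because the annulus stays away from it; this admits
`√(iξ)`, its inverse and its derivative. -/
lemma mul (hA : AnnulusSymbol a b A) (ha : 0 < a) {f : ℝ → ℂ} (hf : ContDiffOn ℝ ∞ f {0}ᶜ) :
    AnnulusSymbol a b (fun ξ => f ξ * A ξ) := by
  refine ⟨contDiff_iff_contDiffAt.2 fun ξ => ?_, fun ξ h => hA.support ξ (right_ne_zero_of_mul h)⟩
  rcases eq_or_ne ξ 0 with rfl | hξ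
  · refine (contDiffAt_const (c := (0 : ℂ))).congr_of_eventuallyEq ?_
    filter_upwards [hA.eventually_zero ha] with ζ hζ
    rw [hζ, mul_zero]
  · exact (hf.contDiffAt (isOpen_compl_singleton.mem_nhds hξ)).mul hA.smooth.contDiffAt

lemma deriv (hA : AnnulusSymbol a b A) : AnnulusSymbol a b (deriv A) := by
  refine ⟨(contDiff_infty_iff_deriv.1 hA.smooth).2, fun ξ h => ?_⟩
  have h1 : ξ ∈ tsupport A := by
    by_contra h2
    have h3 := notMem_tsupport_iff_eventuallyEq.1 h2
    exact h (by rw [h3.deriv_eq]; simp)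
  have hcl : IsClosed {ξ : ℝ | a ≤ |ξ| ∧ |ξ| ≤ b} :=
    (isClosed_le continuous_const continuous_abs).inter
      (isClosed_le continuous_abs continuous_const)
  exact closure_minimal (fun ξ hξ => hA.support ξ hξ) hcl h1

lemma add (hA : AnnulusSymbol a b A) (hB : AnnulusSymbol a b B) :
    AnnulusSymbol a b (fun ξ => A ξ + B ξ) := by
  refine ⟨hA.smooth.add hB.smooth, fun ξ h => ?_⟩
  by_cases h1 : A ξ = 0
  · exact hB.support ξ fun h2 => h (by rw [h1, h2, add_zero])
  · exact hA.support ξ h1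

lemma const_mul (hA : AnnulusSymbol a b A) (z : ℂ) : AnnulusSymbol a b (fun ξ => z * A ξ) :=
  ⟨contDiff_const.mul hA.smooth, fun ξ h => hA.support ξ (right_ne_zero_of_mul h)⟩

lemma bounded (hA : AnnulusSymbol a b A) : ∃ C : ℝ, 0 ≤ C ∧ ∀ ξ, ‖A ξ‖ ≤ C := by
  obtain ⟨C, hC⟩ := hA.smooth.continuous.bounded_above_of_compact_support hA.testSymbol.compact
  exact ⟨C, (norm_nonneg _).trans (hC 0), hC⟩

lemma contDiffOn_exp_heatPhase (w : ℝ) :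
    ContDiffOn ℝ ∞ (fun ξ => Complex.exp (w * heatPhase ξ)) {0}ᶜ :=
  (contDiffOn_const.mul contDiffOn_heatPhase).cexp

/-- The derivative has the same form, with the new amplitude `A' + w θ' A` for `θ = heatPhase`.
Applying this twice gives the second derivative, with a quadratic polynomial in `w`. -/
lemma deriv_exp_mul (hA : AnnulusSymbol a b A) (ha : 0 < a) (w : ℝ) :
    _root_.deriv (fun ξ => Complex.exp (w * heatPhase ξ) * A ξ) = fun ξ =>
      Complex.exp (w * heatPhase ξ) *
        (_root_.deriv A ξ + w * (_root_.deriv heatPhase ξ * A ξ)) := by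
  funext ξ
  rcases eq_or_ne ξ 0 with rfl | hξ
  · have h0 := hA.eventually_zero ha
    have h1 : (fun ξ => Complex.exp (w * heatPhase ξ) * A ξ) =ᶠ[𝓝 0] fun _ => 0 := by
      filter_upwards [h0] with ζ hζ
      rw [hζ, mul_zero]
    rw [h1.deriv_eq, h0.deriv_eq, h0.eq_of_nhds]
    simp
  · have h1 := (((hasDerivAt_heatPhase hξ).const_mul (w : ℂ)).cexp).mul
      (hA.smooth.differentiable (by simp) ξ).hasDerivAt
    refine h1.deriv.trans ?_
    ring

lemma integral_norm_exp_mul_le (hA : AnnulusSymbol a b A) (hb : 0 ≤ b) {w C E : ℝ}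
    (hC : ∀ ξ, ‖A ξ‖ ≤ C) (hE0 : 0 ≤ E)
    (hE : ∀ ξ, a ≤ |ξ| → |ξ| ≤ b → ‖Complex.exp (w * heatPhase ξ)‖ ≤ E) :
    ∫ ξ, ‖Complex.exp (w * heatPhase ξ) * A ξ‖ ≤ 2 * b * (C * E) := by
  have h1 : ∀ ξ, ‖Complex.exp (w * heatPhase ξ) * A ξ‖ ≤ (Icc (-b) b).indicator
      (fun _ => C * E) ξ := by
    intro ξ
    by_cases h : A ξ = 0
    · rw [h, mul_zero, norm_zero]
      exact indicator_nonneg (fun _ _ => mul_nonneg ((norm_nonneg _).trans (hC 0)) hE0) _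
    · obtain ⟨h2, h3⟩ := hA.support ξ h
      have hmem : ξ ∈ Icc (-b) b := abs_le.1 h3
      rw [indicator_of_mem hmem, norm_mul, mul_comm]
      have := hE ξ h2 h3
      have := hC ξ
      have := (norm_nonneg (A ξ)).trans this
      gcongr
  have h2 : Integrable ((Icc (-b) b).indicator fun _ : ℝ => C * E) :=
    (integrable_indicator_iff measurableSet_Icc).2 continuous_const.integrableOn_Icc
  refine (integral_mono_of_nonneg (Eventually.of_forall fun _ => norm_nonneg _) h2
    (Eventually.of_forall h1)).trans (le_of_eq ?_)
  rw [integral_indicator measurableSet_Icc, setIntegral_const, Real.volume_real_Icc_of_le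
    (by linarith), smul_eq_mul]
  ring

/-- The `L¹` norm of the kernel of an oscillating symbol. -/
lemma exists_lintegral_symbolKernel_le (hA : AnnulusSymbol a b A) (ha : 0 < a) (hb : 0 ≤ b) :
    ∃ C : ℝ, 0 ≤ C ∧ ∀ w E : ℝ, 0 ≤ E →
      (∀ ξ, a ≤ |ξ| → |ξ| ≤ b → ‖Complex.exp (w * heatPhase ξ)‖ ≤ E) →
      ∫⁻ t, ‖symbolKernel (fun ξ => Complex.exp (w * heatPhase ξ) * A ξ) t‖ₑ ≤
        ENNReal.ofReal (C * ((1 + w ^ 2) * E)) := by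
  have hS := hA.mul ha contDiffOn_deriv_heatPhase
  have hSS := hS.mul ha contDiffOn_deriv_heatPhase
  have hSD := hA.deriv.mul ha contDiffOn_deriv_heatPhase
  obtain ⟨c₀, h₀, hc₀⟩ := hA.bounded
  obtain ⟨c₁, h₁, hc₁⟩ := hA.deriv.deriv.bounded
  obtain ⟨c₂, h₂, hc₂⟩ := hS.deriv.bounded
  obtain ⟨c₃, h₃, hc₃⟩ := hSD.bounded
  obtain ⟨c₄, h₄, hc₄⟩ := hSS.bounded
  -- The `cᵢ` bound `A`, `A''`, `(θ'A)'`, `θ'A'` and `θ'²A` for `θ = heatPhase`; `2 * b` is the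
  -- length of an interval containing the support, and `π` comes from `lintegral_symbolKernel_le`.
  refine ⟨Real.pi * (2 * b) * (c₀ + c₁ + c₂ + c₃ + c₄), by positivity, fun w E hE0 hE => ?_⟩
  have hB : AnnulusSymbol a b
      (fun ξ => _root_.deriv A ξ + w * (_root_.deriv heatPhase ξ * A ξ)) :=
    hA.deriv.add (hS.const_mul w)
  have hT := (hA.mul ha (contDiffOn_exp_heatPhase w)).testSymbol
  refine (lintegral_symbolKernel_le hT).trans (ENNReal.ofReal_le_ofReal ?_)
  have hD2 : AnnulusSymbol a b (fun ξ => _root_.deriv (fun ξ => _root_.deriv A ξ +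
      w * (_root_.deriv heatPhase ξ * A ξ)) ξ + w * (_root_.deriv heatPhase ξ *
        (_root_.deriv A ξ + w * (_root_.deriv heatPhase ξ * A ξ)))) :=
    hB.deriv.add ((hB.mul ha contDiffOn_deriv_heatPhase).const_mul w)
  have e2 : iteratedDeriv 2 (fun ξ => Complex.exp (w * heatPhase ξ) * A ξ) = fun ξ =>
      Complex.exp (w * heatPhase ξ) * (_root_.deriv (fun ξ => _root_.deriv A ξ +
      w * (_root_.deriv heatPhase ξ * A ξ)) ξ + w * (_root_.deriv heatPhase ξ *
        (_root_.deriv A ξ + w * (_root_.deriv heatPhase ξ * A ξ)))) := by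
    rw [iteratedDeriv_succ, iteratedDeriv_one, hA.deriv_exp_mul ha, hB.deriv_exp_mul ha]
  have hw : 2 * |w| ≤ 1 + w ^ 2 := by nlinarith [sq_nonneg (|w| - 1), sq_abs w]
  have hw0 := abs_nonneg w
  have hbd : ∀ ξ, ‖_root_.deriv (fun ξ => _root_.deriv A ξ +
      w * (_root_.deriv heatPhase ξ * A ξ)) ξ + w * (_root_.deriv heatPhase ξ *
        (_root_.deriv A ξ + w * (_root_.deriv heatPhase ξ * A ξ)))‖ ≤
      (c₁ + c₂ + c₃ + c₄) * (1 + w ^ 2) := by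
    intro ξ
    have e3 : _root_.deriv (fun ξ => _root_.deriv A ξ +
        w * (_root_.deriv heatPhase ξ * A ξ)) ξ = _root_.deriv (_root_.deriv A) ξ +
        w * _root_.deriv (fun ξ => _root_.deriv heatPhase ξ * A ξ) ξ := by
      have d1 := hA.deriv.smooth.differentiable (by simp) ξ
      have d2 := hS.smooth.differentiable (by simp) ξ
      exact (d1.hasDerivAt.add (d2.hasDerivAt.const_mul (w : ℂ))).deriv
    have e4 : (w : ℂ) * (_root_.deriv heatPhase ξ *
        (_root_.deriv A ξ + w * (_root_.deriv heatPhase ξ * A ξ))) =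
        w * (_root_.deriv heatPhase ξ * _root_.deriv A ξ) +
        w ^ 2 * (_root_.deriv heatPhase ξ * (_root_.deriv heatPhase ξ * A ξ)) := by ring
    rw [e3, e4]
    have n1 : ‖(w : ℂ)‖ = |w| := by rw [Complex.norm_real, Real.norm_eq_abs]
    have n2 : ‖(w : ℂ) ^ 2‖ = w ^ 2 := by rw [norm_pow, n1, sq_abs]
    calc _ ≤ (‖_root_.deriv (_root_.deriv A) ξ‖ +
          ‖(w : ℂ) * _root_.deriv (fun ξ => _root_.deriv heatPhase ξ * A ξ) ξ‖) +
          (‖(w : ℂ) * (_root_.deriv heatPhase ξ * _root_.deriv A ξ)‖ +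
          ‖(w : ℂ) ^ 2 * (_root_.deriv heatPhase ξ * (_root_.deriv heatPhase ξ * A ξ))‖) := by
          refine (norm_add_le _ _).trans ?_
          gcongr <;> exact norm_add_le _ _
      _ ≤ (c₁ + |w| * c₂) + (|w| * c₃ + w ^ 2 * c₄) := by
          rw [norm_mul (w : ℂ), norm_mul (w : ℂ), norm_mul ((w : ℂ) ^ 2), n1, n2]
          gcongr
          · exact hc₁ ξ
          · exact hc₂ ξ
          · exact hc₃ ξ
          · exact hc₄ ξ
      _ ≤ _ := by nlinarith [sq_nonneg w, mul_nonneg h₁ (sq_nonneg w)]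
  have i1 := hA.integral_norm_exp_mul_le hb hc₀ hE0 hE
  have i2 := hD2.integral_norm_exp_mul_le hb hbd hE0 hE
  rw [e2]
  calc _ ≤ Real.pi * (2 * b * (c₀ * E) + 2 * b * ((c₁ + c₂ + c₃ + c₄) * (1 + w ^ 2) * E)) := by
        gcongr
    _ ≤ Real.pi * (2 * b * (c₀ * (1 + w ^ 2) * E) +
        2 * b * ((c₁ + c₂ + c₃ + c₄) * (1 + w ^ 2) * E)) := by
        gcongr
        exact le_mul_of_one_le_right h₀ (by nlinarith [sq_nonneg w])
    _ = _ := by ring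

end AnnulusSymbol

/-- A smooth symbol equal to one on `{a ≤ |ξ| ≤ b}` and supported in a larger annulus. -/
lemma exists_annulusSymbol_eq_one {a b : ℝ} (ha : 0 < a) (hb : 0 < b) :
    ∃ χ : ℝ → ℂ, AnnulusSymbol (a / 2) (2 * b) χ ∧ ∀ ξ, a ≤ |ξ| → |ξ| ≤ b → χ ξ = 1 := by
  refine ⟨fun ξ => ((Real.smoothTransition ((ξ ^ 2 - a ^ 2 / 4) / (3 * a ^ 2 / 4)) *
    Real.smoothTransition ((4 * b ^ 2 - ξ ^ 2) / (3 * b ^ 2)) : ℝ) : ℂ), ⟨?_, fun ξ h => ?_⟩,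
    fun ξ h1 h2 => ?_⟩
  · refine Complex.ofRealCLM.contDiff.comp (ContDiff.mul ?_ ?_)
    · exact Real.smoothTransition.contDiff.comp
        (by fun_prop : ContDiff ℝ ∞ fun ξ : ℝ => (ξ ^ 2 - a ^ 2 / 4) / (3 * a ^ 2 / 4))
    · exact Real.smoothTransition.contDiff.comp
        (by fun_prop : ContDiff ℝ ∞ fun ξ : ℝ => (4 * b ^ 2 - ξ ^ 2) / (3 * b ^ 2))
  · rw [Complex.ofReal_ne_zero] at h
    constructor
    · by_contra h1
      refine left_ne_zero_of_mul h (Real.smoothTransition.zero_of_nonpos ?_)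
      apply div_nonpos_of_nonpos_of_nonneg _ (by positivity)
      nlinarith [abs_nonneg ξ, sq_abs ξ]
    · by_contra h1
      refine right_ne_zero_of_mul h (Real.smoothTransition.zero_of_nonpos ?_)
      apply div_nonpos_of_nonpos_of_nonneg _ (by positivity)
      nlinarith [abs_nonneg ξ, sq_abs ξ]
  · dsimp only
    rw [Real.smoothTransition.one_of_one_le, Real.smoothTransition.one_of_one_le]
    · simp
    · rw [le_div_iff₀ (by positivity)]; nlinarith [abs_nonneg ξ, sq_abs ξ]
    · rw [le_div_iff₀ (by positivity)]; nlinarith [abs_nonneg ξ, sq_abs ξ]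

/-! ### Littlewood-Paley blocks of the heat extension -/

/-- The time slice at height `x` of the second derivative of the heat extension. -/
noncomputable def heatSlice (g : ℝ → ℂ) (x t : ℝ) : ℂ :=
  ∫ s : ℝ, (heatKernelXX x (t - s) : ℂ) * g s

lemma norm_exp_mul_heatPhase (w ξ : ℝ) :
    ‖Complex.exp (w * heatPhase ξ)‖ = Real.exp (w * Real.sqrt (|ξ| / 2)) := by
  rw [Complex.norm_exp, Complex.re_ofReal_mul, heatPhase_re]

lemma sqrt_two_zpow_sq (j : ℤ) : (Real.sqrt 2 ^ j) ^ 2 = (2 : ℝ) ^ j := by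
  rw [← zpow_natCast, ← zpow_mul, mul_comm, zpow_mul, zpow_natCast, Real.sq_sqrt (by norm_num)]

lemma heatPhase_dyadic (j : ℤ) (ξ : ℝ) :
    heatPhase ξ = (Real.sqrt 2 ^ j : ℝ) * heatPhase (((2 : ℝ) ^ j)⁻¹ * ξ) := by
  rw [← heatPhase_sq_mul (by positivity), sqrt_two_zpow_sq, mul_inv_cancel_left₀ (by positivity)]

lemma TestSymbol.const_mul_dilate {F : ℝ → ℂ} (hF : TestSymbol F) (z : ℂ) {c : ℝ} (hc : 0 < c) :
    TestSymbol (fun ξ => z * F (c⁻¹ * ξ)) :=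
  ⟨contDiff_const.mul (hF.dilate (inv_pos.2 hc).ne').smooth,
    (hF.dilate (inv_pos.2 hc).ne').compact.mul_left⟩

lemma lintegral_symbolKernel_const_mul_dilate (F : ℝ → ℂ) {z c : ℝ} (hz : 0 ≤ z) (hc : 0 < c) :
    ∫⁻ t, ‖symbolKernel (fun ξ => (z : ℂ) * F (c⁻¹ * ξ)) t‖ₑ =
      ENNReal.ofReal z * ∫⁻ t, ‖symbolKernel F t‖ₑ := by
  rw [symbolKernel_const_mul]
  simp_rw [enorm_mul, enorm_complex_ofReal, Real.enorm_of_nonneg hz]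
  rw [lintegral_const_mul' _ _ ENNReal.ofReal_ne_top, lintegral_symbolKernel_dilate F hc]

section

variable {g : ℝ → ℂ} {N : ℕ}

lemma symbolKernel_conv_heatSlice {m : ℝ → ℂ} (hm : TestSymbol m)
    (hg : AEStronglyMeasurable g volume) (hw : Integrable (fun s => pastWeight N s * ‖g s‖)) {x : ℝ}
    (hx : 0 < x) (t : ℝ) :
    ∫ r, symbolKernel m (t - r) * heatSlice g x r =
      ∫ s, symbolKernel (fun ξ => m ξ * angularFourier (fun t => (heatKernelXX x t : ℂ)) ξ) (t - s) *
        g s := by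
  obtain ⟨C, -, hC⟩ := integral_heatKernelXX_growth hg hw hx
  have hmeas : Measurable fun t => (heatKernelXX x t : ℂ) :=
    Complex.measurable_ofReal.comp (measurable_heatKernelXX.comp measurable_prodMk_left)
  exact symbolKernel_conv_conv hm hmeas.stronglyMeasurable (integrable_heatKernelXX hx).ofReal hg
    ⟨C, N + 1, hC⟩ t

end

namespace IsLittlewoodPaleyCutoff

variable {φ : ℝ → ℝ} {q : ℝ}

/-- A block of the boundary function is controlled by the heat extension at comparable heights. -/
lemma exists_eLpNorm_lpBlock_le (hφ : IsLittlewoodPaleyCutoff φ) (hq : 1 ≤ q) :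
    ∃ C : ℝ, 0 ≤ C ∧ ∀ (g : ℝ → ℂ) (N : ℕ), AEStronglyMeasurable g volume →
      Integrable (fun s => pastWeight N s * ‖g s‖) → ∀ (j : ℤ) (x : ℝ), 0 < x →
      x * Real.sqrt 2 ^ j ≤ 2 → eLpNorm (lpBlock φ j g) (ENNReal.ofReal q) volume ≤
        ENNReal.ofReal ((Real.sqrt 2 ^ j)⁻¹ * C) *
          eLpNorm (heatSlice g x) (ENNReal.ofReal q) volume := by
  obtain ⟨a, b, ha, hab, hsupp⟩ := hφ.annulus
  have hφ' : AnnulusSymbol a b (fun ξ => (φ ξ : ℂ)) :=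
    ⟨hφ.testSymbol.smooth, fun ξ h => hsupp ξ (by simpa using h)⟩
  have hA : AnnulusSymbol a b (fun ξ => (2 * (heatPhase ξ)⁻¹) * (φ ξ : ℂ)) :=
    hφ'.mul ha (contDiffOn_const.mul (contDiffOn_heatPhase.inv fun ξ hξ => heatPhase_ne_zero hξ))
  obtain ⟨C, hC0, hC⟩ := hA.exists_lintegral_symbolKernel_le ha (ha.trans hab).le
  -- With `w = x √2^j ≤ 2` one has `1 + w² ≤ 5`, and on the support `√(|ξ|/2) ≤ √b`, which bounds
  -- the growing exponential `e^{w√(iξ)}`.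
  refine ⟨C * (5 * Real.exp (2 * Real.sqrt b)), by positivity, fun g N hg hw j x hx hxj => ?_⟩
  set l : ℝ := Real.sqrt 2 ^ j with hl
  have hl0 : 0 < l := by positivity
  have hc : (0 : ℝ) < 2 ^ j := by positivity
  set F : ℝ → ℂ := fun ξ => Complex.exp ((x * l : ℝ) * heatPhase ξ) *
    ((2 * (heatPhase ξ)⁻¹) * (φ ξ : ℂ)) with hF
  have hFt : TestSymbol F := (hA.mul ha (AnnulusSymbol.contDiffOn_exp_heatPhase _)).testSymbol
  have hFn : ∫⁻ t, ‖symbolKernel F t‖ₑ ≤ ENNReal.ofReal (C * (5 * Real.exp (2 * Real.sqrt b))) := by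
    refine (hC (x * l) (Real.exp (2 * Real.sqrt b)) (by positivity) fun ξ _ h2 => ?_).trans
      (ENNReal.ofReal_le_ofReal ?_)
    · rw [norm_exp_mul_heatPhase]
      gcongr
      linarith [abs_nonneg ξ]
    · have : 0 < x * l := by positivity
      gcongr
      nlinarith
  have hm := hFt.const_mul_dilate ((l⁻¹ : ℝ) : ℂ) hc
  -- The multiplier is the inverse of the slice symbol on the band: by homogeneity of `√(iξ)` its
  -- size is `(√2^j)⁻¹` and the exponentials cancel. At `ξ = 0`, where the slice symbol is not
  -- computed, both sides vanish with `φ`.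
  have hsym : (fun ξ => (((l⁻¹ : ℝ) : ℂ) * F (((2 : ℝ) ^ j)⁻¹ * ξ)) *
      angularFourier (fun t => (heatKernelXX x t : ℂ)) ξ) = bandSymbol φ j := by
    funext ξ
    rcases eq_or_ne ξ 0 with rfl | hξ
    · simp [hF, bandSymbol, hφ.apply_zero]
    · rw [angularFourier_heatKernelXX hx hξ]
      change _ * (heatPhase ξ / 2 * Complex.exp (-(x * heatPhase ξ))) = _
      rw [heatPhase_dyadic j ξ, ← hl, hF, bandSymbol]
      have h1 : heatPhase (((2 : ℝ) ^ j)⁻¹ * ξ) ≠ 0 :=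
        heatPhase_ne_zero (mul_ne_zero (inv_ne_zero hc.ne') hξ)
      set z := heatPhase (((2 : ℝ) ^ j)⁻¹ * ξ)
      have h2 : (l : ℂ) ≠ 0 := by exact_mod_cast hl0.ne'
      have h3 : Complex.exp ((x * l : ℝ) * z) * Complex.exp (-(x * (l * z))) = 1 := by
        rw [← Complex.exp_add, ← Complex.exp_zero]
        congr 1
        push_cast; ring
      push_cast at h3 ⊢
      calc _ = ((l : ℂ)⁻¹ * l) * (z⁻¹ * z) * (Complex.exp (x * l * z) *
            Complex.exp (-(x * (l * z)))) * (φ (((2 : ℝ) ^ j)⁻¹ * ξ) : ℂ) := by ring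
        _ = _ := by rw [h3, inv_mul_cancel₀ h2, inv_mul_cancel₀ h1]; ring
  have hconv : lpBlock φ j g = fun t => ∫ r, symbolKernel
      (fun ξ => ((l⁻¹ : ℝ) : ℂ) * F (((2 : ℝ) ^ j)⁻¹ * ξ)) (t - r) * heatSlice g x r := by
    funext t
    rw [symbolKernel_conv_heatSlice hm hg hw hx, hsym, lpBlock_eq_symbolKernel]
  have hU : PolyGrowth (heatSlice g x) := polyGrowth_integral_heatKernelXX hg hw hx
  rw [hconv]
  refine (eLpNorm_conv_le (continuous_symbolKernel hm.integrable) hU.1.aestronglyMeasurable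
    hq).trans ?_
  gcongr
  rw [lintegral_symbolKernel_const_mul_dilate F (by positivity) hc,
    ENNReal.ofReal_mul (by positivity)]
  gcongr

/-- Comparing `e^{cy}` with `(cy)²/2` and `(cy)⁴/24` shows that the loss `1 + y²` is harmless.
Quadratic decay is all that the summation over scales uses. -/
lemma exp_decay_bound {c y : ℝ} (hc : 0 < c) (hy : 0 < y) :
    (1 + (-y) ^ 2) * Real.exp (-(c * y)) ≤
      (1 + 2 / c ^ 2 + 24 / c ^ 4) * min 1 (y ^ 2)⁻¹ := by
  have h0 : 1 ≤ Real.exp (c * y) := Real.one_le_exp (by positivity)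
  have h2 := Real.pow_div_factorial_le_exp (c * y) (by positivity) 2
  have h4 := Real.pow_div_factorial_le_exp (c * y) (by positivity) 4
  have hcy := Real.exp_pos (c * y)
  norm_num [Nat.factorial] at h2 h4
  have e2 : y ^ 2 ≤ 2 / c ^ 2 * Real.exp (c * y) := by
    rw [div_mul_eq_mul_div, le_div_iff₀ (by positivity)]; nlinarith
  have e4 : y ^ 4 ≤ 24 / c ^ 4 * Real.exp (c * y) := by
    rw [div_mul_eq_mul_div, le_div_iff₀ (by positivity)]; nlinarith
  have p2 : 0 < 2 / c ^ 2 := by positivity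
  have p4 : 0 < 24 / c ^ 4 := by positivity
  rw [Real.exp_neg, ← div_eq_mul_inv, div_le_iff₀ hcy]
  rcases min_choice 1 (y ^ 2)⁻¹ with h | h <;> rw [h]
  · nlinarith
  · rw [← div_eq_mul_inv, div_mul_eq_mul_div, le_div_iff₀ (by positivity)]
    nlinarith

/-- The blocks of the heat extension are controlled by those of the boundary function. -/
lemma exists_eLpNorm_lpBlock_heatSlice_le (hφ : IsLittlewoodPaleyCutoff φ) (hq : 1 ≤ q) :
    ∃ C : ℝ, 0 ≤ C ∧ ∀ (g : ℝ → ℂ) (N : ℕ), IsTemperedFunction g →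
      Integrable (fun s => pastWeight N s * ‖g s‖) → ∀ (j : ℤ) (x : ℝ), 0 < x →
      eLpNorm (lpBlock φ j (heatSlice g x)) (ENNReal.ofReal q) volume ≤
        ENNReal.ofReal (Real.sqrt 2 ^ j * (C * min 1 ((x * Real.sqrt 2 ^ j) ^ 2)⁻¹)) *
          eLpNorm (lpBlock φ j g) (ENNReal.ofReal q) volume := by
  obtain ⟨a, b, ha, hab, hsupp⟩ := hφ.annulus
  obtain ⟨χ, hχ, hχ1⟩ := exists_annulusSymbol_eq_one ha (ha.trans hab)
  have hA : AnnulusSymbol (a / 2) (2 * b) (fun ξ => (heatPhase ξ / 2) * χ ξ) :=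
    hχ.mul (by positivity) (contDiffOn_heatPhase.div_const 2)
  obtain ⟨C, hC0, hC⟩ := hA.exists_lintegral_symbolKernel_le (by positivity) (by linarith)
  -- The enlarged annulus starts at `a / 2`, so `√(|ξ|/2) ≥ √(a/4)` there; this is the rate of
  -- exponential decay.
  set c : ℝ := Real.sqrt (a / 4) with hc
  have hc0 : 0 < c := Real.sqrt_pos.2 (by positivity)
  refine ⟨C * (1 + 2 / c ^ 2 + 24 / c ^ 4), by positivity, fun g N hg hw j x hx => ?_⟩
  have hgm := hg.aestronglyMeasurable
  set l : ℝ := Real.sqrt 2 ^ j with hl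
  have hl0 : 0 < l := by positivity
  have hj : (0 : ℝ) < 2 ^ j := by positivity
  set F : ℝ → ℂ := fun ξ => Complex.exp ((-(x * l) : ℝ) * heatPhase ξ) *
    ((heatPhase ξ / 2) * χ ξ) with hF
  have hFt : TestSymbol F :=
    (hA.mul (by positivity) (AnnulusSymbol.contDiffOn_exp_heatPhase _)).testSymbol
  have hFn : ∫⁻ t, ‖symbolKernel F t‖ₑ ≤ ENNReal.ofReal
      (C * (1 + 2 / c ^ 2 + 24 / c ^ 4) * min 1 ((x * l) ^ 2)⁻¹) := by
    refine (hC (-(x * l)) (Real.exp (-(c * (x * l)))) (by positivity) fun ξ h1 _ => ?_).trans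
      (ENNReal.ofReal_le_ofReal ?_)
    · rw [norm_exp_mul_heatPhase]
      have h3 : c ≤ Real.sqrt (|ξ| / 2) := Real.sqrt_le_sqrt (by linarith)
      have : 0 < x * l := by positivity
      gcongr
      nlinarith
    · rw [mul_assoc]
      exact mul_le_mul_of_nonneg_left (exp_decay_bound hc0 (by positivity)) hC0
  have hm := hFt.const_mul_dilate (l : ℂ) hj
  have hband := hφ.testSymbol_band j
  -- The cutoff `χ` equals one on the support of `φ`, so inserting it changes nothing on the band.
  -- It makes the remaining factor a test symbol by itself, which can then be applied to `Δ_j g`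
  -- instead of `g`.
  have hsym : (fun ξ => bandSymbol φ j ξ *
      angularFourier (fun t => (heatKernelXX x t : ℂ)) ξ) = fun ξ =>
      ((l : ℂ) * F (((2 : ℝ) ^ j)⁻¹ * ξ)) * angularFourier (symbolKernel (bandSymbol φ j)) ξ := by
    funext ξ
    rw [angularFourier_symbolKernel_eq hband]
    by_cases hφξ : φ (((2 : ℝ) ^ j)⁻¹ * ξ) = 0
    · simp [bandSymbol, hφξ]
    · have hξ : ξ ≠ 0 := by
        rintro rfl
        exact hφξ (by rw [mul_zero, hφ.apply_zero])
      have hone := hχ1 _ (hsupp _ hφξ).1 (hsupp _ hφξ).2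
      rw [angularFourier_heatKernelXX hx hξ]
      change _ * (heatPhase ξ / 2 * Complex.exp (-(x * heatPhase ξ))) = _
      rw [heatPhase_dyadic j ξ, ← hl, hF, bandSymbol]
      dsimp only
      rw [hone]
      push_cast
      rw [show -((x : ℂ) * (l * heatPhase (((2 : ℝ) ^ j)⁻¹ * ξ))) =
        -(x * l) * heatPhase (((2 : ℝ) ^ j)⁻¹ * ξ) by ring]
      ring
  have hconv : lpBlock φ j (heatSlice g x) = fun t => ∫ r, symbolKernel
      (fun ξ => (l : ℂ) * F (((2 : ℝ) ^ j)⁻¹ * ξ)) (t - r) * lpBlock φ j g r := by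
    funext t
    rw [lpBlock_eq_symbolKernel, symbolKernel_conv_heatSlice hband hgm hw hx, hsym]
    simp_rw [lpBlock_eq_symbolKernel φ j g]
    exact (symbolKernel_conv_conv hm
      (continuous_symbolKernel hband.integrable).stronglyMeasurable
      (integrable_symbolKernel hband) hgm (convGrowth_symbolKernel hband hg) t).symm
  rw [hconv]
  refine (eLpNorm_conv_le (continuous_symbolKernel hm.integrable)
    (hφ.continuous_lpBlock hg j).aestronglyMeasurable hq).trans ?_
  gcongr
  rw [lintegral_symbolKernel_const_mul_dilate F (by positivity) hj,
    ENNReal.ofReal_mul (by positivity)]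
  gcongr

/-- The heat extension at a fixed height is controlled by the blocks of the boundary function. -/
lemma exists_eLpNorm_heatSlice_le (hφ : IsLittlewoodPaleyCutoff φ) (hq : 1 ≤ q) :
    ∃ C : ℝ, 0 ≤ C ∧ ∀ (g : ℝ → ℂ) (N : ℕ), IsTemperedFunction g →
      Integrable (fun s => pastWeight N s * ‖g s‖) → ∀ x : ℝ, 0 < x →
      eLpNorm (heatSlice g x) (ENNReal.ofReal q) volume ≤ ∑' j : ℤ,
        ENNReal.ofReal (Real.sqrt 2 ^ j * (C * min 1 ((x * Real.sqrt 2 ^ j) ^ 2)⁻¹)) *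
          eLpNorm (lpBlock φ j g) (ENNReal.ofReal q) volume := by
  obtain ⟨C, hC0, hC⟩ := hφ.exists_eLpNorm_lpBlock_heatSlice_le hq
  refine ⟨C, hC0, fun g N hg hw x hx => ?_⟩
  have hgm := hg.aestronglyMeasurable
  exact (hφ.eLpNorm_le_tsum (polyGrowth_integral_heatKernelXX hgm hw hx)
    (meanVanishesInPast_integral_heatKernelXX hgm hw hx) hq).trans
    (ENNReal.tsum_le_tsum fun j => hC g N hg hw j x hx)

end IsLittlewoodPaleyCutoff

/-! ### Summation over dyadic scales -/

lemma ofReal_sqrt_two_zpow (j : ℤ) :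
    ENNReal.ofReal (Real.sqrt 2 ^ j) = (2 : ℝ≥0∞) ^ ((j : ℝ) / 2) := by
  have h : Real.sqrt 2 ^ j = (2 : ℝ) ^ ((j : ℝ) / 2) := by
    rw [Real.sqrt_eq_rpow, ← Real.rpow_intCast, ← Real.rpow_mul (by norm_num)]
    congr 1; ring
  rw [h, ← ENNReal.ofReal_rpow_of_pos (by norm_num)]
  norm_num

lemma two_rpow_add (x y : ℝ) : (2 : ℝ≥0∞) ^ (x + y) = 2 ^ x * 2 ^ y :=
  ENNReal.rpow_add x y (by norm_num) (by norm_num)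

/-- The heights comparable to the scale `2^{-j}` in time. -/
def heightTile (j : ℤ) : Set ℝ := Ico (Real.sqrt 2 ^ (-j)) (Real.sqrt 2 ^ (-j + 1))

lemma one_lt_sqrt_two : 1 < Real.sqrt 2 := by
  rw [Real.lt_sqrt (by norm_num)]; norm_num

lemma lintegral_Ioi_eq_tsum_heightTile (f : ℝ → ℝ≥0∞) :
    ∫⁻ x in Ioi 0, f x = ∑' j : ℤ, ∫⁻ x in heightTile j, f x := by
  have h1 : Ioi (0 : ℝ) = ⋃ j : ℤ, Ico (Real.sqrt 2 ^ j) (Real.sqrt 2 ^ (j + 1)) := by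
    ext x
    rw [mem_iUnion]
    refine ⟨fun hx => exists_mem_Ico_zpow hx one_lt_sqrt_two, fun ⟨j, hj⟩ => ?_⟩
    exact lt_of_lt_of_le (by positivity) hj.1
  have h2 : Pairwise (Function.onFun Disjoint
      fun j : ℤ => Ico (Real.sqrt 2 ^ j) (Real.sqrt 2 ^ (j + 1))) :=
    (zpow_right_mono₀ one_lt_sqrt_two.le).pairwise_disjoint_on_Ico_succ
  rw [h1, lintegral_iUnion (fun _ => measurableSet_Ico) h2]
  -- Tiles are indexed by time frequency, so small heights correspond to large `j`; hence the
  -- reflection of the index.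
  exact ((Equiv.neg ℤ).tsum_eq fun j => ∫⁻ x in Ico (Real.sqrt 2 ^ j) (Real.sqrt 2 ^ (j + 1)),
    f x).symm

lemma volume_heightTile (j : ℤ) :
    volume (heightTile j) = ENNReal.ofReal (Real.sqrt 2 - 1) * 2 ^ (-(j : ℝ) / 2) := by
  have h : Real.sqrt 2 ^ (-j + 1) - Real.sqrt 2 ^ (-j) =
      (Real.sqrt 2 - 1) * Real.sqrt 2 ^ (-j) := by
    rw [zpow_add_one₀ (by positivity)]; ring
  rw [heightTile, Real.volume_Ico, h, ENNReal.ofReal_mul (by linarith [one_lt_sqrt_two]),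
    ofReal_sqrt_two_zpow]
  push_cast
  rfl

lemma pos_of_mem_heightTile {j : ℤ} {x : ℝ} (hx : x ∈ heightTile j) : 0 < x :=
  lt_of_lt_of_le (by positivity) hx.1

lemma mul_le_two_of_mem_heightTile {j : ℤ} {x : ℝ} (hx : x ∈ heightTile j) :
    x * Real.sqrt 2 ^ j ≤ 2 := by
  have h1 : x * Real.sqrt 2 ^ j ≤ Real.sqrt 2 ^ (-j + 1) * Real.sqrt 2 ^ j := by
    gcongr; exact hx.2.le
  rw [← zpow_add₀ (by positivity)] at h1
  have h2 : Real.sqrt 2 ≤ 2 := by rw [Real.sqrt_le_left (by norm_num)]; norm_num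
  have h3 : -j + 1 + j = 1 := by ring
  rw [h3, zpow_one] at h1
  linarith

lemma sq_inv_le_of_mem_heightTile {i : ℤ} {x : ℝ} (hx : x ∈ heightTile i) (j : ℤ) :
    ENNReal.ofReal ((x * Real.sqrt 2 ^ j) ^ 2)⁻¹ ≤ 2 ^ ((i : ℝ) - j) := by
  have h1 : Real.sqrt 2 ^ (-i) * Real.sqrt 2 ^ j ≤ x * Real.sqrt 2 ^ j := by
    gcongr; exact hx.1
  rw [← zpow_add₀ (by positivity)] at h1
  have h2 : ((x * Real.sqrt 2 ^ j) ^ 2)⁻¹ ≤ ((Real.sqrt 2 ^ (-i + j)) ^ 2)⁻¹ := by gcongr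
  refine (ENNReal.ofReal_le_ofReal h2).trans (le_of_eq ?_)
  rw [sqrt_two_zpow_sq, ← zpow_neg, ← Real.rpow_intCast, ← ENNReal.ofReal_rpow_of_pos (by norm_num)]
  norm_num
  ring_nf

/-- The geometric weights `2^{-|n|/(2q)}`. -/
noncomputable def dyadicDecay (q : ℝ) (n : ℤ) : ℝ≥0∞ := ((2 : ℝ≥0∞) ^ (-(1 / (2 * q)))) ^ n.natAbs

lemma dyadicDecay_eq (q : ℝ) (n : ℤ) : dyadicDecay q n = 2 ^ (-(|(n : ℝ)| / (2 * q))) := by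
  rw [dyadicDecay, ← ENNReal.rpow_natCast, ← ENNReal.rpow_mul, Nat.cast_natAbs, Int.cast_abs]
  congr 1; ring

/-- Two geometric series with ratio `2^{-1/(2q)} < 1`; finiteness of `q` enters here. -/
lemma tsum_dyadicDecay_ne_top {q : ℝ} (hq : 0 < q) : ∑' n, dyadicDecay q n ≠ ⊤ := by
  set r : ℝ≥0∞ := (2 : ℝ≥0∞) ^ (-(1 / (2 * q))) with hr
  have hr1 : r < 1 := ENNReal.rpow_lt_one_of_one_lt_of_neg (by norm_num) (by
    have : 0 < 1 / (2 * q) := by positivity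
    linarith)
  have hg : (1 - r)⁻¹ ≠ ⊤ := ENNReal.inv_ne_top.2 (tsub_pos_of_lt hr1).ne'
  have h1 : HasSum (fun n : ℕ => dyadicDecay q n) (1 - r)⁻¹ := by
    rw [← ENNReal.tsum_geometric]; exact ENNReal.summable.hasSum
  have h2 : HasSum (fun n : ℕ => dyadicDecay q (-(n + 1))) (∑' n : ℕ, r ^ (n + 1)) := by
    have : ∀ n : ℕ, dyadicDecay q (-(n + 1)) = r ^ (n + 1) := fun n => by
      rw [dyadicDecay, Int.natAbs_neg]; rfl
    simp_rw [this]
    exact ENNReal.summable.hasSum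
  rw [(h1.of_nat_of_neg_add_one h2).tsum_eq]
  refine ENNReal.add_ne_top.2 ⟨hg, ?_⟩
  simp_rw [pow_succ]
  rw [ENNReal.tsum_mul_right, ENNReal.tsum_geometric]
  exact ENNReal.mul_ne_top hg (hr1.trans ENNReal.one_lt_top).ne

/-- Young's inequality for convolution with the geometric weights. -/
lemma tsum_dyadicDecay_conv_rpow_le {q : ℝ} (hq : 1 ≤ q) (b : ℤ → ℝ≥0∞) :
    ∑' i : ℤ, (∑' j : ℤ, dyadicDecay q (j - i) * b j) ^ q ≤
      (∑' n, dyadicDecay q n) ^ q * ∑' j, b j ^ q := by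
  have h := lintegral_rpow_kernel_le (μ := (Measure.count : Measure ℤ))
    (ν := (Measure.count : Measure ℤ)) (K := fun i j => dyadicDecay q (j - i))
    (measurable_of_countable _) (measurable_of_countable b).aemeasurable
    (A := ∑' n, dyadicDecay q n) (fun i => ?_) (fun j => ?_) hq
  · simpa only [lintegral_count] using h
  · rw [lintegral_count]
    exact ((Equiv.subRight i).tsum_eq (dyadicDecay q)).le
  · rw [lintegral_count]
    exact ((Equiv.subLeft j).tsum_eq (dyadicDecay q)).le

/-- The `q`-th power of the Besov norm is a sum over the blocks. -/
lemma homBesovNorm_rpow (φ : ℝ → ℝ) (g : ℝ → ℂ) {q : ℝ} (hq : 1 ≤ q) :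
    homBesovNorm φ (1 / 2 - 1 / (2 * q)) (ENNReal.ofReal q) q g ^ q =
      ∑' j : ℤ, 2 ^ ((j : ℝ) / 2 * (q - 1)) *
        eLpNorm (lpBlock φ j g) (ENNReal.ofReal q) volume ^ q := by
  have hq0 : 0 < q := by linarith
  rw [homBesovNorm, ← ENNReal.rpow_mul, one_div_mul_cancel hq0.ne', ENNReal.rpow_one]
  refine tsum_congr fun j => ?_
  congr 2
  field_simp

lemma eLpNorm_heatExtensionXX_rpow {g : ℝ → ℂ} (hg : AEStronglyMeasurable g volume)
    (hi : ∀ x t : ℝ, 0 < x → Integrable (fun s : ℝ => (heatKernel x (t - s) : ℂ) * g s))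
    {q : ℝ} (hq : 1 ≤ q) :
    eLpNorm (heatExtensionXX g) (ENNReal.ofReal q) (volume.restrict (Ioi (0 : ℝ) ×ˢ univ)) ^ q =
      ∫⁻ x in Ioi 0, eLpNorm (heatSlice g x) (ENNReal.ofReal q) volume ^ q := by
  have hm := aestronglyMeasurable_heatExtensionXX hg hi
  rw [eLpNorm_rpow_eq _ hq]
  rw [Measure.volume_eq_prod, ← Measure.prod_restrict, Measure.restrict_univ] at hm ⊢
  rw [lintegral_prod _ (hm.enorm.pow_const q)]
  refine setLIntegral_congr_fun measurableSet_Ioi fun x hx => ?_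
  rw [eLpNorm_rpow_eq _ hq]
  refine lintegral_congr fun t => ?_
  rw [heatExtensionXX_eq hg hi hx, heatSlice]

namespace IsLittlewoodPaleyCutoff

variable {φ : ℝ → ℝ} {q : ℝ}

lemma exists_homBesovNorm_le (hφ : IsLittlewoodPaleyCutoff φ) (hq : 1 ≤ q) :
    ∃ C : ℝ≥0∞, C ≠ ⊤ ∧ ∀ g : ℝ → ℂ, IsTemperedFunction g →
      (∀ x t : ℝ, 0 < x → Integrable (fun s : ℝ => (heatKernel x (t - s) : ℂ) * g s)) →
      homBesovNorm φ (1 / 2 - 1 / (2 * q)) (ENNReal.ofReal q) q g ≤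
        C * eLpNorm (heatExtensionXX g) (ENNReal.ofReal q)
          (volume.restrict (Ioi (0 : ℝ) ×ˢ univ)) := by
  have hq0 : 0 < q := by linarith
  obtain ⟨C, hC0, hC⟩ := hφ.exists_eLpNorm_lpBlock_le hq
  set e : ℝ≥0∞ := ENNReal.ofReal (Real.sqrt 2 - 1) with he
  have he0 : e ≠ 0 := (ENNReal.ofReal_pos.2 (by linarith [one_lt_sqrt_two])).ne'
  set D : ℝ≥0∞ := ENNReal.ofReal C with hD
  have hDt : D ^ q ≠ ⊤ := ENNReal.rpow_ne_top_of_nonneg hq0.le ENNReal.ofReal_ne_top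
  refine ⟨(e⁻¹ * D ^ q) ^ (1 / q), ENNReal.rpow_ne_top_of_nonneg (by positivity)
    (ENNReal.mul_ne_top (ENNReal.inv_ne_top.2 he0) hDt), fun g hg hi => ?_⟩
  have hgm := hg.aestronglyMeasurable
  obtain ⟨N, hw⟩ := integrable_pastWeight hg hi
  rw [← ENNReal.rpow_le_rpow_iff hq0, ENNReal.mul_rpow_of_nonneg _ _ hq0.le, ← ENNReal.rpow_mul,
    one_div_mul_cancel hq0.ne', ENNReal.rpow_one, homBesovNorm_rpow φ g hq,
    eLpNorm_heatExtensionXX_rpow hgm hi hq, lintegral_Ioi_eq_tsum_heightTile,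
    ← ENNReal.tsum_mul_left]
  refine ENNReal.tsum_le_tsum fun j => ?_
  set B := eLpNorm (lpBlock φ j g) (ENNReal.ofReal q) volume
  -- The block norm does not depend on the height, so the pointwise bound may be integrated over the
  -- whole tile. The tile measure, proportional to `2^{-j/2}`, turns `2^{jq/2}` into the Besov
  -- weight.
  have h1 : ∫⁻ _ in heightTile j, B ^ q ≤ ∫⁻ x in heightTile j, (2 ^ (-(j : ℝ) / 2 * q) * D ^ q) *
      eLpNorm (heatSlice g x) (ENNReal.ofReal q) volume ^ q := by
    refine setLIntegral_mono' measurableSet_Ico fun x hx => ?_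
    refine (ENNReal.rpow_le_rpow (hC g N hgm hw j x (pos_of_mem_heightTile hx)
      (mul_le_two_of_mem_heightTile hx)) hq0.le).trans (le_of_eq ?_)
    rw [ENNReal.mul_rpow_of_nonneg _ _ hq0.le, ENNReal.ofReal_mul (by positivity),
      ENNReal.mul_rpow_of_nonneg _ _ hq0.le, ← zpow_neg, ofReal_sqrt_two_zpow, ← ENNReal.rpow_mul]
    push_cast
    rfl
  rw [lintegral_const_mul' _ _ (ENNReal.mul_ne_top (ENNReal.rpow_ne_top_of_ne_zero (by norm_num)
    (by norm_num)) hDt), lintegral_const, Measure.restrict_apply_univ, volume_heightTile, ← he] at h1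
  set J := ∫⁻ x in heightTile j, eLpNorm (heatSlice g x) (ENNReal.ofReal q) volume ^ q
  calc (2 : ℝ≥0∞) ^ ((j : ℝ) / 2 * (q - 1)) * B ^ q
      = e⁻¹ * (2 ^ ((j : ℝ) / 2 * q) * (B ^ q * (e * 2 ^ (-(j : ℝ) / 2)))) := by
        rw [show (j : ℝ) / 2 * (q - 1) = (j : ℝ) / 2 * q + -(j : ℝ) / 2 by ring, two_rpow_add]
        rw [show ∀ u v w : ℝ≥0∞, e⁻¹ * (u * (w * (e * v))) = (e⁻¹ * e) * (u * v * w) by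
          intros; ring, ENNReal.inv_mul_cancel he0 ENNReal.ofReal_ne_top, one_mul]
    _ ≤ e⁻¹ * (2 ^ ((j : ℝ) / 2 * q) * (2 ^ (-(j : ℝ) / 2 * q) * D ^ q * J)) := by gcongr
    _ = _ := by
        rw [show ∀ u v : ℝ≥0∞, e⁻¹ * (u * (v * D ^ q * J)) = (u * v) * (e⁻¹ * D ^ q * J) by
          intros; ring, ← two_rpow_add]
        rw [show (j : ℝ) / 2 * q + -(j : ℝ) / 2 * q = 0 by ring, ENNReal.rpow_zero, one_mul]

/-- At heights in the `i`-th tile the contributions of the blocks decay geometrically. -/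
lemma coefficient_le {C : ℝ} (hq : 1 ≤ q) {i : ℤ} {x : ℝ} (hx : x ∈ heightTile i) (j : ℤ)
    (B : ℝ≥0∞) :
    ENNReal.ofReal (Real.sqrt 2 ^ j * (C * min 1 ((x * Real.sqrt 2 ^ j) ^ 2)⁻¹)) * B ≤
      (ENNReal.ofReal C * 2 ^ ((i : ℝ) / (2 * q))) *
        (dyadicDecay q (j - i) * (2 ^ ((j : ℝ) * (1 / 2 - 1 / (2 * q))) * B)) := by
  have hq0 : 0 < q := by linarith
  have hmin : 0 ≤ min 1 ((x * Real.sqrt 2 ^ j) ^ 2)⁻¹ := by positivity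
  -- The factor `2^{j/2}` splits as `2^{i/(2q)} · 2^{(j-i)/(2q)} · 2^{j(1/2-1/(2q))}`, so it remains
  -- to bound `2^{(j-i)/(2q)} min(1, 2^{i-j})` by `2^{-|j-i|/(2q)}`. For `j ≤ i` the minimum is
  -- replaced by `1` and equality results; for `j ≥ i` this is `(j-i)/q ≤ j-i`, which uses `q ≥ 1`.
  have h0 : ENNReal.ofReal (min 1 ((x * Real.sqrt 2 ^ j) ^ 2)⁻¹) ≤ 2 ^ (((i : ℝ) - j) / (2 * q) +
      -(|((j - i : ℤ) : ℝ)| / (2 * q))) := by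
    push_cast
    rcases le_total i j with hij | hij
    · have hij' : (0 : ℝ) ≤ j - i := by rw [sub_nonneg]; exact_mod_cast hij
      refine ((ENNReal.ofReal_le_ofReal (min_le_right _ _)).trans
        (sq_inv_le_of_mem_heightTile hx j)).trans ?_
      refine ENNReal.rpow_le_rpow_of_exponent_le (by norm_num) ?_
      rw [abs_of_nonneg hij']
      have : ((j : ℝ) - i) / q ≤ j - i := div_le_self hij' hq
      have e : ((i : ℝ) - j) / (2 * q) + -((j - i) / (2 * q)) = -((j - i) / q) := by
        field_simp; ring
      rw [e]; linarith
    · have hij' : (j : ℝ) - i ≤ 0 := by rw [sub_nonpos]; exact_mod_cast hij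
      refine (ENNReal.ofReal_le_ofReal (min_le_left _ _)).trans (le_of_eq ?_)
      rw [abs_of_nonpos hij', show ((i : ℝ) - j) / (2 * q) + -(-((j : ℝ) - i) / (2 * q)) = 0 by ring]
      simp
  rw [ENNReal.ofReal_mul (by positivity), ENNReal.ofReal_mul' hmin, ofReal_sqrt_two_zpow,
    dyadicDecay_eq]
  calc _ ≤ 2 ^ ((j : ℝ) / 2) * (ENNReal.ofReal C * 2 ^ (((i : ℝ) - j) / (2 * q) +
      -(|((j - i : ℤ) : ℝ)| / (2 * q)))) * B := by gcongr
    _ = (2 ^ ((j : ℝ) / 2) * 2 ^ (((i : ℝ) - j) / (2 * q) +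
      -(|((j - i : ℤ) : ℝ)| / (2 * q)))) * (ENNReal.ofReal C * B) := by ring
    _ = (2 ^ ((i : ℝ) / (2 * q)) * (2 ^ (-(|((j - i : ℤ) : ℝ)| / (2 * q))) *
      2 ^ ((j : ℝ) * (1 / 2 - 1 / (2 * q))))) * (ENNReal.ofReal C * B) := by
        rw [← two_rpow_add, ← two_rpow_add, ← two_rpow_add]
        congr 2; ring
    _ = _ := by ring

lemma exists_eLpNorm_heatExtensionXX_le (hφ : IsLittlewoodPaleyCutoff φ) (hq : 1 ≤ q) :
    ∃ C : ℝ≥0∞, C ≠ ⊤ ∧ ∀ g : ℝ → ℂ, IsTemperedFunction g →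
      (∀ x t : ℝ, 0 < x → Integrable (fun s : ℝ => (heatKernel x (t - s) : ℂ) * g s)) →
      eLpNorm (heatExtensionXX g) (ENNReal.ofReal q) (volume.restrict (Ioi (0 : ℝ) ×ˢ univ)) ≤
        C * homBesovNorm φ (1 / 2 - 1 / (2 * q)) (ENNReal.ofReal q) q g := by
  have hq0 : 0 < q := by linarith
  obtain ⟨C, hC0, hC⟩ := hφ.exists_eLpNorm_heatSlice_le hq
  set e : ℝ≥0∞ := ENNReal.ofReal (Real.sqrt 2 - 1) with he
  set D : ℝ≥0∞ := ENNReal.ofReal C with hD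
  set A : ℝ≥0∞ := ∑' n, dyadicDecay q n with hA
  have hDt : D ^ q ≠ ⊤ := ENNReal.rpow_ne_top_of_nonneg hq0.le ENNReal.ofReal_ne_top
  have hAt : A ^ q ≠ ⊤ := ENNReal.rpow_ne_top_of_nonneg hq0.le (tsum_dyadicDecay_ne_top hq0)
  refine ⟨(e * D ^ q * A ^ q) ^ (1 / q), ENNReal.rpow_ne_top_of_nonneg (by positivity)
    (ENNReal.mul_ne_top (ENNReal.mul_ne_top ENNReal.ofReal_ne_top hDt) hAt), fun g hg hi => ?_⟩
  have hgm := hg.aestronglyMeasurable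
  obtain ⟨N, hw⟩ := integrable_pastWeight hg hi
  rw [← ENNReal.rpow_le_rpow_iff hq0, ENNReal.mul_rpow_of_nonneg _ _ hq0.le, ← ENNReal.rpow_mul,
    one_div_mul_cancel hq0.ne', ENNReal.rpow_one, homBesovNorm_rpow φ g hq,
    eLpNorm_heatExtensionXX_rpow hgm hi hq, lintegral_Ioi_eq_tsum_heightTile]
  set b : ℤ → ℝ≥0∞ := fun j => 2 ^ ((j : ℝ) * (1 / 2 - 1 / (2 * q))) *
    eLpNorm (lpBlock φ j g) (ENNReal.ofReal q) volume with hb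
  have hbq : ∀ j : ℤ, 2 ^ ((j : ℝ) / 2 * (q - 1)) *
      eLpNorm (lpBlock φ j g) (ENNReal.ofReal q) volume ^ q = b j ^ q := fun j => by
    rw [hb, ENNReal.mul_rpow_of_nonneg _ _ hq0.le, ← ENNReal.rpow_mul]
    congr 2
    field_simp
  simp_rw [hbq]
  -- The factor `2^{i/(2q)}` raised to the power `q` is exactly compensated by the tile measure,
  -- proportional to `2^{-i/2}`; this fixes the smoothness exponent `1/2 - 1/(2q)`.
  have htile : ∀ i : ℤ, ∫⁻ x in heightTile i, eLpNorm (heatSlice g x) (ENNReal.ofReal q) volume ^ q ≤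
      e * D ^ q * (∑' j, dyadicDecay q (j - i) * b j) ^ q := fun i => by
    set S := ∑' j, dyadicDecay q (j - i) * b j
    calc _ ≤ ∫⁻ _ in heightTile i, (D * 2 ^ ((i : ℝ) / (2 * q)) * S) ^ q := by
          refine setLIntegral_mono' measurableSet_Ico fun x hx => ENNReal.rpow_le_rpow ?_ hq0.le
          refine (hC g N hg hw x (pos_of_mem_heightTile hx)).trans ?_
          rw [← ENNReal.tsum_mul_left]
          exact ENNReal.tsum_le_tsum fun j => coefficient_le hq hx j _
      _ = (D * 2 ^ ((i : ℝ) / (2 * q)) * S) ^ q * (e * 2 ^ (-(i : ℝ) / 2)) := by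
          rw [lintegral_const, Measure.restrict_apply_univ, volume_heightTile]
      _ = (2 ^ ((i : ℝ) / (2 * q) * q) * 2 ^ (-(i : ℝ) / 2)) * (e * D ^ q * S ^ q) := by
          rw [ENNReal.mul_rpow_of_nonneg _ _ hq0.le, ENNReal.mul_rpow_of_nonneg _ _ hq0.le,
            ← ENNReal.rpow_mul]
          ring
      _ = _ := by
          rw [← two_rpow_add]
          have : (i : ℝ) / (2 * q) * q + -(i : ℝ) / 2 = 0 := by field_simp; ring
          rw [this, ENNReal.rpow_zero, one_mul]
  calc _ ≤ ∑' i : ℤ, e * D ^ q * (∑' j, dyadicDecay q (j - i) * b j) ^ q :=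
        ENNReal.tsum_le_tsum htile
    _ ≤ e * D ^ q * (A ^ q * ∑' j, b j ^ q) := by
        rw [ENNReal.tsum_mul_left]
        gcongr
        exact tsum_dyadicDecay_conv_rpow_le hq b
    _ = _ := by ring

end IsLittlewoodPaleyCutoff

theorem lemma2p7 (φ : ℝ → ℝ) (hφ : IsLittlewoodPaleyCutoff φ) (q : ℝ) (hq : 1 ≤ q) :
    ∃ C : ℝ≥0, ∀ g : ℝ → ℂ, IsTemperedFunction g →
      (∀ x t : ℝ, 0 < x → Integrable (fun s : ℝ => (heatKernel x (t - s) : ℂ) * g s)) →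
      (∀ t : ℝ, ContDiffOn ℝ 2 (fun x : ℝ => heatExtension g x t) (Ioi 0)) ∧
      AEStronglyMeasurable (heatExtensionXX g) (volume.restrict (Ioi (0 : ℝ) ×ˢ univ)) ∧
      homBesovNorm φ (1 / 2 - 1 / (2 * q)) (ENNReal.ofReal q) q g ≤
        C * eLpNorm (heatExtensionXX g) (ENNReal.ofReal q)
          (volume.restrict (Ioi (0 : ℝ) ×ˢ univ)) ∧
      eLpNorm (heatExtensionXX g) (ENNReal.ofReal q)
          (volume.restrict (Ioi (0 : ℝ) ×ˢ univ)) ≤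
        C * homBesovNorm φ (1 / 2 - 1 / (2 * q)) (ENNReal.ofReal q) q g := by
  obtain ⟨C₁, h₁, hC₁⟩ := hφ.exists_homBesovNorm_le hq
  obtain ⟨C₂, h₂, hC₂⟩ := hφ.exists_eLpNorm_heatExtensionXX_le hq
  refine ⟨(max C₁ C₂).toNNReal, fun g hg hi => ?_⟩
  have hgm := hg.aestronglyMeasurable
  rw [ENNReal.coe_toNNReal (max_lt h₁.lt_top h₂.lt_top).ne]
  refine ⟨fun t => contDiffOn_heatExtension hgm hi t, aestronglyMeasurable_heatExtensionXX hgm hi,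
    (hC₁ g hg hi).trans ?_, (hC₂ g hg hi).trans ?_⟩ <;> gcongr
  · exact le_max_left _ _
  · exact le_max_right _ _
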